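/- **Setting.** On $\mathbb R^{1+3}$ use Cartesian coordinates $(x^0,x^1,x^2,x^3)$, $x^0=t$; Greek indices run over $0,\dots,3$, Latin indices over $1,2,3$, and repeated indices are summed. Let $\bar\varrho>0$ be a constant and $p=p(\varrho,s)$ a smooth equation of state on $\{\varrho>0\}$. Let $\mathcal M$ be a compact set contained in an open set $\mathscr O\subset\mathbb R^{1+3}$, and let $\varrho$, $v=(v^1,v^2,v^3)$, $s$ be smooth functions on $\mathscr O$ with $\varrho>0$ and $\partial p/\partial\varrho>0$ on $\mathcal M$. Put $\rho=\ln(\varrho/\bar\varrho)$, $c=\sqrt{\partial p/\partial\varrho}$, $p_{;s}=\partial p/\partial s$ (at fixed $\varrho$), $\mathbf B=\partial_t+v^a\partial_a$, and assume that on $\mathcal M$ the compressible Euler equations hold: $$\mathbf B\rho=-\partial_av^a,\qquad \mathbf Bv^i=-c^2\partial_i\rho-e^{-\rho}\tfrac{p_{;s}}{\bar\varrho}\partial_is,\qquad \mathbf Bs=0 .$$ Let $\Omega^i=e^{-\rho}(\mathrm{curl}\,v)^i$, $S^i=\partial_is$, and $\mathcal C^i=e^{-\rho}(\mathrm{curl}\,\Omega)^i+e^{-3\rho}c^{-2}\frac{p_{;s}}{\bar\varrho}\{S^a\partial_av^i-(\partial_av^a)S^i\}$,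 regarded as spacetime vectorfields with vanishing $0$-component; likewise $v^0:=0$ wherever $v$ carries a Greek index. Let $$\mathbf g=-dt\otimes dt+c^{-2}\sum_a(dx^a-v^adt)\otimes(dx^a-v^adt),\qquad \mathbf g^{-1}=-\mathbf B\otimes\mathbf B+c^2\sum_a\partial_a\otimes\partial_a .$$ Indices are lowered with $\mathbf g$, $(g^{-1})^{ab}=c^2\delta^{ab}$, and $\epsilon_{\alpha\beta\gamma\delta}$ is the antisymmetric symbol with $\epsilon_{0123}=1$. **Region.** Let $T>0$ and let $\tau$ be smooth on $\mathscr O$ with $\mathbf B\tau>0$ and $(\mathbf g^{-1})^{\alpha\beta}\partial_\alpha\tau\,\partial_\beta\tau<0$ on $\mathcal M$. Let $\underline{\mathcal H}\subset\mathcal M$ (the lateral boundary) be such that every $q\in\mathcal M\setminus\underline{\mathcal H}$ has an open neighbourhood in which $\mathcal M$ coincides with $\{0\le\tau\le T\}$, and every $q\in\underline{\mathcal H}$ has an open neighbourhood and a smooth function $u$ on it, with $du(q),d\tau(q)$ linearly independent, in which $\mathcal M$ coincides with $\{u\le0,\ 0\le\tau\le T\}$ and $\underline{\mathcal H}$ with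 $\{u=0,\ 0\le\tau\le T\}$. Assume that $\underline{\mathcal H}$ is $\mathbf g$-spacelike at all its points or $\mathbf g$-null at all its points. (As usual, $\tau$ also denotes values of this function.) For $0\le\tau'\le T$ set $\widetilde\Sigma_{\tau'}=\mathcal M\cap\{\tau=\tau'\}$, $\mathcal S_{\tau'}=\underline{\mathcal H}\cap\widetilde\Sigma_{\tau'}$, $\underline{\mathcal H}_{\tau'}=\bigcup_{0\le\tau''\le\tau'}\mathcal S_{\tau''}$. **Vectorfields and scalars along $\underline{\mathcal H}$.** $N$ is the $\mathbf g$-normal of $\widetilde\Sigma_\tau$ with $Nt=1$; $\underline N$ the $\mathbf g$-normal of $\underline{\mathcal H}$ with $\underline Nt=1$; $Z$ the $\mathbf g$-unit outer normal of $\mathcal S_\tau$ in $\widetilde\Sigma_\tau$; $\underline H$ is tangent to $\underline{\mathcal H}$, $\mathbf g$-orthogonal to $\mathcal S_\tau$, with $\underline Ht=1$ (assumed to exist). Put $\underline z=-\mathbf g(Z,\underline N)$, $\underline h=-\mathbf g(\underline H,N)$ and assume $\underline z>0$, $\underline h>0$ on $\underline{\mathcal H}$. Let $\nu=\sqrt{-\mathbf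 g(N,N)}$, $\hat N=N/\nu$, $\underline\eta=\sqrt{\mathbf g(\underline H,\underline H)}$, $\lambda=1/(\underline H\tau)$, $$\Theta=\mathbf B-\tfrac1{\underline h}\underline H-\tfrac1{\underline z}Z,\quad \underline E=\mathbf B-\tfrac1{\underline z}Z,\quad P=\tfrac{\underline N-N}{\underline h},\quad e_\alpha=\partial_\alpha+\underline N_\alpha\mathbf B-P_\alpha\underline H,$$ $$k=\tfrac{S^a\underline N_a-S^aN_a}{\underline h},\quad U=S+S^a\underline N_a\mathbf B-k\underline H,\quad Y=k\Theta-\tfrac1{\underline h}U .$$ Let $\widetilde\Pi^\alpha{}_\beta=\delta^\alpha_\beta+\hat N^\alpha\hat N_\beta$, $\not{\Pi}^\alpha{}_\beta=\widetilde\Pi^\alpha{}_\beta-Z^\alpha Z_\beta$, $\not{g}_{\alpha\beta}=\mathbf g_{\alpha\beta}+\hat N_\alpha\hat N_\beta-Z_\alpha Z_\beta$, $(\not{g}^{-1})^{\alpha\beta}=(\mathbf g^{-1})^{\alpha\beta}+\hat N^\alpha\hat N^\beta-Z^\alpha Z^\beta$. For a vectorfield $V$ put $\not{V}=\not{\Pi}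 V$ and $|\not{V}|^2=\not{g}(\not{V},\not{V})$; let $\not{\partial}_\beta=\not{\Pi}\,\partial_\beta$, let $\mathrm{div}_{\mathcal S}$ be the divergence on $\mathcal S_\tau$ with respect to the Levi-Civita connection of the induced metric $\not{g}$, and let $\mathcal L$ denote the Lie derivative. $d\varpi_{\not{g}}$ is the area form of $\not{g}$ on $\mathcal S_\tau$, and integrals over $\underline{\mathcal H}_\tau$ are taken with respect to $d\varpi_{\not{g}}\,d\tau'$, i.e. $\int_{\underline{\mathcal H}_\tau}f\,d\varpi_{\not{g}}d\tau'=\int_0^\tau\big(\int_{\mathcal S_{\tau'}}f\,d\varpi_{\not{g}}\big)d\tau'$. For $V\in\{\Omega,S\}$ let $$J^\alpha[V]=V^\gamma\widetilde\Pi^\lambda{}_\gamma\widetilde\Pi^\alpha{}_\kappa\partial_\lambda V^\kappa-V^\gamma\widetilde\Pi^\alpha{}_\gamma\widetilde\Pi^\kappa{}_\lambda\partial_\kappa V^\lambda .$$ **Error integrands.** For a smooth scalar function $\mathscr W$ on $\mathcal M$ and $V\in\{\Omega,S\}$, define $$\underline{\mathfrak H}_{(\partial\mathscr W)}[V]=\tfrac{\underline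 z}{\underline h}|\not{V}|^2\,\underline H\mathscr W+\underline z|\not{V}|^2\,\Theta\mathscr W+V_\alpha Z^\alpha\,\not{V}\mathscr W,$$ $$\begin{aligned}\underline{\mathfrak H}[V]={}&\tfrac12\tfrac{\underline z}{\underline h\lambda}|\not{V}|^2(\not{g}^{-1})^{\alpha\beta}\mathcal L_{\lambda\underline H}\not{g}_{\alpha\beta}+\Big\{\lambda\underline H\Big[\tfrac{\underline z}{\underline h\lambda}(\not{g}^{-1})^{\alpha\beta}\Big]\Big\}V_\alpha V_\beta+\{\Theta[\underline z(\not{g}^{-1})^{\alpha\beta}]\}V_\alpha V_\beta\\&-2\underline zV_\alpha\not{V}\mathbf B^\alpha+\underline z|\not{V}|^2\mathrm{div}_{\mathcal S}\,\Theta+Z_\alpha V^\alpha V^\beta\mathrm{div}_{\mathcal S}\,\not{\partial}_\beta-V^\alpha Z^\beta\not{V}\mathbf g_{\alpha\beta}+V_\alpha\not{V}Z^\alpha .\end{aligned}$$ With $\hat p=p_{;s}/\bar\varrho$, $\sigma=\mathrm{sgn}\big(\epsilon_{\alpha\beta\gamma\delta}\underline E^\alpha\not{\Omega}^\beta\underline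 N^\gamma(S^\delta+S^a\underline N_a\mathbf B^\delta)\big)$ (and $\mathrm{sgn}\,0=0$), $$G=\frac{\underline h+\underline\eta^2}{\sqrt{\underline h^2+\underline\eta^2\nu^2}}\sqrt{\det\begin{pmatrix}\not{g}(\not{\Omega},\not{\Omega})&\not{g}(\not{\Omega},Y)\\\not{g}(\not{\Omega},Y)&\not{g}(Y,Y)\end{pmatrix}},$$ $$K=P_a\underline Hv^a+\underline N_aP^a\underline H\rho+e_av^a+(g^{-1})^{ab}\underline N_ae_b\rho+e^{-\rho}\hat p\,\underline N_aS^a,$$ and $\epsilon(X_1,X_2,X_3,X_4)=\epsilon_{\alpha\beta\gamma\delta}X_1^\alpha X_2^\beta X_3^\gamma X_4^\delta$, where $e\rho$ and $S^ae_av$ denote the vectors with $0$-component $0$ and spatial components $e_a\rho$ and $S^ae_av^i$, define $$\begin{aligned}\underline{\mathfrak H}_{(1)}[\Omega]={}&2\sigma\underline zc^{-1}e^{-2\rho}\hat p\,G\,K+4\underline z\,\Omega_\alpha\underline E^\alpha\,\not{\Omega}\ln c-4\underline z|\not{\Omega}|^2\underline E\ln c+4\underline z\,\underline E^0\Omega_a\not{\Omega}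 v^a-4\underline z\,\not{\Omega}^0\Omega_a\underline Ev^a\\&+2\underline zc^{-4}e^{-2\rho}\hat p\,\epsilon(\underline E,\not{\Omega},P,S)\underline H\rho-2\underline zc^{-4}e^{-2\rho}\hat p\,S^a\underline N_a\,\epsilon(\underline E,\not{\Omega},\mathbf B,P)\underline H\rho\\&+2\underline zc^{-2}e^{-2\rho}\hat p\,\epsilon(\underline E,\not{\Omega},e\rho,S)-2\underline zc^{-2}e^{-2\rho}\hat p\,S^a\underline N_a\,\epsilon(\underline E,\not{\Omega},\mathbf B,e\rho)\\&-2\underline zc^{-4}e^{-2\rho}\hat p\,S^aP_a\,\epsilon(\underline E,\not{\Omega},\mathbf B,\underline Hv)-2\underline zc^{-4}e^{-2\rho}\hat p\,\epsilon(\underline E,\not{\Omega},\mathbf B,S^ae_av)\\&+2\underline zc^{-2}e^{\rho}\,\epsilon(\underline E,\not{\Omega},\mathbf B,\mathcal C)-2\underline zc^{-4}e^{-3\rho}\hat p^2\,S^a\underline N_a\,\epsilon(\underline E,\not{\Omega},\mathbf B,S),\\ \underline{\mathfrak H}_{(2)}[S]={}&4\underline zS_\alpha\underline E^\alpha\,\not{S}\ln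 c-4\underline z|\not{S}|^2\underline E\ln c .\end{aligned}$$ **Proposition.** Under these assumptions, $\lambda>0$ on $\underline{\mathcal H}$, and for every smooth scalar function $\mathscr W$ on $\mathcal M$ and every $\tau\in[0,T]$ all integrals below exist and $$\int_{\underline{\mathcal H}_\tau}\mathscr WZ_\alpha J^\alpha[\Omega]\,d\varpi_{\not{g}}d\tau'+\int_{\mathcal S_\tau}\mathscr W\tfrac{\underline z}{\underline h\lambda}|\not{\Omega}|^2d\varpi_{\not{g}}=\int_{\mathcal S_0}\mathscr W\tfrac{\underline z}{\underline h\lambda}|\not{\Omega}|^2d\varpi_{\not{g}}+\int_{\underline{\mathcal H}_\tau}\big\{\underline{\mathfrak H}_{(\partial\mathscr W)}[\Omega]+\mathscr W\underline{\mathfrak H}[\Omega]+\mathscr W\underline{\mathfrak H}_{(1)}[\Omega]\big\}d\varpi_{\not{g}}d\tau',$$ $$\int_{\underline{\mathcal H}_\tau}\mathscr WZ_\alpha J^\alpha[S]\,d\varpi_{\not{g}}d\tau'+\int_{\mathcal S_\tau}\mathscr W\tfrac{\underline z}{\underline h\lambda}|\not{S}|^2d\varpi_{\not{g}}=\int_{\mathcal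 S_0}\mathscr W\tfrac{\underline z}{\underline h\lambda}|\not{S}|^2d\varpi_{\not{g}}+\int_{\underline{\mathcal H}_\tau}\big\{\underline{\mathfrak H}_{(\partial\mathscr W)}[S]+\mathscr W\underline{\mathfrak H}[S]+\mathscr W\underline{\mathfrak H}_{(2)}[S]\big\}d\varpi_{\not{g}}d\tau'.$$ Moreover, along $\underline{\mathcal H}$ the first product $2\sigma\underline zc^{-1}e^{-2\rho}\hat p\,G\,K$ of $\underline{\mathfrak H}_{(1)}[\Omega]$ equals $-2\underline zc^{-4}e^{-2\rho}\hat p\cdot(-\sigma c^3GK)$, and it vanishes along $\underline{\mathcal H}$ when $\underline{\mathcal H}$ is $\mathbf g$-null. -/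

import Mathlib

open Set MeasureTheory
open scoped ContDiff

noncomputable section

namespace EulerBdry

/-! ### Spacetime -/

/-- Spacetime `ℝ^{1+3}` with Cartesian coordinates `(x⁰, x¹, x², x³)`, `x⁰ = t`. -/
abbrev ST : Type := Fin 4 → ℝ

/-- The Cartesian coordinate vector `∂_α`. -/
def coordVec (α : Fin 4) : ST := Pi.single α 1

/-- A vector in `ℝ³` regarded as a `Σ_t`-tangent spacetime vector (vanishing `0`-component). -/
def spatial (w : Fin 3 → ℝ) : ST := Fin.cons (0 : ℝ) w

/-- `ε_{αβγδ} X₁^α X₂^β X₃^γ X₄^δ`, where `ε` is the fully antisymmetric symbol with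
`ε_{0123} = 1`. -/
def eps4 (X₁ X₂ X₃ X₄ : ST) : ℝ := Matrix.det (Matrix.of ![X₁, X₂, X₃, X₄])

/-- The Euclidean curl at `q` of a time-dependent vector field on `ℝ³`. -/
def curl (w : ST → Fin 3 → ℝ) (q : ST) : Fin 3 → ℝ :=
  let A : Fin 3 → Fin 3 → ℝ := fun a i => fderiv ℝ w q (coordVec a.succ) i
  ![A 1 2 - A 2 1, A 2 0 - A 0 2, A 0 1 - A 1 0]

/-! ### The fluid and the acoustical metric -/

/-- The data of a compressible fluid: the equation of state `p = eos ϱ s`, a fixed constant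
background density, and the density, velocity and entropy as functions on spacetime. -/
structure Fluid where
  eos : ℝ → ℝ → ℝ
  densBar : ℝ
  dens : ST → ℝ
  vel : ST → Fin 3 → ℝ
  ent : ST → ℝ

namespace Fluid

variable (F : Fluid)

/-- The logarithmic density `ρ = ln (ϱ / ϱ̄)`. -/
def rho (q : ST) : ℝ := Real.log (F.dens q / F.densBar)

/-- `∂p/∂ϱ` at fixed entropy, evaluated along the fluid. -/
def pDens (q : ST) : ℝ := deriv (fun r => F.eos r (F.ent q)) (F.dens q)

/-- `p_{;s} / ϱ̄`, where `p_{;s}` is `∂p/∂s` at fixed density, evaluated along the fluid. -/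
def pEntBar (q : ST) : ℝ := deriv (fun s => F.eos (F.dens q) s) (F.ent q) / F.densBar

/-- The speed of sound. -/
def c (q : ST) : ℝ := Real.sqrt (F.pDens q)

/-- The material derivative vector field `B = ∂_t + v^a ∂_a`. -/
def B (q : ST) : ST := Fin.cons (1 : ℝ) (F.vel q)

/-- The specific vorticity `Ω^i = (curl v)^i / exp ρ`. -/
def Om (q : ST) : ST := spatial fun i => curl F.vel q i / Real.exp (F.rho q)

/-- The entropy gradient `S^i = ∂_i s`. -/
def S (q : ST) : ST := spatial fun i => fderiv ℝ F.ent q (coordVec i.succ)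

/-- The divergence `∂_a v^a`. -/
def divVel (q : ST) : ℝ := ∑ a : Fin 3, fderiv ℝ F.vel q (coordVec a.succ) a

/-- The modified fluid variable
`𝒞^i = e^{-ρ} (curl Ω)^i + e^{-3ρ} c^{-2} (p_{;s}/ϱ̄) (S^a ∂_a v^i - (∂_a v^a) S^i)`. -/
def modCurl (q : ST) : ST := spatial fun i =>
  Real.exp (-F.rho q) * curl (fun p j => F.Om p j.succ) q i
    + Real.exp (-3 * F.rho q) * (F.c q ^ 2)⁻¹ * F.pEntBar q * fderiv ℝ F.vel q (F.S q) i
    - Real.exp (-3 * F.rho q) * (F.c q ^ 2)⁻¹ * F.pEntBar q * F.divVel q * F.S q i.succ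

/-- The acoustical metric
`g = - dt ⊗ dt + c^{-2} ∑_a (dx^a - v^a dt) ⊗ (dx^a - v^a dt)`, at the point `q`. -/
def g (q : ST) (X Y : ST) : ℝ :=
  -(X 0 * Y 0) + (F.c q ^ 2)⁻¹ * ∑ a : Fin 3,
    (X a.succ - F.vel q a * X 0) * (Y a.succ - F.vel q a * Y 0)

/-- The Cartesian components `g_{αβ}`. -/
def gLow (q : ST) (α β : Fin 4) : ℝ := F.g q (coordVec α) (coordVec β)

/-- The Cartesian components of the inverse metric
`g^{-1} = - B ⊗ B + c² ∑_a ∂_a ⊗ ∂_a`. -/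
def gInv (q : ST) (α β : Fin 4) : ℝ :=
  -(F.B q α * F.B q β) + if α = β ∧ α ≠ 0 then F.c q ^ 2 else 0

/-- `X_α = g_{αβ} X^β`. -/
def lower (q : ST) (X : ST) (α : Fin 4) : ℝ := F.g q X (coordVec α)

/-- The Christoffel symbols `Γ_α^γ_β` of `g`. -/
def christoffel (q : ST) (α γ β : Fin 4) : ℝ :=
  (1 / 2) * ∑ δ : Fin 4, F.gInv q γ δ *
    (fderiv ℝ (fun p => F.gLow p δ β) q (coordVec α)
      + fderiv ℝ (fun p => F.gLow p α δ) q (coordVec β)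
      - fderiv ℝ (fun p => F.gLow p α β) q (coordVec δ))

/-- `F` is a smooth solution of the compressible Euler equations on `M`, with positive density and
positive sound speed there; `O` is an open set containing `M` on which the fluid variables are
smooth. -/
structure IsEulerSolution (O M : Set ST) : Prop where
  densBar_pos : 0 < F.densBar
  eos_smooth : ContDiffOn ℝ ∞ (fun x : ℝ × ℝ => F.eos x.1 x.2) (Ioi 0 ×ˢ univ)
  dens_smooth : ContDiffOn ℝ ∞ F.dens O
  vel_smooth : ContDiffOn ℝ ∞ F.vel O
  ent_smooth : ContDiffOn ℝ ∞ F.ent O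
  dens_pos : ∀ q ∈ M, 0 < F.dens q
  pDens_pos : ∀ q ∈ M, 0 < F.pDens q
  /-- `B ρ = - ∂_a v^a` -/
  mass : ∀ q ∈ M, fderiv ℝ F.rho q (F.B q) = -F.divVel q
  /-- `B v^i = - c² ∂_i ρ - exp(-ρ) (p_{;s}/ϱ̄) ∂_i s` -/
  momentum : ∀ q ∈ M, ∀ i : Fin 3, fderiv ℝ F.vel q (F.B q) i
    = -(F.c q ^ 2 * fderiv ℝ F.rho q (coordVec i.succ))
      - Real.exp (-F.rho q) * F.pEntBar q * fderiv ℝ F.ent q (coordVec i.succ)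
  /-- `B s = 0` -/
  entropy : ∀ q ∈ M, fderiv ℝ F.ent q (F.B q) = 0

end Fluid

/-! ### The spacetime region -/

/-- The data of a spacetime region: an open set `ambient` of spacetime, a function `tau` on it, a
number `T`, the region `region` foliated by the level sets of `tau` for values in `[0, T]`, and
its lateral boundary `lateral`. -/
structure Region where
  ambient : Set ST
  region : Set ST
  lateral : Set ST
  tau : ST → ℝ
  T : ℝ

/-- The tangent space of `A` at `q`, as a subspace of `ℝ^{1+3}`: the span of the tangent cone. If
`A` is a smooth submanifold, possibly with boundary, this is its usual tangent space. -/
def tangentSpaceAt (A : Set ST) (q : ST) : Submodule ℝ ST := Submodule.span ℝ (tangentConeAt ℝ A q)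

namespace Region

variable (R : Region) (F : Fluid)

/-- The slice `Σ̃_{t}` where `tau = t`. -/
def slice (t : ℝ) : Set ST := R.region ∩ {q | R.tau q = t}

/-- The surface `S_t`, the intersection of the lateral boundary and the slice. -/
def sphere (t : ℝ) : Set ST := R.lateral ∩ R.slice t

/-- The derivative at `q`, in the direction of a vector `X` tangent to the lateral boundary, of a
function that is only considered along the lateral boundary. -/
def along {G : Type*} [NormedAddCommGroup G] [NormedSpace ℝ G] (f : ST → G) (q X : ST) : G :=
  fderivWithin ℝ f R.lateral q X

/-! #### Vector fields and scalar functions along the lateral boundary -/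

/-- The vector `(g^{-1})^{αβ} ∂_β tau`. -/
def gradTau (q : ST) : ST := fun α => ∑ β : Fin 4, F.gInv q α β * fderiv ℝ R.tau q (coordVec β)

/-- `N`: the normal of the slices, normalized by `N t = 1`. -/
def N (q : ST) : ST := (R.gradTau F q 0)⁻¹ • R.gradTau F q

/-- `ν = √(-g(N, N))`. -/
def nu (q : ST) : ℝ := Real.sqrt (-F.g q (R.N F q) (R.N F q))

/-- `N̂`: the future-directed unit normal of the slices. -/
def Nhat (q : ST) : ST := (R.nu F q)⁻¹ • R.N F q

/-- `X` is `g`-orthogonal to the lateral boundary at `q`. -/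
def IsNormalToLateral (q X : ST) : Prop := ∀ Y ∈ tangentSpaceAt R.lateral q, F.g q X Y = 0

/-- `X` is `g`-orthogonal at `q` to the surface `S_{tau q}`. -/
def IsNormalToSphere (q X : ST) : Prop :=
  ∀ Y ∈ tangentSpaceAt (R.sphere (R.tau q)) q, F.g q X Y = 0

/-- `X` is tangent to the lateral boundary, `g`-orthogonal to `S_{tau q}`, and `X t = 1`. -/
def IsGenerator (q X : ST) : Prop :=
  X ∈ tangentSpaceAt R.lateral q ∧ R.IsNormalToSphere F q X ∧ X 0 = 1

/-- `X` is the `g`-unit outer normal at `q` of `S_{tau q}` in the slice through `q`: it is tangent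
to the slice, `g`-orthogonal to `S_{tau q}`, of unit length, and `-X` points into the slice. -/
def IsOuterNormal (q X : ST) : Prop :=
  fderiv ℝ R.tau q X = 0 ∧ R.IsNormalToSphere F q X ∧ F.g q X X = 1 ∧
    -X ∈ posTangentConeAt (R.slice (R.tau q)) q

/-- `N̲`: the `g`-normal of the lateral boundary with `N̲ t = 1`. -/
def Nbar (q : ST) : ST := Classical.epsilon fun X => R.IsNormalToLateral F q X ∧ X 0 = 1

/-- `Z`: the `g`-unit outer normal of the surfaces `S_τ` in the slices. -/
def Z (q : ST) : ST := Classical.epsilon fun X => R.IsOuterNormal F q X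

/-- `H̲`: tangent to the lateral boundary, `g`-orthogonal to the surfaces `S_τ`, `H̲ t = 1`. -/
def H (q : ST) : ST := Classical.epsilon fun X => R.IsGenerator F q X

/-- `z = - g(Z, N̲)`. -/
def z (q : ST) : ℝ := -F.g q (R.Z F q) (R.Nbar F q)

/-- `h = - g(H̲, N)`. -/
def h (q : ST) : ℝ := -F.g q (R.H F q) (R.N F q)

/-- The lapse `1 / (H̲ tau)`. -/
def lapse (q : ST) : ℝ := (fderiv ℝ R.tau q (R.H F q))⁻¹

/-- The rescaled generator: `lapse • H̲`. -/
def Hbreve (q : ST) : ST := R.lapse F q • R.H F q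

/-- `η = √(g(H̲, H̲))`. -/
def eta (q : ST) : ℝ := Real.sqrt (F.g q (R.H F q) (R.H F q))

/-- `Θ = B - h⁻¹ H̲ - z⁻¹ Z`. -/
def Theta (q : ST) : ST := F.B q - (R.h F q)⁻¹ • R.H F q - (R.z F q)⁻¹ • R.Z F q

/-- `E = B - z⁻¹ Z`. -/
def E (q : ST) : ST := F.B q - (R.z F q)⁻¹ • R.Z F q

/-- `P = (N̲ - N) / h`. -/
def P (q : ST) : ST := (R.h F q)⁻¹ • (R.Nbar F q - R.N F q)

/-- `e_α = ∂_α + N̲_α B - P_α H̲`. -/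
def e (α : Fin 4) (q : ST) : ST :=
  coordVec α + F.lower q (R.Nbar F q) α • F.B q - F.lower q (R.P F q) α • R.H F q

/-- `S^a N̲_a`. -/
def SNbar (q : ST) : ℝ := F.g q (F.S q) (R.Nbar F q)

/-- `h⁻¹ (S^a N̲_a - S^a N_a)`. -/
def kCoef (q : ST) : ℝ := (R.SNbar F q - F.g q (F.S q) (R.N F q)) / R.h F q

/-- `U = S + (S^a N̲_a) B - h⁻¹ (S^a N̲_a - S^a N_a) H̲`. -/
def U (q : ST) : ST := F.S q + R.SNbar F q • F.B q - R.kCoef F q • R.H F q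

/-- `Y = h⁻¹ (S^a N̲_a - S^a N_a) Θ - h⁻¹ U`. -/
def Y (q : ST) : ST := R.kCoef F q • R.Theta F q - (R.h F q)⁻¹ • R.U F q

/-! #### Projections -/

/-- `δ^α_β + N̂^α N̂_β`, the `g`-orthogonal projection onto the slices. -/
def sliceProj (q : ST) (α β : Fin 4) : ℝ :=
  (if α = β then 1 else 0) + R.Nhat F q α * F.lower q (R.Nhat F q) β

/-- `δ^α_β + N̂^α N̂_β - Z^α Z_β`, the `g`-orthogonal projection onto the surfaces `S_τ`. -/
def sphProj (q : ST) (α β : Fin 4) : ℝ :=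
  R.sliceProj F q α β - R.Z F q α * F.lower q (R.Z F q) β

/-- The first fundamental form of the surfaces `S_τ`, components
`g_{αβ} + N̂_α N̂_β - Z_α Z_β`. -/
def sphLow (q : ST) (α β : Fin 4) : ℝ :=
  F.gLow q α β + F.lower q (R.Nhat F q) α * F.lower q (R.Nhat F q) β
    - F.lower q (R.Z F q) α * F.lower q (R.Z F q) β

/-- The inverse first fundamental form, components
`(g^{-1})^{αβ} + N̂^α N̂^β - Z^α Z^β`. -/
def sphInv (q : ST) (α β : Fin 4) : ℝ :=
  F.gInv q α β + R.Nhat F q α * R.Nhat F q β - R.Z F q α * R.Z F q β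

/-- The first fundamental form of the surfaces `S_τ` as a bilinear form. -/
def sphForm (q : ST) (X Y : ST) : ℝ := ∑ α : Fin 4, ∑ β : Fin 4, R.sphLow F q α β * X α * Y β

/-- The `g`-orthogonal projection of a vector at `q` onto the surface `S_{tau q}`. -/
def tang (q : ST) (X : ST) : ST := fun α => ∑ β : Fin 4, R.sphProj F q α β * X β

/-- The projection of the coordinate vector field `∂_β` onto the surfaces `S_τ`. -/
def angCoord (β : Fin 4) (q : ST) : ST := fun α => R.sphProj F q α β

/-- The divergence on `S_τ`, with respect to the Levi-Civita connection of its first fundamental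
form, of a vector field `X` tangent to the surfaces `S_τ`: the trace of the projection onto `S_τ`
of the spacetime covariant derivative of `X` in directions tangent to `S_τ`. -/
def sphDiv (X : ST → ST) (q : ST) : ℝ :=
  (∑ δ : Fin 4, R.along (fun p => X p δ) q (R.angCoord F δ q))
    + ∑ γ : Fin 4, ∑ δ : Fin 4, ∑ κ : Fin 4,
        R.sphProj F q γ δ * F.christoffel q γ δ κ * X q κ

/-- The Lie derivative along `X` of the first fundamental form of the surfaces `S_τ`, evaluated at
the vectors `Y₁, Y₂` (all vectors tangent to the lateral boundary):
`(X T_{αβ}) Y₁^α Y₂^β + T(Y₁^α ∂_α X, Y₂) + T(Y₁, Y₂^α ∂_α X)`. -/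
def lieSph (X : ST → ST) (q : ST) (Y₁ Y₂ : ST) : ℝ :=
  (∑ α : Fin 4, ∑ β : Fin 4, R.along (fun p => R.sphLow F p α β) q (X q) * Y₁ α * Y₂ β)
    + R.sphForm F q (R.along X q Y₁) Y₂ + R.sphForm F q Y₁ (R.along X q Y₂)

/-- The trace over `S_τ` of the Lie derivative along `X` of the first fundamental form. -/
def trLieSph (X : ST → ST) (q : ST) : ℝ :=
  ∑ μ : Fin 4, ∑ ν : Fin 4,
    R.sphInv F q μ ν * R.lieSph F X q (R.angCoord F μ q) (R.angCoord F ν q)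

/-! #### The elliptic-hyperbolic current and the error integrands -/

/-- The current `J[V]`, tangent to the slices:
`J^α = V^γ Π^λ_γ Π^α_κ ∂_λ V^κ - V^γ Π^α_γ Π^κ_λ ∂_κ V^λ`, where `Π` is the projection onto the
slices. -/
def current (V : ST → ST) (q : ST) : ST := fun α =>
  (∑ γ : Fin 4, ∑ l : Fin 4, ∑ κ : Fin 4, V q γ * R.sliceProj F q l γ * R.sliceProj F q α κ
      * fderiv ℝ V q (coordVec l) κ)
    - ∑ γ : Fin 4, ∑ l : Fin 4, ∑ κ : Fin 4, V q γ * R.sliceProj F q α γ * R.sliceProj F q κ l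
      * fderiv ℝ V q (coordVec κ) l

/-- `Z_α J^α[V]`. -/
def ZJ (V : ST → ST) (q : ST) : ℝ := F.g q (R.Z F q) (R.current F V q)

/-- The squared length, in the first fundamental form, of the projection of `V` onto `S_τ`. -/
def normSq (V : ST → ST) (q : ST) : ℝ := R.sphForm F q (R.tang F q (V q)) (R.tang F q (V q))

/-- The error integrand involving derivatives of the weight. -/
def errWeight (W : ST → ℝ) (V : ST → ST) (q : ST) : ℝ :=
  R.z F q / R.h F q * R.normSq F V q * R.along W q (R.H F q)
    + R.z F q * R.normSq F V q * R.along W q (R.Theta F q)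
    + F.g q (V q) (R.Z F q) * R.along W q (R.tang F q (V q))

/-- The error integrand common to `V = Ω` and `V = S`. -/
def errCommon (V : ST → ST) (q : ST) : ℝ :=
  (1 / 2) * (R.z F q / (R.h F q * R.lapse F q)) * R.normSq F V q * R.trLieSph F (R.Hbreve F) q
    + (∑ α : Fin 4, ∑ β : Fin 4,
        R.along (fun p => R.z F p / (R.h F p * R.lapse F p) * R.sphInv F p α β) q (R.Hbreve F q)
          * F.lower q (V q) α * F.lower q (V q) β)
    + (∑ α : Fin 4, ∑ β : Fin 4,
        R.along (fun p => R.z F p * R.sphInv F p α β) q (R.Theta F q)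
          * F.lower q (V q) α * F.lower q (V q) β)
    - 2 * R.z F q * ∑ α : Fin 4,
        F.lower q (V q) α * fderiv ℝ (fun p => F.B p α) q (R.tang F q (V q))
    + R.z F q * R.normSq F V q * R.sphDiv F (R.Theta F) q
    + F.g q (R.Z F q) (V q) * (∑ β : Fin 4, V q β * R.sphDiv F (R.angCoord F β) q)
    - (∑ α : Fin 4, ∑ β : Fin 4,
        V q α * R.Z F q β * fderiv ℝ (fun p => F.gLow p α β) q (R.tang F q (V q)))
    + ∑ α : Fin 4,
        F.lower q (V q) α * R.along (fun p => R.Z F p α) q (R.tang F q (V q))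

/-- The sign of `ε_{αβγδ} E^α Ω̸^β N̲^γ (S^δ + S^a N̲_a B^δ)`. -/
def sgn (q : ST) : ℝ :=
  Real.sign (eps4 (R.E F q) (R.tang F q (F.Om q)) (R.Nbar F q) (F.S q + R.SNbar F q • F.B q))

/-- `(h + η²) (h² + η² ν²)^{-1/2}` times the square root of the Gram determinant, in the first
fundamental form of `S_τ`, of the projection of `Ω` and of `Y`. -/
def gramFactor (q : ST) : ℝ :=
  (R.h F q + R.eta F q ^ 2) / Real.sqrt (R.h F q ^ 2 + R.eta F q ^ 2 * R.nu F q ^ 2)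
    * Real.sqrt (Matrix.det
        !![R.sphForm F q (R.tang F q (F.Om q)) (R.tang F q (F.Om q)),
           R.sphForm F q (R.tang F q (F.Om q)) (R.Y F q);
           R.sphForm F q (R.tang F q (F.Om q)) (R.Y F q),
           R.sphForm F q (R.Y F q) (R.Y F q)])

/-- `P_a H̲ v^a + N̲_a P^a H̲ ρ + e_a v^a + (g^{-1})^{ab} N̲_a e_b ρ
  + exp(-ρ) (p_{;s}/ϱ̄) N̲_a S^a`. -/
def tangBrace (q : ST) : ℝ :=
  (∑ a : Fin 3, F.lower q (R.P F q) a.succ * fderiv ℝ F.vel q (R.H F q) a)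
    + (∑ a : Fin 3, F.lower q (R.Nbar F q) a.succ * R.P F q a.succ) * fderiv ℝ F.rho q (R.H F q)
    + (∑ a : Fin 3, fderiv ℝ F.vel q (R.e F a.succ q) a)
    + (∑ a : Fin 3, ∑ b : Fin 3, (if a = b then F.c q ^ 2 else 0)
        * F.lower q (R.Nbar F q) a.succ * fderiv ℝ F.rho q (R.e F b.succ q))
    + Real.exp (-F.rho q) * F.pEntBar q
        * ∑ a : Fin 3, F.lower q (R.Nbar F q) a.succ * F.S q a.succ

/-- The determinant product `- σ c³ (h + η²) (h² + η² ν²)^{-1/2} √det {…}`. -/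
def detProduct (q : ST) : ℝ := -(R.sgn F q * F.c q ^ 3 * R.gramFactor F q * R.tangBrace F q)

/-- The first product in the error integrand of the vorticity. -/
def errVortFirst (q : ST) : ℝ :=
  2 * R.sgn F q * R.z F q * (F.c q)⁻¹ * Real.exp (-2 * F.rho q) * F.pEntBar q
    * R.gramFactor F q * R.tangBrace F q

/-- `X ln c`. -/
def dLogC (q X : ST) : ℝ := fderiv ℝ (fun p => Real.log (F.c p)) q X

/-- The error integrand specific to the vorticity. -/
def errVort (q : ST) : ℝ :=
  let E := R.E F q
  let Om := R.tang F q (F.Om q)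
  let B := F.B q
  let S := F.S q
  let P := R.P F q
  let k := 2 * R.z F q * Real.exp (-2 * F.rho q) * F.pEntBar q
  let dRhoH := fderiv ℝ F.rho q (R.H F q)
  let eRho : ST := spatial fun a => fderiv ℝ F.rho q (R.e F a.succ q)
  R.errVortFirst F q
    + 4 * R.z F q * F.g q (F.Om q) E * dLogC F q Om
    - 4 * R.z F q * R.normSq F F.Om q * dLogC F q E
    + 4 * R.z F q * E 0 * (∑ a : Fin 3, F.lower q (F.Om q) a.succ * fderiv ℝ F.vel q Om a)
    - 4 * R.z F q * Om 0 * (∑ a : Fin 3, F.lower q (F.Om q) a.succ * fderiv ℝ F.vel q E a)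
    + k * (F.c q ^ 4)⁻¹ * eps4 E Om P S * dRhoH
    - k * (F.c q ^ 4)⁻¹ * R.SNbar F q * eps4 E Om B P * dRhoH
    + k * (F.c q ^ 2)⁻¹ * eps4 E Om eRho S
    - k * (F.c q ^ 2)⁻¹ * R.SNbar F q * eps4 E Om B eRho
    - k * (F.c q ^ 4)⁻¹ * F.g q S P * eps4 E Om B (spatial (fderiv ℝ F.vel q (R.H F q)))
    - k * (F.c q ^ 4)⁻¹ * eps4 E Om B
        (spatial (∑ a : Fin 3, S a.succ • fderiv ℝ F.vel q (R.e F a.succ q)))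
    + 2 * R.z F q * (F.c q ^ 2)⁻¹ * Real.exp (F.rho q) * eps4 E Om B (F.modCurl q)
    - 2 * R.z F q * (F.c q ^ 4)⁻¹ * Real.exp (-3 * F.rho q) * F.pEntBar q ^ 2
        * R.SNbar F q * eps4 E Om B S

/-- The error integrand specific to the entropy gradient. -/
def errEnt (q : ST) : ℝ :=
  4 * R.z F q * F.g q (F.S q) (R.E F q) * dLogC F q (R.tang F q (F.S q))
    - 4 * R.z F q * R.normSq F F.S q * dLogC F q (R.E F q)

/-! #### The assumptions on the region -/

/-- The lateral boundary is `g`-spacelike at all of its points (its normals are timelike). -/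
def LateralSpacelike : Prop :=
  ∀ q ∈ R.lateral, ∀ X : ST, X ≠ 0 → R.IsNormalToLateral F q X → F.g q X X < 0

/-- The lateral boundary is `g`-null at all of its points (its normals are null). -/
def LateralNull : Prop :=
  ∀ q ∈ R.lateral, ∀ X : ST, X ≠ 0 → R.IsNormalToLateral F q X → F.g q X X = 0

/-- The assumptions on the spacetime region. The region is a compact manifold with corners whose
boundary consists of the bottom slice, the top slice and the lateral boundary; `tau` is an
acoustical time function; the lateral boundary is a smooth hypersurface portion, transversal to the
level sets of `tau`, spacelike everywhere or null everywhere; and the ingoing conditions `z > 0`,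
`h > 0` hold along it. -/
structure IsAdmissible : Prop where
  ambient_open : IsOpen R.ambient
  region_subset : R.region ⊆ R.ambient
  region_compact : IsCompact R.region
  T_pos : 0 < R.T
  tau_smooth : ContDiffOn ℝ ∞ R.tau R.ambient
  /-- the gradient of `tau` is past-directed -/
  tau_past : ∀ q ∈ R.region, 0 < fderiv ℝ R.tau q (F.B q)
  /-- the gradient of `tau` is timelike -/
  tau_timelike : ∀ q ∈ R.region, ∑ α : Fin 4, ∑ β : Fin 4,
    F.gInv q α β * fderiv ℝ R.tau q (coordVec α) * fderiv ℝ R.tau q (coordVec β) < 0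
  lateral_subset : R.lateral ⊆ R.region
  /-- away from the lateral boundary, the region is locally the slab `0 ≤ tau ≤ T` -/
  local_interior : ∀ q ∈ R.region \ R.lateral, ∃ O : Set ST, IsOpen O ∧ q ∈ O ∧ O ⊆ R.ambient ∧
    R.region ∩ O = {p ∈ O | R.tau p ∈ Icc 0 R.T}
  /-- near the lateral boundary, the region is locally the part `u ≤ 0` of the slab
  `0 ≤ tau ≤ T`, and the lateral boundary is the part `u = 0`, for a smooth function `u` such that
  `du` and `d tau` are linearly independent -/
  local_lateral : ∀ q ∈ R.lateral, ∃ (O : Set ST) (u : ST → ℝ), IsOpen O ∧ q ∈ O ∧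
    O ⊆ R.ambient ∧ ContDiffOn ℝ ∞ u O ∧
    LinearIndependent ℝ ![fderiv ℝ u q, fderiv ℝ R.tau q] ∧
    R.region ∩ O = {p ∈ O | u p ≤ 0 ∧ R.tau p ∈ Icc 0 R.T} ∧
    R.lateral ∩ O = {p ∈ O | u p = 0 ∧ R.tau p ∈ Icc 0 R.T}
  causal : R.LateralSpacelike F ∨ R.LateralNull F
  generator_exists : ∀ q ∈ R.lateral, ∃ X : ST, R.IsGenerator F q X
  z_pos : ∀ q ∈ R.lateral, 0 < R.z F q
  h_pos : ∀ q ∈ R.lateral, 0 < R.h F q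

end Region

/-! ### Area forms and integrals -/

/-- The Gram determinant, with respect to `g`, of the coordinate vectors of a parametrized surface
`ψ` at the parameter value `y`. -/
def paramGram (F : Fluid) (ψ : (Fin 2 → ℝ) → ST) (y : Fin 2 → ℝ) : ℝ :=
  Matrix.det (Matrix.of fun A C : Fin 2 =>
    F.g (ψ y) (fderiv ℝ ψ y (Pi.single A 1)) (fderiv ℝ ψ y (Pi.single C 1)))

/-- `ψ`, restricted to the open set `D`, is a smooth local parametrization of the surface `A`: it
is smooth and maps `D` onto a relatively open subset of `A`, with an inverse that extends
smoothly to an open subset of spacetime. -/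
def IsParam (A : Set ST) (D : Set (Fin 2 → ℝ)) (ψ : (Fin 2 → ℝ) → ST) : Prop :=
  IsOpen D ∧ ContDiffOn ℝ ∞ ψ D ∧ ∃ (O : Set ST) (χ : ST → Fin 2 → ℝ), IsOpen O ∧
    ContDiffOn ℝ ∞ χ O ∧ ψ '' D = A ∩ O ∧ ∀ y ∈ D, χ (ψ y) = y

/-- The area measure of a surface `A`, spacelike for `g`: the least measure that dominates, for
every local parametrization `ψ` of `A`, the measure `√det(g(∂_A ψ, ∂_C ψ)) dy¹ dy²` on the
parametrized patch. For a smooth spacelike surface these measures agree on overlaps and the area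
measure restricts to each of them on its patch. -/
def areaMeasure (F : Fluid) (A : Set ST) : Measure ST :=
  ⨆ (D : Set (Fin 2 → ℝ)) (ψ : (Fin 2 → ℝ) → ST) (_ : IsParam A D ψ),
    ((volume.restrict D).withDensity
      fun y => ENNReal.ofReal (Real.sqrt (paramGram F ψ y))).map ψ

namespace Region

variable (R : Region) (F : Fluid)

/-- The area measure of `S_t`. -/
def sphereMeasure (t : ℝ) : Measure ST := areaMeasure F (R.sphere t)

/-- The integral of `f` over `S_t` with respect to the area measure. -/
def sphereIntegral (t : ℝ) (f : ST → ℝ) : ℝ := ∫ q, f q ∂(R.sphereMeasure F t)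

/-- The integral of `f` over the portion `0 ≤ tau ≤ t` of the lateral boundary, with respect to
the product of the area measure of the surfaces `S_{t'}` and `dt'`. -/
def lateralIntegral (t : ℝ) (f : ST → ℝ) : ℝ := ∫ t' in (0 : ℝ)..t, R.sphereIntegral F t' f

/-- `f` is integrable over all surfaces `S_{t'}`, `0 ≤ t' ≤ t`, and its integral over `S_{t'}` is
an integrable function of `t'`. -/
def LateralIntegrable (t : ℝ) (f : ST → ℝ) : Prop :=
  (∀ t' ∈ Icc 0 t, Integrable f (R.sphereMeasure F t')) ∧
    IntervalIntegrable (fun t' => R.sphereIntegral F t' f) volume 0 t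

/-- The positive integrand on the surfaces `S_τ`: `(z / (h lapse)) |V̸|²`. -/
def sphereDensity (V : ST → ST) (q : ST) : ℝ :=
  R.z F q / (R.h F q * R.lapse F q) * R.normSq F V q

end Region

/-- The integral identity for the vector field `V` and the weight `W` on the portion
`0 ≤ tau ≤ t`, with lateral error integrand
`errWeight[V] + W errCommon[V] + W errV`; all integrals in it exist. -/
structure BoundaryIdentity (R : Region) (F : Fluid) (W : ST → ℝ) (V : ST → ST) (errV : ST → ℝ)
    (t : ℝ) : Prop where
  left_integrable : R.LateralIntegrable F t fun q => W q * R.ZJ F V q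
  right_integrable : R.LateralIntegrable F t fun q =>
    R.errWeight F W V q + W q * R.errCommon F V q + W q * errV q
  top_integrable : Integrable (fun q => W q * R.sphereDensity F V q) (R.sphereMeasure F t)
  bottom_integrable : Integrable (fun q => W q * R.sphereDensity F V q) (R.sphereMeasure F 0)
  identity :
    R.lateralIntegral F t (fun q => W q * R.ZJ F V q)
        + R.sphereIntegral F t (fun q => W q * R.sphereDensity F V q)
      = R.sphereIntegral F 0 (fun q => W q * R.sphereDensity F V q)
        + R.lateralIntegral F t (fun q =>
            R.errWeight F W V q + W q * R.errCommon F V q + W q * errV q)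

end EulerBdry

end

/-!
Both integral identities are instances of the divergence theorem on the lateral boundary, fibred by
the surfaces `S_τ`. For a vector field `J` tangent to the lateral boundary, the derivative of the
integral over `S_τ` of its flux `J τ` is the integral of the divergence of `J` over `S_τ`. The
current is `W` times `z h⁻¹ |V̸|² H̲` plus fields tangent to the surfaces `S_τ`
(`|V̸|² z Θ` and `g(Z, V) V̸`), and its flux is the density `W z (h λ)⁻¹ |V̸|²` of the integrals over
`S_τ`.

*The pointwise identity* (`errors_eq_lateralDiv`). Expanding the projections gives
`Z_α J^α[V] = g(Z, V̸ V) - g(Z, V) ∂̸_δ V^δ`. The first term and an integration by parts of the second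
along `S_τ` leave derivatives of `V_♭` in the direction `V̸`, contracted with `Z = z (B - E)`. Since
`g(V, B) = 0`, the `B` part contains no derivative of `V`. In the `E` part, the derivative is
`(V̸ V_β) E^β = dV_♭(V̸, E) + (E V_β) V̸^β`, where the last term is half the derivative of `|V̸|²` along
`E = h⁻¹ H̲ + Θ`, up to derivatives of the frame. As `E` is tangent to the lateral boundary, a
divergence results, and the only remaining derivative of `V` is `-2 z dV_♭(V̸, E)`. It remains to
express this term by the last error integrand.

*The entropy gradient* (`errEnt_eq`). Here `S_♭ = c⁻² (ds - (B s) dt) = c⁻² ds`, so the exterior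
derivative only sees `d ln c`.

*The vorticity* (`errVort_eq`). Here `Ω_♭ = c⁻² Ω^a (dx^a - v^a dt)`. The transport equation of `Ω`,
which is the curl of the momentum equation, and the definition of `𝒞` express its exterior derivative
by first derivatives of `ρ` and `v` (`dLower_Om`). Decomposing `∂_α = e_α - N̲_α B + P_α H̲` replaces
them by derivatives tangent to the boundary, except for a multiple of
`(div v) ε(E, Ω̸, N̲, S + S^a N̲_a B)`. On the one hand, the tangential expression `K` equals
`-g(N̲, N̲) div v` (`tangBrace_eq`). On the other hand, the `ε` factor is, up to sign, the volume of
the vectors `H̲`, `Ω̸`, `N̲`, `Y`, so its square is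
`-c⁶ g(N̲, N̲) g(H̲, H̲) (|Ω̸|² |Y|² - g(Ω̸, Y)²)` (`eps4_first_sq`). The ratio of the lengths of `H̲` and
`N̲` is the quotient in `G` (`norm_ratio`), and the first product `2 σ z c⁻¹ e^{-2ρ} p̂ G K` results.
If the boundary is null, then `g(N̲, N̲) = 0`, hence `K` and the product vanish.

*The divergence theorem* (`lateralIntegral_lateralDiv`). Near the boundary, `u` and `τ` are completed
to a chart in which the lateral boundary is `{u = 0, 0 ≤ τ ≤ T}`. In it the area form is `√Δ dy` with
a Gram determinant `Δ`, the divergence is `(√Δ)⁻¹ ∂_i (√Δ J^i)`, and the theorem for boxes applies to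
currents with compact support in the chart. A partition of unity combines the charts. The fields
`N̲`, `Z` and `H̲`, specified by their geometric properties, are given by explicit formulas in the
gradients of `u` and `τ`; hence they are unique and smooth along the boundary.
-/

open Set MeasureTheory
open scoped ContDiff

noncomputable section

namespace EulerBdry

open Filter Topology

/-! ### Algebra of the acoustical metric -/

lemma coordVec_apply (α β : Fin 4) : coordVec α β = if β = α then 1 else 0 := by
  simp [coordVec, Pi.single_apply]

lemma sum_smul_coordVec (X : ST) : ∑ α, X α • coordVec α = X := by
  ext β
  simp [coordVec_apply]

@[simp] lemma spatial_zero (w : Fin 3 → ℝ) : spatial w 0 = 0 := rfl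

@[simp] lemma spatial_succ (w : Fin 3 → ℝ) (a : Fin 3) : spatial w a.succ = w a := rfl

lemma map_eq_sum {G : Type*} [AddCommGroup G] [Module ℝ G] [TopologicalSpace G] (L : ST →L[ℝ] G)
    (X : ST) : L X = ∑ α, X α • L (coordVec α) := by
  conv_lhs => rw [← sum_smul_coordVec X]
  simp [map_sum]

namespace Fluid

variable (F : Fluid) (q : ST)

@[simp] lemma B_zero : F.B q 0 = 1 := rfl

@[simp] lemma B_succ (a : Fin 3) : F.B q a.succ = F.vel q a := rfl

@[simp] lemma Om_zero : F.Om q 0 = 0 := rfl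

@[simp] lemma S_zero : F.S q 0 = 0 := rfl

lemma g_comm (X Y : ST) : F.g q X Y = F.g q Y X := by
  simp only [g, Fin.sum_univ_three]; ring

/-- The acoustical metric at `q` as a bilinear map. -/
def gBil : ST →ₗ[ℝ] ST →ₗ[ℝ] ℝ :=
  LinearMap.mk₂ ℝ (F.g q)
    (by intros; simp only [g, Fin.sum_univ_three, Pi.add_apply]; ring)
    (by intros; simp only [g, Fin.sum_univ_three, Pi.smul_apply, smul_eq_mul]; ring)
    (by intros; simp only [g, Fin.sum_univ_three, Pi.add_apply]; ring)
    (by intros; simp only [g, Fin.sum_univ_three, Pi.smul_apply, smul_eq_mul]; ring)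

lemma gBil_apply (X Y : ST) : F.gBil q X Y = F.g q X Y := rfl

lemma g_add_left (X Y Z : ST) : F.g q (X + Y) Z = F.g q X Z + F.g q Y Z := by
  simp [← gBil_apply]

lemma g_add_right (X Y Z : ST) : F.g q X (Y + Z) = F.g q X Y + F.g q X Z := by
  simp [← gBil_apply]

lemma g_sub_left (X Y Z : ST) : F.g q (X - Y) Z = F.g q X Z - F.g q Y Z := by
  simp [← gBil_apply]

lemma g_sub_right (X Y Z : ST) : F.g q X (Y - Z) = F.g q X Y - F.g q X Z := by
  simp [← gBil_apply]

lemma g_smul_left (a : ℝ) (X Y : ST) : F.g q (a • X) Y = a * F.g q X Y := by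
  simp [← gBil_apply]

lemma g_smul_right (a : ℝ) (X Y : ST) : F.g q X (a • Y) = a * F.g q X Y := by
  simp [← gBil_apply]

lemma g_zero_left (Y : ST) : F.g q 0 Y = 0 := by
  simp [← gBil_apply]

lemma g_sum_left {ι : Type*} (s : Finset ι) (X : ι → ST) (Y : ST) :
    F.g q (∑ i ∈ s, X i) Y = ∑ i ∈ s, F.g q (X i) Y := by
  simp [← gBil_apply]

lemma g_sum_right {ι : Type*} (s : Finset ι) (X : ι → ST) (Y : ST) :
    F.g q Y (∑ i ∈ s, X i) = ∑ i ∈ s, F.g q Y (X i) := by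
  simp [← gBil_apply]

lemma g_eq_sum_lower (X Y : ST) : F.g q X Y = ∑ α, F.lower q X α * Y α := by
  conv_lhs => rw [← sum_smul_coordVec Y]
  simp [g_sum_right, g_smul_right, lower, mul_comm]

lemma lower_eq_sum (X : ST) (β : Fin 4) : F.lower q X β = ∑ α, F.gLow q α β * X α := by
  rw [lower]
  conv_lhs => rw [← sum_smul_coordVec X]
  simp [g_sum_left, g_smul_left, gLow, mul_comm]

lemma g_eq_sum (X Y : ST) : F.g q X Y = ∑ α, ∑ β, F.gLow q α β * X α * Y β := by
  rw [g_eq_sum_lower, Finset.sum_comm]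
  simp [lower_eq_sum, Finset.sum_mul]

lemma gLow_comm (α β : Fin 4) : F.gLow q α β = F.gLow q β α := F.g_comm q _ _

lemma gInv_comm (α β : Fin 4) : F.gInv q α β = F.gInv q β α := by
  unfold gInv
  by_cases h : α = β
  · subst h; rfl
  · rw [if_neg (by tauto), if_neg (by tauto)]; ring

/-- The vector `(g⁻¹)^{αβ} φ_β` of a covector `φ`. -/
def sharp (φ : ST →L[ℝ] ℝ) : ST := fun α => ∑ β, F.gInv q α β * φ (coordVec β)

lemma sharp_eq (φ : ST →L[ℝ] ℝ) (α : Fin 4) :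
    F.sharp q φ α = -F.B q α * φ (F.B q) + if α ≠ 0 then F.c q ^ 2 * φ (coordVec α) else 0 := by
  rw [map_eq_sum φ (F.B q)]
  simp only [sharp, gInv, add_mul, Finset.sum_add_distrib, Finset.mul_sum, smul_eq_mul]
  congr 1
  · exact Finset.sum_congr rfl fun β _ => by ring
  · by_cases h : α = 0
    · simp [h]
    · simp [h]

lemma sharp_zero_comp (φ : ST →L[ℝ] ℝ) : F.sharp q φ 0 = -φ (F.B q) := by
  simp [sharp_eq]

lemma sharp_succ_comp (φ : ST →L[ℝ] ℝ) (a : Fin 3) :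
    F.sharp q φ a.succ = -F.vel q a * φ (F.B q) + F.c q ^ 2 * φ (coordVec a.succ) := by
  simp [sharp_eq]

variable {q}

lemma g_sharp (hc : 0 < F.c q) (φ : ST →L[ℝ] ℝ) (X : ST) : F.g q (F.sharp q φ) X = φ X := by
  have h0 := F.sharp_zero_comp q φ
  have hs := F.sharp_succ_comp q φ
  have hB := map_eq_sum φ (F.B q)
  rw [map_eq_sum φ X]
  simp only [g, h0, hs]
  simp only [Fin.sum_univ_four, Fin.sum_univ_three] at hB ⊢
  simp only [smul_eq_mul, B_zero, show (1 : Fin 4) = Fin.succ 0 from rfl,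
    show (2 : Fin 4) = Fin.succ 1 from rfl, show (3 : Fin 4) = Fin.succ 2 from rfl, B_succ] at hB ⊢
  have hc' := hc.ne'
  rw [hB]
  field_simp
  ring

lemma g_B_left (X : ST) : F.g q (F.B q) X = -X 0 := by
  simp [g]

lemma g_B_right (X : ST) : F.g q X (F.B q) = -X 0 := by
  rw [g_comm, g_B_left]

/-- The acoustical metric is nondegenerate. -/
lemma eq_zero_of_g_eq_zero (hc : 0 < F.c q) {X : ST} (h : ∀ Y, F.g q X Y = 0) : X = 0 := by
  have h0 : X 0 = 0 := by simpa [g_B_right] using h (F.B q)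
  ext α
  refine Fin.cases h0 (fun a => ?_) α
  have := h (coordVec a.succ)
  have hc' := hc.ne'
  fin_cases a <;> simpa [g, h0, coordVec_apply, Fin.sum_univ_three, hc'] using this

lemma eq_of_g_eq (hc : 0 < F.c q) {X X' : ST} (h : ∀ Y, F.g q X Y = F.g q X' Y) : X = X' :=
  sub_eq_zero.1 (F.eq_zero_of_g_eq_zero hc fun Y => by rw [g_sub_left, h, sub_self])

lemma sharp_unique (hc : 0 < F.c q) {φ : ST →L[ℝ] ℝ} {X : ST} (h : ∀ Y, F.g q X Y = φ Y) :
    X = F.sharp q φ :=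
  F.eq_of_g_eq hc fun Y => by rw [h, g_sharp F hc]

lemma sharp_coord (hc : 0 < F.c q) (α β : Fin 4) :
    ∑ γ, F.gInv q α γ * F.gLow q γ β = if α = β then 1 else 0 := by
  have h := F.sharp_unique hc (φ := ((F.gBil q).flip (coordVec β)).toContinuousLinearMap)
    (X := coordVec β) (fun Y => by
      simp [LinearMap.coe_toContinuousLinearMap', gBil_apply, F.g_comm])
  have := congrFun h α
  rw [coordVec_apply] at this
  rw [this]
  simp [sharp, gBil_apply, gLow]

/-- Reverse Cauchy–Schwarz: the orthogonal complement of a timelike vector is spacelike. -/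
lemma g_pos_of_orthogonal (hc : 0 < F.c q) {N X : ST} (hN : F.g q N N < 0) (hNX : F.g q N X = 0)
    (hX : X ≠ 0) : 0 < F.g q X X := by
  have hc2 : 0 < (F.c q ^ 2)⁻¹ := by positivity
  set k := (F.c q ^ 2)⁻¹ with hk
  set n : Fin 3 → ℝ := fun a => N a.succ - F.vel q a * N 0 with hn
  set x : Fin 3 → ℝ := fun a => X a.succ - F.vel q a * X 0 with hx
  have e1 : F.g q N N = -(N 0 * N 0) + k * ∑ a, n a * n a := rfl
  have e2 : F.g q N X = -(N 0 * X 0) + k * ∑ a, n a * x a := rfl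
  have e3 : F.g q X X = -(X 0 * X 0) + k * ∑ a, x a * x a := rfl
  rw [e1] at hN
  rw [e2] at hNX
  rw [e3]
  -- Cauchy–Schwarz for the parts orthogonal to `B`
  have cs : (∑ a, n a * x a) ^ 2 ≤ (∑ a, n a * n a) * ∑ a, x a * x a := by
    have := Finset.sum_mul_sq_le_sq_mul_sq Finset.univ n x
    simpa [sq] using this
  have hnn : 0 ≤ ∑ a, n a * n a := Finset.sum_nonneg fun a _ => mul_self_nonneg _
  have hN0 : 0 < N 0 * N 0 := by nlinarith [mul_nonneg hc2.le hnn]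
  have hxx : 0 < ∑ a, x a * x a := by
    refine lt_of_le_of_ne (Finset.sum_nonneg fun a _ => mul_self_nonneg _) fun h0 => hX ?_
    have hx0 : ∀ a, x a = 0 := by
      intro a
      have := (Finset.sum_eq_zero_iff_of_nonneg (fun a _ => mul_self_nonneg (x a))).1 h0.symm a
        (Finset.mem_univ a)
      exact mul_self_eq_zero.1 this
    have hX0 : X 0 = 0 := by
      simp only [hx0, mul_zero, Finset.sum_const_zero, add_zero] at hNX
      have : N 0 ≠ 0 := fun h => by simp [h] at hN0
      simpa [this] using hNX
    ext α
    refine Fin.cases hX0 (fun a => ?_) α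
    have := hx0 a
    simpa [hx, hX0] using this
  have h1 : (N 0 * N 0) * (X 0 * X 0) = k ^ 2 * (∑ a, n a * x a) ^ 2 := by
    have : N 0 * X 0 = k * ∑ a, n a * x a := by linarith
    calc (N 0 * N 0) * (X 0 * X 0) = (N 0 * X 0) ^ 2 := by ring
      _ = _ := by rw [this]; ring
  have h2 : (N 0 * N 0) * (X 0 * X 0) ≤ (k * ∑ a, n a * n a) * (k * ∑ a, x a * x a) := by
    rw [h1]
    nlinarith [mul_le_mul_of_nonneg_left cs (sq_nonneg k)]
  have h3 : (k * ∑ a, n a * n a) * (k * ∑ a, x a * x a) < (N 0 * N 0) * (k * ∑ a, x a * x a) :=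
    mul_lt_mul_of_pos_right (by linarith) (by positivity)
  have h4 : X 0 * X 0 < k * ∑ a, x a * x a := by
    by_contra! h
    nlinarith [mul_le_mul_of_nonneg_left h hN0.le]
  linarith

/-- Nonzero causal vectors are transversal to the surfaces of constant time, whose normal `B` is
timelike. -/
lemma time_ne_zero_of_causal (hc : 0 < F.c q) {X : ST} (hX : X ≠ 0) (h : F.g q X X ≤ 0) :
    X 0 ≠ 0 := by
  intro h0
  have hB : F.g q (F.B q) (F.B q) < 0 := by simp [g_B_left]
  have := F.g_pos_of_orthogonal hc hB (X := X) (by simp [g_B_left, h0]) hX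
  linarith

end Fluid

/-- A covector that vanishes on the kernel of `φ` is a multiple of `φ`. -/
lemma exists_smul_of_ker_le_ker {φ ψ : ST →L[ℝ] ℝ} (h : ∀ X, φ X = 0 → ψ X = 0) :
    ∃ a : ℝ, ∀ X, ψ X = a * φ X := by
  have := mem_span_of_iInf_ker_le_ker (ι := Fin 1) (L := fun _ => φ.toLinearMap)
    (K := ψ.toLinearMap) (by
      intro X hX
      simp only [Submodule.mem_iInf, LinearMap.mem_ker] at hX
      exact h X (hX 0))
  simp only [Set.range_const, Submodule.mem_span_singleton] at this
  obtain ⟨a, ha⟩ := this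
  exact ⟨a, fun X => by simpa using (LinearMap.congr_fun ha X).symm⟩

/-! ### Smoothness of the fluid variables and of the acoustical metric -/

namespace Fluid

variable {F : Fluid} {O M : Set ST} {q : ST}

/-- The points of `O` at which density and squared sound speed are positive. -/
def goodSet (F : Fluid) (O : Set ST) : Set ST := {p | p ∈ O ∧ 0 < F.dens p ∧ 0 < F.pDens p}

/-- The equation of state as a function on the plane. -/
def eosPair (F : Fluid) (x : ℝ × ℝ) : ℝ := F.eos x.1 x.2

lemma IsEulerSolution.eosPair_contDiffAt (hF : F.IsEulerSolution O M) {x : ℝ × ℝ}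
    (hx : 0 < x.1) : ContDiffAt ℝ ∞ F.eosPair x :=
  hF.eos_smooth.contDiffAt ((isOpen_Ioi.prod isOpen_univ).mem_nhds ⟨hx, mem_univ _⟩)

lemma IsEulerSolution.pDens_eq (hF : F.IsEulerSolution O M) {p : ST} (hp : 0 < F.dens p) :
    F.pDens p = fderiv ℝ F.eosPair (F.dens p, F.ent p) (1, 0) := by
  have h := ((hF.eosPair_contDiffAt (x := (F.dens p, F.ent p)) hp).differentiableAt
    (by simp)).hasFDerivAt
  have h2 : HasDerivAt (fun r : ℝ => (r, F.ent p)) (1, 0) (F.dens p) :=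
    (hasDerivAt_id _).prodMk (hasDerivAt_const _ _)
  exact (h.comp_hasDerivAt (F.dens p) h2).deriv

lemma IsEulerSolution.pEntBar_eq (hF : F.IsEulerSolution O M) {p : ST} (hp : 0 < F.dens p) :
    F.pEntBar p = fderiv ℝ F.eosPair (F.dens p, F.ent p) (0, 1) / F.densBar := by
  have h := ((hF.eosPair_contDiffAt (x := (F.dens p, F.ent p)) hp).differentiableAt
    (by simp)).hasFDerivAt
  have h2 : HasDerivAt (fun s : ℝ => (F.dens p, s)) (0, 1) (F.ent p) :=
    (hasDerivAt_const _ _).prodMk (hasDerivAt_id _)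
  rw [pEntBar]
  congr 1
  exact (h.comp_hasDerivAt (F.ent p) h2).deriv

section

variable (hF : F.IsEulerSolution O M) (hO : IsOpen O)
include hF hO

lemma IsEulerSolution.dens_contDiffAt (hq : q ∈ O) : ContDiffAt ℝ ∞ F.dens q :=
  hF.dens_smooth.contDiffAt (hO.mem_nhds hq)

lemma IsEulerSolution.vel_contDiffAt (hq : q ∈ O) : ContDiffAt ℝ ∞ F.vel q :=
  hF.vel_smooth.contDiffAt (hO.mem_nhds hq)

lemma IsEulerSolution.ent_contDiffAt (hq : q ∈ O) : ContDiffAt ℝ ∞ F.ent q :=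
  hF.ent_smooth.contDiffAt (hO.mem_nhds hq)

lemma IsEulerSolution.eventually_dens_pos (hq : q ∈ O) (h : 0 < F.dens q) :
    ∀ᶠ p in 𝓝 q, 0 < F.dens p :=
  (hF.dens_contDiffAt hO hq).continuousAt.eventually (lt_mem_nhds h)

lemma IsEulerSolution.fderiv_eosPair_contDiffAt (hq : q ∈ O) (h : 0 < F.dens q) (v : ℝ × ℝ) :
    ContDiffAt ℝ ∞ (fun p => fderiv ℝ F.eosPair (F.dens p, F.ent p) v) q := by
  have h1 : ContDiffAt ℝ ∞ (fun x => fderiv ℝ F.eosPair x v) (F.dens q, F.ent q) :=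
    ((hF.eosPair_contDiffAt (x := (F.dens q, F.ent q)) h).fderiv_right (m := ∞) (by simp)).clm_apply
      contDiffAt_const
  exact h1.comp q ((hF.dens_contDiffAt hO hq).prodMk (hF.ent_contDiffAt hO hq))

lemma IsEulerSolution.pDens_contDiffAt (hq : q ∈ O) (h : 0 < F.dens q) :
    ContDiffAt ℝ ∞ F.pDens q :=
  (hF.fderiv_eosPair_contDiffAt hO hq h (1, 0)).congr_of_eventuallyEq <|
    (hF.eventually_dens_pos hO hq h).mono fun _ hp => hF.pDens_eq hp

lemma IsEulerSolution.rho_contDiffAt (hq : q ∈ F.goodSet O) : ContDiffAt ℝ ∞ F.rho q :=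
  ((hF.dens_contDiffAt hO hq.1).div_const _).log (div_pos hq.2.1 hF.densBar_pos).ne'

lemma IsEulerSolution.c_contDiffAt (hq : q ∈ F.goodSet O) : ContDiffAt ℝ ∞ F.c q :=
  (hF.pDens_contDiffAt hO hq.1 hq.2.1).sqrt hq.2.2.ne'

omit hF hO in
lemma c_pos_of_mem (hq : q ∈ F.goodSet O) : 0 < F.c q := Real.sqrt_pos.2 hq.2.2

omit hF hO in
lemma c_sq_of_mem (hq : q ∈ F.goodSet O) : F.c q ^ 2 = F.pDens q := Real.sq_sqrt hq.2.2.le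

lemma IsEulerSolution.vel_apply_contDiffAt (hq : q ∈ O) (a : Fin 3) :
    ContDiffAt ℝ ∞ (fun p => F.vel p a) q :=
  contDiffAt_pi.1 (hF.vel_contDiffAt hO hq) a

lemma IsEulerSolution.B_contDiffAt (hq : q ∈ O) : ContDiffAt ℝ ∞ F.B q := by
  rw [contDiffAt_pi]
  refine fun α => Fin.cases contDiffAt_const (fun a => ?_) α
  exact hF.vel_apply_contDiffAt hO hq a

lemma IsEulerSolution.fderiv_ent_contDiffAt (hq : q ∈ O) (X : ST) :
    ContDiffAt ℝ ∞ (fun p => fderiv ℝ F.ent p X) q :=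
  ((hF.ent_contDiffAt hO hq).fderiv_right (m := ∞) (by simp)).clm_apply contDiffAt_const

lemma IsEulerSolution.fderiv_vel_contDiffAt (hq : q ∈ O) (X : ST) (a : Fin 3) :
    ContDiffAt ℝ ∞ (fun p => fderiv ℝ F.vel p X a) q :=
  contDiffAt_pi.1 (((hF.vel_contDiffAt hO hq).fderiv_right (m := ∞) (by simp)).clm_apply
    contDiffAt_const) a

lemma IsEulerSolution.S_contDiffAt (hq : q ∈ O) : ContDiffAt ℝ ∞ F.S q := by
  rw [contDiffAt_pi]
  refine fun α => Fin.cases contDiffAt_const (fun a => ?_) α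
  exact hF.fderiv_ent_contDiffAt hO hq _

lemma IsEulerSolution.curl_vel_contDiffAt (hq : q ∈ O) (a : Fin 3) :
    ContDiffAt ℝ ∞ (fun p => curl F.vel p a) q := by
  have h := fun b => hF.fderiv_vel_contDiffAt hO hq (coordVec b)
  fin_cases a
  · exact (h 2 2).sub (h 3 1)
  · exact (h 3 0).sub (h 1 2)
  · exact (h 1 1).sub (h 2 0)

lemma IsEulerSolution.Om_contDiffAt (hq : q ∈ F.goodSet O) : ContDiffAt ℝ ∞ F.Om q := by
  rw [contDiffAt_pi]
  refine fun α => Fin.cases contDiffAt_const (fun a => ?_) α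
  exact (hF.curl_vel_contDiffAt hO hq.1 a).div (hF.rho_contDiffAt hO hq).exp (Real.exp_ne_zero _)

/-- The metric product of two smooth vector fields is smooth. -/
lemma IsEulerSolution.g_contDiffWithinAt {s : Set ST} {n : ℕ∞ω} (hn : n ≤ ∞) {X Y : ST → ST}
    (hq : q ∈ F.goodSet O)
    (hX : ContDiffWithinAt ℝ n X s q) (hY : ContDiffWithinAt ℝ n Y s q) :
    ContDiffWithinAt ℝ n (fun p => F.g p (X p) (Y p)) s q := by
  have hX' := contDiffWithinAt_pi.1 hX
  have hY' := contDiffWithinAt_pi.1 hY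
  have hv := fun a => ((hF.vel_apply_contDiffAt hO hq.1 a).of_le hn).contDiffWithinAt (s := s)
  have hc := (((hF.c_contDiffAt hO hq).pow 2).inv (pow_pos (c_pos_of_mem hq) 2).ne').of_le hn
    |>.contDiffWithinAt (s := s)
  unfold g
  refine ((hX' 0).mul (hY' 0)).neg.add (hc.mul (ContDiffWithinAt.sum fun a _ => ?_))
  exact ((hX' _).sub ((hv a).mul (hX' 0))).mul ((hY' _).sub ((hv a).mul (hY' 0)))

lemma IsEulerSolution.gLow_contDiffAt (hq : q ∈ F.goodSet O) (α β : Fin 4) :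
    ContDiffAt ℝ ∞ (fun p => F.gLow p α β) q := by
  rw [← contDiffWithinAt_univ]
  exact hF.g_contDiffWithinAt hO le_rfl hq contDiffWithinAt_const contDiffWithinAt_const

lemma IsEulerSolution.gInv_contDiffAt (hq : q ∈ F.goodSet O) (α β : Fin 4) :
    ContDiffAt ℝ ∞ (fun p => F.gInv p α β) q := by
  have hB := contDiffAt_pi.1 (hF.B_contDiffAt hO hq.1)
  unfold gInv
  refine ((hB α).mul (hB β)).neg.add ?_
  split_ifs
  · exact (hF.c_contDiffAt hO hq).pow 2
  · exact contDiffAt_const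

lemma IsEulerSolution.sharp_contDiffWithinAt {s : Set ST} {n : ℕ∞ω} (hn : n ≤ ∞)
    {φ : ST → ST →L[ℝ] ℝ} (hq : q ∈ F.goodSet O) (hφ : ContDiffWithinAt ℝ n φ s q) :
    ContDiffWithinAt ℝ n (fun p => F.sharp p (φ p)) s q := by
  rw [contDiffWithinAt_pi]
  intro α
  unfold sharp
  refine ContDiffWithinAt.sum fun β _ => ?_
  exact ((hF.gInv_contDiffAt hO hq α β).of_le hn).contDiffWithinAt.mul
    (hφ.clm_apply contDiffWithinAt_const)

end

lemma IsEulerSolution.mem_goodSet (hF : F.IsEulerSolution O M) (hMO : M ⊆ O) (hq : q ∈ M) :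
    q ∈ F.goodSet O := ⟨hMO hq, hF.dens_pos q hq, hF.pDens_pos q hq⟩

end Fluid

/-! ### The normal of the slices -/

namespace Region

variable {R : Region} {F : Fluid} {q : ST}

lemma gradTau_eq_sharp (R : Region) (F : Fluid) (q : ST) :
    R.gradTau F q = F.sharp q (fderiv ℝ R.tau q) := rfl

section

variable (hF : F.IsEulerSolution R.ambient R.region) (hR : R.IsAdmissible F)
include hF hR

lemma IsAdmissible.mem_goodSet (hq : q ∈ R.region) : q ∈ F.goodSet R.ambient :=
  hF.mem_goodSet hR.region_subset hq

lemma IsAdmissible.c_pos (hq : q ∈ R.region) : 0 < F.c q :=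
  Fluid.c_pos_of_mem (hR.mem_goodSet hF hq)

omit hF in
lemma IsAdmissible.tau_contDiffAt (hq : q ∈ R.ambient) : ContDiffAt ℝ ∞ R.tau q :=
  hR.tau_smooth.contDiffAt (hR.ambient_open.mem_nhds hq)

lemma IsAdmissible.g_gradTau (hq : q ∈ R.region) (X : ST) :
    F.g q (R.gradTau F q) X = fderiv ℝ R.tau q X :=
  F.g_sharp (hR.c_pos hF hq) _ X

omit hF in
lemma IsAdmissible.gradTau_zero_neg (hq : q ∈ R.region) : R.gradTau F q 0 < 0 := by
  rw [gradTau_eq_sharp, F.sharp_zero_comp]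
  linarith [hR.tau_past q hq]

lemma IsAdmissible.g_gradTau_self_neg (hq : q ∈ R.region) :
    F.g q (R.gradTau F q) (R.gradTau F q) < 0 := by
  rw [hR.g_gradTau hF hq]
  have := hR.tau_timelike q hq
  rw [map_eq_sum]
  simp only [gradTau, smul_eq_mul, Finset.sum_mul]
  refine lt_of_eq_of_lt (Finset.sum_congr rfl fun α _ => Finset.sum_congr rfl fun β _ => ?_) this
  ring

omit hF in
lemma IsAdmissible.N_time (hq : q ∈ R.region) : R.N F q 0 = 1 := by
  simp [N, (hR.gradTau_zero_neg hq).ne]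

lemma IsAdmissible.g_N (hq : q ∈ R.region) (X : ST) :
    F.g q (R.N F q) X = (R.gradTau F q 0)⁻¹ * fderiv ℝ R.tau q X := by
  rw [N, F.g_smul_left, hR.g_gradTau hF hq]

lemma IsAdmissible.g_N_self_neg (hq : q ∈ R.region) : F.g q (R.N F q) (R.N F q) < 0 := by
  rw [N, F.g_smul_left, F.g_smul_right, ← mul_assoc]
  exact mul_neg_of_pos_of_neg (mul_self_pos.2 (inv_ne_zero (hR.gradTau_zero_neg hq).ne))
    (hR.g_gradTau_self_neg hF hq)

lemma IsAdmissible.nu_pos (hq : q ∈ R.region) : 0 < R.nu F q :=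
  Real.sqrt_pos.2 (by linarith [hR.g_N_self_neg hF hq])

lemma IsAdmissible.nu_sq (hq : q ∈ R.region) : R.nu F q ^ 2 = -F.g q (R.N F q) (R.N F q) :=
  Real.sq_sqrt (by linarith [hR.g_N_self_neg hF hq])

lemma IsAdmissible.g_Nhat_self (hq : q ∈ R.region) : F.g q (R.Nhat F q) (R.Nhat F q) = -1 := by
  have h := hR.nu_sq hF hq
  have h' := (hR.nu_pos hF hq).ne'
  rw [Nhat, F.g_smul_left, F.g_smul_right]
  field_simp
  linarith

lemma IsAdmissible.g_Nhat_eq_zero_iff (hq : q ∈ R.region) (X : ST) :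
    F.g q (R.Nhat F q) X = 0 ↔ fderiv ℝ R.tau q X = 0 := by
  rw [Nhat, F.g_smul_left, hR.g_N hF hq]
  simp [(hR.nu_pos hF hq).ne', (hR.gradTau_zero_neg hq).ne]

lemma IsAdmissible.g_pos_of_tau (hq : q ∈ R.region) {X : ST} (h : fderiv ℝ R.tau q X = 0)
    (hX : X ≠ 0) : 0 < F.g q X X :=
  F.g_pos_of_orthogonal (hR.c_pos hF hq) (hR.g_N_self_neg hF hq) (by rw [hR.g_N hF hq, h, mul_zero])
    hX

omit hF in
lemma IsAdmissible.fderiv_tau_contDiffAt (hq : q ∈ R.region) :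
    ContDiffAt ℝ ∞ (fderiv ℝ R.tau) q :=
  (hR.tau_contDiffAt (hR.region_subset hq)).fderiv_right (by simp)

lemma IsAdmissible.gradTau_contDiffAt (hq : q ∈ R.region) : ContDiffAt ℝ ∞ (R.gradTau F) q := by
  rw [← contDiffWithinAt_univ]
  exact hF.sharp_contDiffWithinAt hR.ambient_open le_rfl (hR.mem_goodSet hF hq)
    (hR.fderiv_tau_contDiffAt hq).contDiffWithinAt

lemma IsAdmissible.N_contDiffAt (hq : q ∈ R.region) : ContDiffAt ℝ ∞ (R.N F) q := by
  have h := hR.gradTau_contDiffAt hF hq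
  exact ((contDiffAt_pi.1 h 0).inv (hR.gradTau_zero_neg hq).ne).smul h

lemma IsAdmissible.nu_contDiffAt (hq : q ∈ R.region) : ContDiffAt ℝ ∞ (R.nu F) q := by
  have h := hR.N_contDiffAt hF hq
  refine ContDiffAt.sqrt ?_ (by linarith [hR.g_N_self_neg hF hq] : (0 : ℝ) < _).ne'
  refine ContDiffAt.neg ?_
  rw [← contDiffWithinAt_univ] at h ⊢
  exact hF.g_contDiffWithinAt hR.ambient_open le_rfl (hR.mem_goodSet hF hq) h h

lemma IsAdmissible.Nhat_contDiffAt (hq : q ∈ R.region) : ContDiffAt ℝ ∞ (R.Nhat F) q :=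
  ((hR.nu_contDiffAt hF hq).inv (hR.nu_pos hF hq).ne').smul (hR.N_contDiffAt hF hq)

end

end Region

/-! ### Adapted charts and tangent spaces of the lateral boundary -/

/-- A smooth chart of spacetime near a point of the lateral boundary, whose first coordinate is a
function `u` with `u = 0` on the lateral boundary and `u ≤ 0` in the region, and whose second
coordinate is `tau`. -/
structure LatChart (R : Region) where
  chart : OpenPartialHomeomorph ST (Fin 4 → ℝ)
  smooth : ContDiffOn ℝ ∞ chart chart.source
  symm_smooth : ContDiffOn ℝ ∞ chart.symm chart.target
  chart_one : ∀ p, chart p 1 = R.tau p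
  region_iff : ∀ p ∈ chart.source, p ∈ R.region ↔ chart p 0 ≤ 0 ∧ R.tau p ∈ Icc 0 R.T
  lateral_iff : ∀ p ∈ chart.source, p ∈ R.lateral ↔ chart p 0 = 0 ∧ R.tau p ∈ Icc 0 R.T

/-- Two independent covectors are the first two components of a linear isomorphism onto `ℝ⁴`. -/
lemma exists_linear_completion {φ ψ : ST →L[ℝ] ℝ} (h : LinearIndependent ℝ ![φ, ψ]) :
    ∃ g : ST →L[ℝ] (Fin 2 → ℝ), ∀ X, φ X = 0 → ψ X = 0 → g X = 0 → X = 0 := by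
  have h1 : ∃ X, φ X = 0 ∧ ψ X ≠ 0 := by
    by_contra! hc
    obtain ⟨a, ha⟩ := exists_smul_of_ker_le_ker hc
    have := (LinearIndependent.pair_iff.1 h) a (-1) (by ext X; simp [ha])
    simp at this
  have h2 : ∃ X, ψ X = 0 ∧ φ X ≠ 0 := by
    by_contra! hc
    obtain ⟨a, ha⟩ := exists_smul_of_ker_le_ker hc
    have := (LinearIndependent.pair_iff.1 h) (-1) a (by ext X; simp [ha])
    simp at this
  obtain ⟨X₁, hX₁, hX₁'⟩ := h1
  obtain ⟨X₂, hX₂, hX₂'⟩ := h2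
  set L : ST →ₗ[ℝ] ℝ × ℝ := φ.toLinearMap.prod ψ.toLinearMap with hL
  have hsurj : Function.Surjective L := by
    rintro ⟨a, b⟩
    refine ⟨(a / φ X₂) • X₂ + (b / ψ X₁) • X₁, ?_⟩
    simp [hL, hX₁, hX₂, hX₁', hX₂']
  have hfin := LinearMap.finrank_range_add_finrank_ker L
  rw [LinearMap.range_eq_top.2 hsurj, finrank_top] at hfin
  have hker : Module.finrank ℝ (LinearMap.ker L) = Module.finrank ℝ (Fin 2 → ℝ) := by
    simp at hfin ⊢
    omega
  let e := LinearEquiv.ofFinrankEq _ _ hker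
  obtain ⟨g, hg⟩ := LinearMap.exists_extend e.toLinearMap
  refine ⟨g.toContinuousLinearMap, fun X h1 h2 h3 => ?_⟩
  have hX : X ∈ LinearMap.ker L := by simp [hL, h1, h2]
  have := LinearMap.congr_fun hg ⟨X, hX⟩
  simp only [LinearMap.comp_apply, Submodule.subtype_apply, LinearEquiv.coe_coe] at this
  rw [LinearMap.coe_toContinuousLinearMap'] at h3
  rw [h3] at this
  have := e.map_eq_zero_iff.1 this.symm
  simpa using congrArg Subtype.val this

/-- The functions `u` and `tau` are completed to a chart by two linear functions. The source is
restricted to points at which the derivative is invertible, so that the inverse is smooth. -/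
lemma Region.IsAdmissible.exists_latChart {R : Region} {F : Fluid} (hR : R.IsAdmissible F) {q : ST}
    (hq : q ∈ R.lateral) : ∃ C : LatChart R, q ∈ C.chart.source := by
  obtain ⟨O, u, hO, hqO, hOa, hu, hli, hreg, hlat⟩ := hR.local_lateral q hq
  obtain ⟨g, hg⟩ := exists_linear_completion hli
  set f : ST → Fin 4 → ℝ := fun p => ![u p, R.tau p, g p 0, g p 1] with hf
  have hfO : ∀ p ∈ O, ContDiffAt ℝ ∞ f p := by
    intro p hp
    rw [contDiffAt_pi]
    have hg' := contDiffAt_pi.1 ((g.contDiff (n := ∞)).contDiffAt (x := p))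
    intro i
    fin_cases i
    · exact hu.contDiffAt (hO.mem_nhds hp)
    · exact hR.tau_smooth.contDiffAt (hR.ambient_open.mem_nhds (hOa hp))
    · exact hg' 0
    · exact hg' 1
  have hder : ∀ p ∈ O, ∀ X, fderiv ℝ f p X = ![fderiv ℝ u p X, fderiv ℝ R.tau p X, g X 0, g X 1] := by
    intro p hp X
    have hd := (hfO p hp).differentiableAt (by simp)
    have h := fun i => congrArg (fun L : ST →L[ℝ] ℝ => L X)
      (hasFDerivAt_pi'.1 hd.hasFDerivAt i).fderiv
    ext i
    refine (h i).symm.trans ?_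
    have hgi : ∀ j, fderiv ℝ (fun p => g p j) p X = g X j := fun j =>
      congrArg (fun L : ST →L[ℝ] ℝ => L X) (hasFDerivAt_pi'.1 (g.hasFDerivAt : HasFDerivAt g g p) j).fderiv
    fin_cases i
    · rfl
    · rfl
    · exact hgi 0
    · exact hgi 1
  have hinj : Function.Injective (fderiv ℝ f q) := by
    refine (injective_iff_map_eq_zero _).2 fun X hX => ?_
    rw [hder q hqO] at hX
    refine hg X (by simpa using congrFun hX 0) (by simpa using congrFun hX 1) ?_
    ext i
    fin_cases i
    · simpa using congrFun hX 2
    · simpa using congrFun hX 3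
  let e : ST ≃L[ℝ] (Fin 4 → ℝ) :=
    (LinearEquiv.ofInjectiveEndo (fderiv ℝ f q : ST →ₗ[ℝ] ST) hinj).toContinuousLinearEquiv
  have he : (e : ST →L[ℝ] (Fin 4 → ℝ)) = fderiv ℝ f q := by
    ext X; rfl
  have hfq : HasFDerivAt f (e : ST →L[ℝ] (Fin 4 → ℝ)) q := by
    rw [he]
    exact ((hfO q hqO).differentiableAt (by simp)).hasFDerivAt
  let Λ₀ := (hfO q hqO).toOpenPartialHomeomorph f hfq (by simp)
  have hΛ₀ : (Λ₀ : ST → Fin 4 → ℝ) = f := (hfO q hqO).toOpenPartialHomeomorph_coe hfq (by simp)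
  have hqs : q ∈ Λ₀.source := (hfO q hqO).mem_toOpenPartialHomeomorph_source hfq (by simp)
  set W : Set ST := O ∩ fderiv ℝ f ⁻¹'
    Set.range (ContinuousLinearEquiv.toContinuousLinearMap : (ST ≃L[ℝ] (Fin 4 → ℝ)) → _) with hW
  have hWo : IsOpen W := by
    refine ContinuousOn.isOpen_inter_preimage (fun p hp => ?_) hO ContinuousLinearEquiv.isOpen
    exact ((hfO p hp).fderiv_right (m := 0) (by simp)).continuousAt.continuousWithinAt
  let Λ := Λ₀.restrOpen W hWo
  have hΛ : (Λ : ST → Fin 4 → ℝ) = f := hΛ₀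
  have hsrc : Λ.source = Λ₀.source ∩ W := Λ₀.restrOpen_source W hWo
  have hsO : ∀ p ∈ Λ.source, p ∈ O := fun p hp => (hsrc ▸ hp).2.1
  refine ⟨⟨Λ, fun p hp => ?_, fun y hy => ?_, fun p => ?_, fun p hp => ?_,
    fun p hp => ?_⟩, ?_⟩
  · rw [hΛ]
    exact (hfO p (hsO p hp)).contDiffWithinAt
  · have hy' := Λ.map_target hy
    obtain ⟨e', he'⟩ := (hsrc ▸ hy').2.2
    refine (Λ.contDiffAt_symm hy (f₀' := e') ?_ ?_).contDiffWithinAt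
    · rw [he', hΛ]
      exact ((hfO _ (hsO _ hy')).differentiableAt (by simp)).hasFDerivAt
    · rw [hΛ]
      exact hfO _ (hsO _ hy')
  · rw [hΛ]; rfl
  · have := Set.ext_iff.1 hreg p
    simp only [mem_inter_iff, mem_ofPred_eq, hsO p hp, and_true, true_and] at this
    rw [this, hΛ]; rfl
  · have := Set.ext_iff.1 hlat p
    simp only [mem_inter_iff, mem_ofPred_eq, hsO p hp, and_true, true_and] at this
    rw [this, hΛ]; rfl
  · rw [hsrc]
    exact ⟨hqs, hqO, e, he⟩

/-- One-sided tangents of curves in a set belong to the positive tangent cone. -/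
lemma mem_posTangentConeAt_of_curve {A : Set ST} {p X : ST} {γ : ℝ → ST} (h0 : γ 0 = p)
    (hγ : HasDerivAt γ X 0) (hA : ∀ᶠ s in 𝓝[>] (0 : ℝ), γ s ∈ A) : X ∈ posTangentConeAt A p := by
  refine mem_tangentConeAt_of_seq (𝓝[>] (0 : ℝ)) (fun s => Real.toNNReal s⁻¹)
    (fun s => γ s - p) ?_ ?_ ?_
  · have := hγ.continuousAt.tendsto
    rw [h0] at this
    simpa using (this.mono_left nhdsWithin_le_nhds).sub_const p
  · simpa using hA
  · have := hγ.hasDerivWithinAt (s := Ioi 0)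
    rw [hasDerivWithinAt_iff_tendsto_slope] at this
    rw [show Ioi (0 : ℝ) \ {0} = Ioi 0 by simp] at this
    refine this.congr' ?_
    filter_upwards [self_mem_nhdsWithin] with s hs
    rw [slope_def_module, sub_zero, h0, NNReal.smul_def, Real.coe_toNNReal _ (inv_nonneg.2 (le_of_lt hs))]

namespace LatChart

variable {R : Region} (C : LatChart R) {p : ST}

/-- The boundary defining function of the chart. -/
def u (p : ST) : ℝ := C.chart p 0

lemma contDiffAt (hp : p ∈ C.chart.source) : ContDiffAt ℝ ∞ C.chart p :=
  C.smooth.contDiffAt (C.chart.open_source.mem_nhds hp)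

lemma symm_contDiffAt {y : Fin 4 → ℝ} (hy : y ∈ C.chart.target) : ContDiffAt ℝ ∞ C.chart.symm y :=
  C.symm_smooth.contDiffAt (C.chart.open_target.mem_nhds hy)

lemma hasFDerivAt (hp : p ∈ C.chart.source) : HasFDerivAt C.chart (fderiv ℝ C.chart p) p :=
  ((C.contDiffAt hp).differentiableAt (by simp)).hasFDerivAt

lemma symm_hasFDerivAt {y : Fin 4 → ℝ} (hy : y ∈ C.chart.target) :
    HasFDerivAt C.chart.symm (fderiv ℝ C.chart.symm y) y :=
  ((C.symm_contDiffAt hy).differentiableAt (by simp)).hasFDerivAt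

lemma u_contDiffAt (hp : p ∈ C.chart.source) : ContDiffAt ℝ ∞ C.u p :=
  contDiffAt_pi.1 (C.contDiffAt hp) 0

lemma fderiv_symm_fderiv (hp : p ∈ C.chart.source) (X : ST) :
    fderiv ℝ C.chart.symm (C.chart p) (fderiv ℝ C.chart p X) = X := by
  have h1 := (C.symm_hasFDerivAt (C.chart.map_source hp)).comp p (C.hasFDerivAt hp)
  have h2 : HasFDerivAt (C.chart.symm ∘ C.chart) (ContinuousLinearMap.id ℝ ST) p :=
    (hasFDerivAt_id p).congr_of_eventuallyEq (C.chart.eventually_left_inverse hp)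
  exact congrArg (fun L : ST →L[ℝ] ST => L X) (h1.unique h2)

lemma fderiv_fderiv_symm (hp : p ∈ C.chart.source) (w : Fin 4 → ℝ) :
    fderiv ℝ C.chart p (fderiv ℝ C.chart.symm (C.chart p) w) = w := by
  have h1 := C.symm_hasFDerivAt (C.chart.map_source hp)
  have h0 := C.hasFDerivAt hp
  have h0' : HasFDerivAt C.chart (fderiv ℝ C.chart p) (C.chart.symm (C.chart p)) := by
    rw [C.chart.left_inv hp]; exact h0
  have h3 := h0'.comp (C.chart p) h1
  have h2 : HasFDerivAt (C.chart ∘ C.chart.symm) (ContinuousLinearMap.id ℝ (Fin 4 → ℝ))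
      (C.chart p) :=
    (hasFDerivAt_id _).congr_of_eventuallyEq (C.chart.eventually_right_inverse
      (C.chart.map_source hp))
  exact congrArg (fun L : (Fin 4 → ℝ) →L[ℝ] (Fin 4 → ℝ) => L w) (h3.unique h2)

lemma fderiv_u (hp : p ∈ C.chart.source) (X : ST) :
    fderiv ℝ C.u p X = fderiv ℝ C.chart p X 0 :=
  congrArg (fun L : ST →L[ℝ] ℝ => L X) (hasFDerivAt_pi'.1 (C.hasFDerivAt hp) 0).fderiv

lemma fderiv_tau (hp : p ∈ C.chart.source) (X : ST) :
    fderiv ℝ R.tau p X = fderiv ℝ C.chart p X 1 := by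
  have h := (hasFDerivAt_pi'.1 (C.hasFDerivAt hp) 1).fderiv
  simp only [C.chart_one] at h
  exact congrArg (fun L : ST →L[ℝ] ℝ => L X) h

/-- The coordinate line through `p` with velocity `w`. -/
lemma hasDerivAt_line (hp : p ∈ C.chart.source) (w : Fin 4 → ℝ) :
    HasDerivAt (fun s : ℝ => C.chart.symm (C.chart p + s • w))
      (fderiv ℝ C.chart.symm (C.chart p) w) 0 := by
  have h1 : HasDerivAt (fun s : ℝ => C.chart p + s • w) w 0 := by
    simpa using ((hasDerivAt_id (0 : ℝ)).smul_const w).const_add (C.chart p)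
  have h0 := C.symm_hasFDerivAt (C.chart.map_source hp)
  have h2 : HasFDerivAt C.chart.symm (fderiv ℝ C.chart.symm (C.chart p))
      (C.chart p + (0 : ℝ) • w) := by simpa using h0
  exact h2.comp_hasDerivAt 0 h1

lemma line_mem_target (hp : p ∈ C.chart.source) (w : Fin 4 → ℝ) :
    ∀ᶠ s in 𝓝[>] (0 : ℝ), C.chart p + s • w ∈ C.chart.target := by
  have : Tendsto (fun s : ℝ => C.chart p + s • w) (𝓝 0) (𝓝 (C.chart p + (0 : ℝ) • w)) :=
    (Continuous.tendsto (by fun_prop) 0)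
  rw [zero_smul, add_zero] at this
  exact (this.mono_left nhdsWithin_le_nhds).eventually
    (C.chart.open_target.mem_nhds (C.chart.map_source hp))

lemma mem_posTangentConeAt {A : Set ST} (hp : p ∈ C.chart.source) (w : Fin 4 → ℝ)
    (h : ∀ᶠ s in 𝓝[>] (0 : ℝ), ∀ p' ∈ C.chart.source, C.chart p' = C.chart p + s • w → p' ∈ A) :
    fderiv ℝ C.chart.symm (C.chart p) w ∈ posTangentConeAt A p := by
  refine mem_posTangentConeAt_of_curve (by simp [C.chart.left_inv hp]) (C.hasDerivAt_line hp w) ?_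
  filter_upwards [h, C.line_mem_target hp w] with s h1 h2
  exact h1 _ (C.chart.map_target h2) (C.chart.right_inv h2)

lemma fderiv_u_eq_zero_of_mem (hp : p ∈ C.chart.source) (hl : p ∈ R.lateral) {X : ST}
    (hX : X ∈ tangentConeAt ℝ R.lateral p) : fderiv ℝ C.u p X = 0 := by
  have h1 : HasFDerivWithinAt C.u (fderiv ℝ C.u p) R.lateral p :=
    ((C.u_contDiffAt hp).differentiableAt (by simp)).hasFDerivAt.hasFDerivWithinAt
  have h2 : HasFDerivWithinAt C.u (0 : ST →L[ℝ] ℝ) R.lateral p := by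
    refine (hasFDerivWithinAt_const (0 : ℝ) p R.lateral).congr_of_eventuallyEq ?_
      ((C.lateral_iff p hp).1 hl).1
    filter_upwards [self_mem_nhdsWithin, nhdsWithin_le_nhds (C.chart.open_source.mem_nhds hp)]
      with p' h1 h2 using ((C.lateral_iff p' h2).1 h1).1
  exact h1.unique_on h2 hX

/-- The tangent space of the lateral boundary is the kernel of `du`, also at its edges `tau = 0` and
`tau = T`: there only one of `X` and `-X` need be a one-sided tangent, but the span contains both. -/
lemma mem_tangentSpaceAt_lateral (hp : p ∈ C.chart.source) (hl : p ∈ R.lateral) (hT : 0 < R.T)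
    (X : ST) : X ∈ tangentSpaceAt R.lateral p ↔ fderiv ℝ C.u p X = 0 := by
  constructor
  · intro hX
    refine Submodule.span_induction (p := fun X _ => fderiv ℝ C.u p X = 0)
      (fun X hX => C.fderiv_u_eq_zero_of_mem hp hl hX) (by simp)
      (fun x y _ _ hx hy => by simp [hx, hy]) (fun a x _ hx => by simp [hx]) hX
  · intro hX
    rw [C.fderiv_u hp] at hX
    set w := fderiv ℝ C.chart p X with hw
    have hXw : X = fderiv ℝ C.chart.symm (C.chart p) w := (C.fderiv_symm_fderiv hp X).symm
    obtain ⟨hu0, hτ⟩ := (C.lateral_iff p hp).1 hl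
    have key : ∀ w : Fin 4 → ℝ, w 0 = 0 →
        ((w 1 = 0) ∨ (0 < w 1 ∧ R.tau p < R.T) ∨ (w 1 < 0 ∧ 0 < R.tau p)) →
        fderiv ℝ C.chart.symm (C.chart p) w ∈ tangentSpaceAt R.lateral p := by
      intro w hw0 hw1
      refine Submodule.subset_span (tangentConeAt_mono_field (C.mem_posTangentConeAt hp w ?_))
      have hlim : Tendsto (fun s : ℝ => R.tau p + s * w 1) (𝓝[>] 0) (𝓝 (R.tau p)) := by
        have : Tendsto (fun s : ℝ => R.tau p + s * w 1) (𝓝 0) (𝓝 (R.tau p + 0 * w 1)) :=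
          (Continuous.tendsto (by fun_prop) 0)
        rw [zero_mul, add_zero] at this
        exact this.mono_left nhdsWithin_le_nhds
      have hev : ∀ᶠ s in 𝓝[>] (0 : ℝ), R.tau p + s * w 1 ∈ Icc 0 R.T := by
        rcases hw1 with h | ⟨h, h'⟩ | ⟨h, h'⟩
        · simp only [h, mul_zero, add_zero]
          exact Eventually.of_forall fun _ => hτ
        · filter_upwards [hlim.eventually (gt_mem_nhds h'), self_mem_nhdsWithin] with s h1 h2
          have h2' : (0 : ℝ) < s := h2
          exact ⟨by have := hτ.1; positivity, h1.le⟩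
        · filter_upwards [hlim.eventually (lt_mem_nhds h'), self_mem_nhdsWithin] with s h1 h2
          have h2' : (0 : ℝ) < s := h2
          exact ⟨h1.le, by nlinarith [hτ.2]⟩
      filter_upwards [hev] with s hs p' hp' hpp
      rw [C.lateral_iff p' hp', ← C.chart_one p', hpp]
      refine ⟨by simp [hw0, hu0], ?_⟩
      simpa [C.chart_one] using hs
    have hneg : fderiv ℝ C.chart.symm (C.chart p) (-w) ∈ tangentSpaceAt R.lateral p → 
        X ∈ tangentSpaceAt R.lateral p := by
      intro h
      rw [map_neg, ← hXw] at h
      simpa using Submodule.neg_mem _ h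
    rcases lt_trichotomy (w 1) 0 with h | h | h
    · rcases hτ.1.lt_or_eq with h' | h'
      · rw [hXw]; exact key w hX (Or.inr (Or.inr ⟨h, h'⟩))
      · exact hneg (key (-w) (by simp [hX]) (Or.inr (Or.inl ⟨by simpa using h, h' ▸ hT⟩)))
    · rw [hXw]; exact key w hX (Or.inl h)
    · rcases hτ.2.lt_or_eq with h' | h'
      · rw [hXw]; exact key w hX (Or.inr (Or.inl ⟨h, h'⟩))
      · exact hneg (key (-w) (by simp [hX]) (Or.inr (Or.inr ⟨by simpa using h, h' ▸ hT⟩)))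

/-- The tangent space of `S_τ` is the common kernel of `du` and `d tau`. -/
lemma mem_tangentSpaceAt_sphere (hp : p ∈ C.chart.source) (hl : p ∈ R.lateral)
    (X : ST) :
    X ∈ tangentSpaceAt (R.sphere (R.tau p)) p ↔ fderiv ℝ C.u p X = 0 ∧ fderiv ℝ R.tau p X = 0 := by
  constructor
  · intro hX
    refine Submodule.span_induction
      (p := fun X _ => fderiv ℝ C.u p X = 0 ∧ fderiv ℝ R.tau p X = 0)
      (fun X hX => ⟨C.fderiv_u_eq_zero_of_mem hp hl (tangentConeAt_mono inter_subset_left hX), ?_⟩)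
      (by simp) (fun x y _ _ hx hy => by simp [hx, hy]) (fun a x _ hx => by simp [hx]) hX
    have h0 : DifferentiableAt ℝ R.tau p := by
      have := hasFDerivAt_pi'.1 (C.hasFDerivAt hp) 1
      simp only [C.chart_one] at this
      exact this.differentiableAt
    have h1 : HasFDerivWithinAt R.tau (fderiv ℝ R.tau p) (R.sphere (R.tau p)) p :=
      h0.hasFDerivAt.hasFDerivWithinAt
    have h2 : HasFDerivWithinAt R.tau (0 : ST →L[ℝ] ℝ) (R.sphere (R.tau p)) p :=
      (hasFDerivWithinAt_const (R.tau p) p _).congr (fun x hx => hx.2.2) rfl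
    exact h1.unique_on h2 hX
  · rintro ⟨hX, hX'⟩
    rw [C.fderiv_u hp] at hX
    rw [C.fderiv_tau hp] at hX'
    rw [← C.fderiv_symm_fderiv hp X]
    set w := fderiv ℝ C.chart p X with hw
    refine Submodule.subset_span (tangentConeAt_mono_field (C.mem_posTangentConeAt hp w ?_))
    obtain ⟨hu0, hτ⟩ := (C.lateral_iff p hp).1 hl
    refine Eventually.of_forall fun s p' hp' hpp => ?_
    have ht : R.tau p' = R.tau p := by rw [← C.chart_one p', hpp]; simp [hX', C.chart_one]
    have hl' : p' ∈ R.lateral := by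
      rw [C.lateral_iff p' hp', ht]
      exact ⟨by rw [hpp]; simp [hX, hu0], hτ⟩
    refine ⟨hl', ?_, ht⟩
    rw [C.region_iff p' hp', ht]
    exact ⟨((C.lateral_iff p' hp').1 hl').1.le, hτ⟩

lemma fderiv_u_nonpos_of_mem_slice (hp : p ∈ C.chart.source) (hl : p ∈ R.lateral) {X : ST}
    (hX : X ∈ posTangentConeAt (R.slice (R.tau p)) p) : fderiv ℝ C.u p X ≤ 0 := by
  refine IsLocalMaxOn.hasFDerivWithinAt_nonpos (f := C.u) (s := R.slice (R.tau p)) ?_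
    ((C.u_contDiffAt hp).differentiableAt (by simp)).hasFDerivAt.hasFDerivWithinAt hX
  filter_upwards [self_mem_nhdsWithin, nhdsWithin_le_nhds (C.chart.open_source.mem_nhds hp)]
    with p' h1 h2
  rw [show C.u p = 0 from ((C.lateral_iff p hp).1 hl).1]
  exact ((C.region_iff p' h2).1 h1.1).1

lemma mem_posTangentConeAt_slice (hp : p ∈ C.chart.source) (hl : p ∈ R.lateral) {X : ST}
    (hu : fderiv ℝ C.u p X ≤ 0) (hτ : fderiv ℝ R.tau p X = 0) :
    X ∈ posTangentConeAt (R.slice (R.tau p)) p := by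
  rw [C.fderiv_u hp] at hu
  rw [C.fderiv_tau hp] at hτ
  rw [← C.fderiv_symm_fderiv hp X]
  set w := fderiv ℝ C.chart p X with hw
  refine C.mem_posTangentConeAt hp w ?_
  obtain ⟨hu0, hτ'⟩ := (C.lateral_iff p hp).1 hl
  filter_upwards [self_mem_nhdsWithin] with s hs p' hp' hpp
  have hs' : (0 : ℝ) < s := hs
  have ht : R.tau p' = R.tau p := by rw [← C.chart_one p', hpp]; simp [hτ, C.chart_one]
  refine ⟨?_, ht⟩
  rw [C.region_iff p' hp', ht, hpp]
  refine ⟨?_, hτ'⟩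
  simp only [Pi.add_apply, Pi.smul_apply, smul_eq_mul, hu0, zero_add]
  nlinarith

end LatChart

/-! ### The frame along the lateral boundary -/

namespace LatChart

variable {R : Region} {F : Fluid} (C : LatChart R) {p : ST}

/-- The gradient of the boundary defining function `u`. -/
def gradU (F : Fluid) (p : ST) : ST := F.sharp p (fderiv ℝ C.u p)

/-- The projection of the gradient of `u` onto the slices. -/
def sliceGradU (F : Fluid) (p : ST) : ST :=
  C.gradU F p + fderiv ℝ C.u p (R.Nhat F p) • R.Nhat F p

/-- A vector field tangent to the lateral boundary and orthogonal to the surfaces `S_τ`. -/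
def preGenerator (F : Fluid) (p : ST) : ST :=
  F.g p (C.sliceGradU F p) (C.sliceGradU F p) • R.Nhat F p
    - fderiv ℝ C.u p (R.Nhat F p) • C.sliceGradU F p

lemma exists_transversal (hp : p ∈ C.chart.source) :
    ∃ X, fderiv ℝ C.u p X = 1 ∧ fderiv ℝ R.tau p X = 0 := by
  refine ⟨fderiv ℝ C.chart.symm (C.chart p) (Pi.single 0 1), ?_, ?_⟩
  · rw [C.fderiv_u hp, C.fderiv_fderiv_symm hp]; simp
  · rw [C.fderiv_tau hp, C.fderiv_fderiv_symm hp]; simp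

variable (hF : F.IsEulerSolution R.ambient R.region) (hR : R.IsAdmissible F)
include hF hR

lemma g_gradU (hr : p ∈ R.region) (X : ST) : F.g p (C.gradU F p) X = fderiv ℝ C.u p X :=
  F.g_sharp (hR.c_pos hF hr) _ X

lemma g_sliceGradU (hr : p ∈ R.region) (X : ST) : F.g p (C.sliceGradU F p) X
    = fderiv ℝ C.u p X + fderiv ℝ C.u p (R.Nhat F p) * F.g p (R.Nhat F p) X := by
  rw [sliceGradU, F.g_add_left, F.g_smul_left, C.g_gradU hF hR hr]

lemma g_Nhat_sliceGradU (hr : p ∈ R.region) : F.g p (R.Nhat F p) (C.sliceGradU F p) = 0 := by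
  rw [F.g_comm, C.g_sliceGradU hF hR hr, hR.g_Nhat_self hF hr]
  ring

lemma g_sliceGradU_self (hr : p ∈ R.region) : F.g p (C.sliceGradU F p) (C.sliceGradU F p)
    = fderiv ℝ C.u p (C.sliceGradU F p) := by
  rw [C.g_sliceGradU hF hR hr, C.g_Nhat_sliceGradU hF hR hr]
  ring

lemma g_sliceGradU_self_pos (hp : p ∈ C.chart.source) (hr : p ∈ R.region) :
    0 < F.g p (C.sliceGradU F p) (C.sliceGradU F p) := by
  refine hR.g_pos_of_tau hF hr ((hR.g_Nhat_eq_zero_iff hF hr _).1 (C.g_Nhat_sliceGradU hF hR hr)) ?_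
  intro h
  obtain ⟨X, h1, h2⟩ := C.exists_transversal hp
  have := C.g_sliceGradU hF hR hr X
  rw [h, h1, (hR.g_Nhat_eq_zero_iff hF hr X).2 h2, F.g_zero_left] at this
  simp at this

/-- The normal space of the lateral boundary is spanned by the gradient of `u`. -/
lemma isNormalToLateral_iff (hp : p ∈ C.chart.source) (hl : p ∈ R.lateral) (X : ST) :
    R.IsNormalToLateral F p X ↔ ∃ a : ℝ, X = a • C.gradU F p := by
  have hr := hR.lateral_subset hl
  constructor
  · intro h
    obtain ⟨a, ha⟩ := exists_smul_of_ker_le_ker (φ := fderiv ℝ C.u p)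
      (ψ := (F.gBil p X).toContinuousLinearMap)
      fun Y hY => h Y ((C.mem_tangentSpaceAt_lateral hp hl hR.T_pos Y).2 hY)
    refine ⟨a, F.eq_of_g_eq (hR.c_pos hF hr) fun Y => ?_⟩
    rw [F.g_smul_left, C.g_gradU hF hR hr]
    exact ha Y
  · rintro ⟨a, rfl⟩ Y hY
    rw [F.g_smul_left, C.g_gradU hF hR hr,
      (C.mem_tangentSpaceAt_lateral hp hl hR.T_pos Y).1 hY, mul_zero]

lemma gradU_ne_zero (hp : p ∈ C.chart.source) (hr : p ∈ R.region) : C.gradU F p ≠ 0 := by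
  intro h
  obtain ⟨X, h1, -⟩ := C.exists_transversal hp
  rw [← C.g_gradU hF hR hr, h, F.g_zero_left] at h1
  exact zero_ne_one h1

/-- The causality of the lateral boundary makes its normals causal, so that they can be normalized by
their time component. -/
lemma gradU_time_ne_zero (hp : p ∈ C.chart.source) (hl : p ∈ R.lateral) : C.gradU F p 0 ≠ 0 := by
  have hr := hR.lateral_subset hl
  have hn := C.gradU_ne_zero hF hR hp hr
  have hN : R.IsNormalToLateral F p (C.gradU F p) :=
    (C.isNormalToLateral_iff hF hR hp hl _).2 ⟨1, (one_smul _ _).symm⟩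
  refine F.time_ne_zero_of_causal (hR.c_pos hF hr) hn ?_
  rcases hR.causal with h | h
  · exact (h p hl _ hn hN).le
  · exact (h p hl _ hn hN).le

lemma Nbar_eq (hp : p ∈ C.chart.source) (hl : p ∈ R.lateral) :
    R.Nbar F p = (C.gradU F p 0)⁻¹ • C.gradU F p := by
  have h0 := C.gradU_time_ne_zero hF hR hp hl
  have hex : ∃ X, R.IsNormalToLateral F p X ∧ X 0 = 1 :=
    ⟨(C.gradU F p 0)⁻¹ • C.gradU F p, (C.isNormalToLateral_iff hF hR hp hl _).2 ⟨_, rfl⟩,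
      by simp [h0]⟩
  obtain ⟨h1, h2⟩ := Classical.epsilon_spec hex
  obtain ⟨a, ha⟩ := (C.isNormalToLateral_iff hF hR hp hl _).1 h1
  change R.Nbar F p = a • _ at ha
  change R.Nbar F p 0 = 1 at h2
  rw [ha] at h2 ⊢
  congr 1
  rw [Pi.smul_apply, smul_eq_mul] at h2
  exact eq_inv_of_mul_eq_one_left h2

lemma isNormalToSphere_sliceGradU (hp : p ∈ C.chart.source) (hl : p ∈ R.lateral) :
    R.IsNormalToSphere F p (C.sliceGradU F p) := by
  intro Y hY
  have hr := hR.lateral_subset hl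
  obtain ⟨h1, h2⟩ := (C.mem_tangentSpaceAt_sphere hp hl Y).1 hY
  rw [C.g_sliceGradU hF hR hr, h1, (hR.g_Nhat_eq_zero_iff hF hr Y).2 h2]
  simp

omit hF in
/-- A vector tangent to `S_τ` and orthogonal to it vanishes. -/
lemma eq_zero_of_tangent_of_normal (hF : F.IsEulerSolution R.ambient R.region)
    (hp : p ∈ C.chart.source) (hl : p ∈ R.lateral) {X : ST}
    (hu : fderiv ℝ C.u p X = 0) (hτ : fderiv ℝ R.tau p X = 0) (hX : R.IsNormalToSphere F p X) :
    X = 0 := by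
  by_contra hne
  have h1 := hR.g_pos_of_tau hF (hR.lateral_subset hl) hτ hne
  rw [hX X ((C.mem_tangentSpaceAt_sphere hp hl X).2 ⟨hu, hτ⟩)] at h1
  exact lt_irrefl _ h1

omit hF hR in
lemma isNormalToSphere_sub_smul {X Y : ST} (hX : R.IsNormalToSphere F p X)
    (hY : R.IsNormalToSphere F p Y) (a : ℝ) : R.IsNormalToSphere F p (X - a • Y) := by
  intro W hW
  rw [F.g_sub_left, F.g_smul_left, hX W hW, hY W hW]
  ring

/-- The outer normal exists and is unique: the condition that `-Z` points into the slice, where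
`u ≤ 0`, fixes the sign. -/
lemma Z_spec_eq (hp : p ∈ C.chart.source) (hl : p ∈ R.lateral) :
    R.Z F p = (Real.sqrt (F.g p (C.sliceGradU F p) (C.sliceGradU F p)))⁻¹ • C.sliceGradU F p := by
  have hr := hR.lateral_subset hl
  have hpos := C.g_sliceGradU_self_pos hF hR hp hr
  set A := F.g p (C.sliceGradU F p) (C.sliceGradU F p) with hA
  have hs : 0 < Real.sqrt A := Real.sqrt_pos.2 hpos
  have hss : Real.sqrt A * Real.sqrt A = A := Real.mul_self_sqrt hpos.le
  have hτQ : fderiv ℝ R.tau p (C.sliceGradU F p) = 0 :=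
    (hR.g_Nhat_eq_zero_iff hF hr _).1 (C.g_Nhat_sliceGradU hF hR hr)
  have huQ : fderiv ℝ C.u p (C.sliceGradU F p) = A := (C.g_sliceGradU_self hF hR hr).symm
  have hex : ∃ X, R.IsOuterNormal F p X := by
    refine ⟨(Real.sqrt A)⁻¹ • C.sliceGradU F p, ?_, ?_, ?_, ?_⟩
    · rw [map_smul, hτQ, smul_zero]
    · intro Y hY
      rw [F.g_smul_left, C.isNormalToSphere_sliceGradU hF hR hp hl Y hY, mul_zero]
    · rw [F.g_smul_left, F.g_smul_right, ← hA]
      field_simp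
      nlinarith
    · refine C.mem_posTangentConeAt_slice hp hl ?_ ?_
      · rw [map_neg, map_smul, huQ, smul_eq_mul]
        have := mul_pos (inv_pos.2 hs) hpos
        linarith
      · rw [map_neg, map_smul, hτQ, smul_zero, neg_zero]
  obtain ⟨h1, h2, h3, h4⟩ := Classical.epsilon_spec hex
  change fderiv ℝ R.tau p (R.Z F p) = 0 at h1
  change R.IsNormalToSphere F p (R.Z F p) at h2
  change F.g p (R.Z F p) (R.Z F p) = 1 at h3
  change -R.Z F p ∈ posTangentConeAt (R.slice (R.tau p)) p at h4
  set t := fderiv ℝ C.u p (R.Z F p) / A with ht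
  have hZ : R.Z F p = t • C.sliceGradU F p := by
    refine sub_eq_zero.1 (C.eq_zero_of_tangent_of_normal hR hF hp hl ?_ ?_
      (isNormalToSphere_sub_smul h2 (C.isNormalToSphere_sliceGradU hF hR hp hl) t))
    · rw [map_sub, map_smul, huQ, ht, smul_eq_mul, div_mul_cancel₀ _ hpos.ne', sub_self]
    · rw [map_sub, map_smul, hτQ, h1, smul_zero, sub_zero]
  have ht0 : 0 ≤ t := by
    have := C.fderiv_u_nonpos_of_mem_slice hp hl h4
    rw [map_neg] at this
    exact div_nonneg (by linarith) hpos.le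
  rw [hZ, F.g_smul_left, F.g_smul_right, ← hA] at h3
  rw [hZ]
  congr 1
  refine eq_inv_of_mul_eq_one_left ?_
  have h5 : (t * Real.sqrt A) ^ 2 = 1 := by
    rw [mul_pow, sq (Real.sqrt A), hss]; linarith
  nlinarith [mul_nonneg ht0 hs.le]

lemma isNormalToSphere_preGenerator (hp : p ∈ C.chart.source) (hl : p ∈ R.lateral) :
    R.IsNormalToSphere F p (C.preGenerator F p) := by
  intro Y hY
  have hr := hR.lateral_subset hl
  obtain ⟨h1, h2⟩ := (C.mem_tangentSpaceAt_sphere hp hl Y).1 hY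
  rw [preGenerator, F.g_sub_left, F.g_smul_left, F.g_smul_left,
    C.isNormalToSphere_sliceGradU hF hR hp hl Y hY, (hR.g_Nhat_eq_zero_iff hF hr Y).2 h2]
  simp

/-- The generator is unique because the normal space of `S_τ` meets the tangent space of the lateral
boundary in a line; the existence assumption says that the time component does not vanish on it. -/
lemma H_eq (hp : p ∈ C.chart.source) (hl : p ∈ R.lateral) :
    C.preGenerator F p 0 ≠ 0 ∧ R.H F p = (C.preGenerator F p 0)⁻¹ • C.preGenerator F p := by
  have hr := hR.lateral_subset hl
  have hpos := C.g_sliceGradU_self_pos hF hR hp hr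
  set A := F.g p (C.sliceGradU F p) (C.sliceGradU F p) with hA
  obtain ⟨h1, h2, h3⟩ := Classical.epsilon_spec (hR.generator_exists p hl)
  change R.H F p ∈ _ at h1
  change R.IsNormalToSphere F p (R.H F p) at h2
  change R.H F p 0 = 1 at h3
  rw [C.mem_tangentSpaceAt_lateral hp hl hR.T_pos] at h1
  have huL : fderiv ℝ C.u p (C.preGenerator F p) = 0 := by
    rw [preGenerator, map_sub, map_smul, map_smul, ← C.g_sliceGradU_self hF hR hr]
    simp only [smul_eq_mul]; ring
  have hNL : F.g p (R.Nhat F p) (C.preGenerator F p) = -A := by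
    rw [preGenerator, F.g_sub_right, F.g_smul_right, F.g_smul_right, hR.g_Nhat_self hF hr,
      C.g_Nhat_sliceGradU hF hR hr, ← hA]
    ring
  set t := F.g p (R.Nhat F p) (R.H F p) / (-A) with ht
  have hH : R.H F p = t • C.preGenerator F p := by
    refine sub_eq_zero.1 (C.eq_zero_of_tangent_of_normal hR hF hp hl ?_ ?_
      (isNormalToSphere_sub_smul h2 (C.isNormalToSphere_preGenerator hF hR hp hl) t))
    · rw [map_sub, map_smul, huL, h1, smul_zero, sub_zero]
    · rw [← hR.g_Nhat_eq_zero_iff hF hr, F.g_sub_right, F.g_smul_right, hNL, ht,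
        div_mul_cancel₀ _ (neg_ne_zero.2 hpos.ne'), sub_self]
  rw [hH, Pi.smul_apply, smul_eq_mul] at h3
  refine ⟨fun h => by simp [h] at h3, ?_⟩
  rw [hH]
  congr 1
  exact eq_inv_of_mul_eq_one_left h3

omit hF hR in
lemma fderiv_u_smooth (hp : p ∈ C.chart.source) : ContDiffAt ℝ ∞ (fderiv ℝ C.u) p :=
  (C.u_contDiffAt hp).fderiv_right (by simp)

lemma gradU_contDiffAt (hp : p ∈ C.chart.source) (hr : p ∈ R.region) :
    ContDiffAt ℝ ∞ (C.gradU F) p := by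
  rw [← contDiffWithinAt_univ]
  exact hF.sharp_contDiffWithinAt hR.ambient_open le_rfl (hR.mem_goodSet hF hr)
    (C.fderiv_u_smooth hp).contDiffWithinAt

lemma sliceGradU_contDiffAt (hp : p ∈ C.chart.source) (hr : p ∈ R.region) :
    ContDiffAt ℝ ∞ (C.sliceGradU F) p :=
  (C.gradU_contDiffAt hF hR hp hr).add
    (((C.fderiv_u_smooth hp).clm_apply (hR.Nhat_contDiffAt hF hr)).smul
      (hR.Nhat_contDiffAt hF hr))

lemma normSq_sliceGradU_contDiffAt (hp : p ∈ C.chart.source) (hr : p ∈ R.region) :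
    ContDiffAt ℝ ∞ (fun p => F.g p (C.sliceGradU F p) (C.sliceGradU F p)) p := by
  have h := C.sliceGradU_contDiffAt hF hR hp hr
  rw [← contDiffWithinAt_univ] at h ⊢
  exact hF.g_contDiffWithinAt hR.ambient_open le_rfl (hR.mem_goodSet hF hr) h h

lemma preGenerator_contDiffAt (hp : p ∈ C.chart.source) (hr : p ∈ R.region) :
    ContDiffAt ℝ ∞ (C.preGenerator F) p :=
  ((C.normSq_sliceGradU_contDiffAt hF hR hp hr).smul (hR.Nhat_contDiffAt hF hr)).sub
    (((C.fderiv_u_smooth hp).clm_apply (hR.Nhat_contDiffAt hF hr)).smul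
      (C.sliceGradU_contDiffAt hF hR hp hr))

end LatChart

namespace Region

variable {R : Region} {F : Fluid} {q : ST}

/-- `X` is tangent at `q` to the surface `S_{tau q}`. -/
def IsSphereTangent (R : Region) (F : Fluid) (q X : ST) : Prop :=
  F.g q (R.Nhat F q) X = 0 ∧ F.g q (R.Z F q) X = 0

namespace IsAdmissible

variable (hF : F.IsEulerSolution R.ambient R.region) (hR : R.IsAdmissible F)
include hF hR

omit hF in
/-- Along the lateral boundary, a field that agrees near each point, in terms of a chart, with a
smooth field is smooth. -/
lemma contDiffOn_lateral_of_chart {G : Type*} [NormedAddCommGroup G] [NormedSpace ℝ G]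
    {f : ST → G} (h : ∀ (C : LatChart R) (p : ST), p ∈ C.chart.source → p ∈ R.lateral →
      ∃ f' : ST → G, ContDiffAt ℝ ∞ f' p ∧ ∀ p' ∈ C.chart.source, p' ∈ R.lateral → f p' = f' p') :
    ContDiffOn ℝ ∞ f R.lateral := by
  intro p hp
  obtain ⟨C, hC⟩ := hR.exists_latChart hp
  obtain ⟨f', h1, h2⟩ := h C p hC hp
  refine h1.contDiffWithinAt.congr_of_eventuallyEq ?_ (h2 p hC hp)
  filter_upwards [self_mem_nhdsWithin, nhdsWithin_le_nhds (C.chart.open_source.mem_nhds hC)]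
    with p' h3 h4 using h2 p' h4 h3

lemma Nbar_contDiffOn : ContDiffOn ℝ ∞ (R.Nbar F) R.lateral :=
  hR.contDiffOn_lateral_of_chart fun C _ hp hl => ⟨_,
    ((contDiffAt_pi.1 (C.gradU_contDiffAt hF hR hp (hR.lateral_subset hl)) 0).inv
      (C.gradU_time_ne_zero hF hR hp hl)).smul (C.gradU_contDiffAt hF hR hp (hR.lateral_subset hl)),
    fun _ hp' hl' => C.Nbar_eq hF hR hp' hl'⟩

lemma Z_contDiffOn : ContDiffOn ℝ ∞ (R.Z F) R.lateral :=
  hR.contDiffOn_lateral_of_chart fun C _ hp hl => ⟨_,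
    (((C.normSq_sliceGradU_contDiffAt hF hR hp (hR.lateral_subset hl)).sqrt
      (C.g_sliceGradU_self_pos hF hR hp (hR.lateral_subset hl)).ne').inv
      (Real.sqrt_pos.2 (C.g_sliceGradU_self_pos hF hR hp (hR.lateral_subset hl))).ne').smul
      (C.sliceGradU_contDiffAt hF hR hp (hR.lateral_subset hl)),
    fun _ hp' hl' => C.Z_spec_eq hF hR hp' hl'⟩

lemma H_contDiffOn : ContDiffOn ℝ ∞ (R.H F) R.lateral :=
  hR.contDiffOn_lateral_of_chart fun C _ hp hl => ⟨_,
    ((contDiffAt_pi.1 (C.preGenerator_contDiffAt hF hR hp (hR.lateral_subset hl)) 0).inv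
      (C.H_eq hF hR hp hl).1).smul (C.preGenerator_contDiffAt hF hR hp (hR.lateral_subset hl)),
    fun _ hp' hl' => (C.H_eq hF hR hp' hl').2⟩

lemma Nbar_time (hq : q ∈ R.lateral) : R.Nbar F q 0 = 1 := by
  obtain ⟨C, hC⟩ := hR.exists_latChart hq
  rw [C.Nbar_eq hF hR hC hq]
  simp [C.gradU_time_ne_zero hF hR hC hq]

lemma isNormalToLateral_Nbar (hq : q ∈ R.lateral) : R.IsNormalToLateral F q (R.Nbar F q) := by
  obtain ⟨C, hC⟩ := hR.exists_latChart hq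
  rw [C.Nbar_eq hF hR hC hq, C.isNormalToLateral_iff hF hR hC hq]
  exact ⟨_, rfl⟩

lemma mem_tangentSpaceAt_iff (hq : q ∈ R.lateral) (X : ST) :
    X ∈ tangentSpaceAt R.lateral q ↔ F.g q (R.Nbar F q) X = 0 := by
  obtain ⟨C, hC⟩ := hR.exists_latChart hq
  rw [C.mem_tangentSpaceAt_lateral hC hq hR.T_pos, C.Nbar_eq hF hR hC hq, F.g_smul_left,
    C.g_gradU hF hR (hR.lateral_subset hq)]
  simp [C.gradU_time_ne_zero hF hR hC hq]

lemma mem_tangentSpaceAt_sphere_iff (hq : q ∈ R.lateral) (X : ST) :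
    X ∈ tangentSpaceAt (R.sphere (R.tau q)) q ↔ R.IsSphereTangent F q X := by
  obtain ⟨C, hC⟩ := hR.exists_latChart hq
  have hr := hR.lateral_subset hq
  have hpos := C.g_sliceGradU_self_pos hF hR hC hr
  rw [C.mem_tangentSpaceAt_sphere hC hq, IsSphereTangent, C.Z_spec_eq hF hR hC hq, F.g_smul_left,
    C.g_sliceGradU hF hR hr X, hR.g_Nhat_eq_zero_iff hF hr, and_comm]
  refine and_congr_right fun h => ?_
  rw [(hR.g_Nhat_eq_zero_iff hF hr X).2 h]
  simp [(Real.sqrt_pos.2 hpos).ne']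

lemma isOuterNormal_Z (hq : q ∈ R.lateral) :
    F.g q (R.Nhat F q) (R.Z F q) = 0 ∧ F.g q (R.Z F q) (R.Z F q) = 1 := by
  obtain ⟨C, hC⟩ := hR.exists_latChart hq
  have hr := hR.lateral_subset hq
  have hpos := C.g_sliceGradU_self_pos hF hR hC hr
  rw [C.Z_spec_eq hF hR hC hq]
  simp only [F.g_smul_left, F.g_smul_right, C.g_Nhat_sliceGradU hF hR hr, mul_zero, true_and]
  rw [← mul_assoc, ← mul_inv, Real.mul_self_sqrt hpos.le, inv_mul_cancel₀ hpos.ne']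

lemma g_Nhat_Z (hq : q ∈ R.lateral) : F.g q (R.Nhat F q) (R.Z F q) = 0 :=
  (hR.isOuterNormal_Z hF hq).1

lemma g_Z_self (hq : q ∈ R.lateral) : F.g q (R.Z F q) (R.Z F q) = 1 :=
  (hR.isOuterNormal_Z hF hq).2

omit hF in
lemma isGenerator_H (hq : q ∈ R.lateral) : R.IsGenerator F q (R.H F q) :=
  Classical.epsilon_spec (hR.generator_exists q hq)

omit hF in
lemma H_time (hq : q ∈ R.lateral) : R.H F q 0 = 1 := (hR.isGenerator_H hq).2.2

lemma g_H_of_isSphereTangent (hq : q ∈ R.lateral) {X : ST} (hX : R.IsSphereTangent F q X) :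
    F.g q (R.H F q) X = 0 :=
  (hR.isGenerator_H hq).2.1 X ((hR.mem_tangentSpaceAt_sphere_iff hF hq X).2 hX)

lemma g_Nbar_H (hq : q ∈ R.lateral) : F.g q (R.Nbar F q) (R.H F q) = 0 :=
  (hR.mem_tangentSpaceAt_iff hF hq _).1 (hR.isGenerator_H hq).1

/-- The surfaces `S_τ` are contained in the lateral boundary. -/
lemma tangent_of_isSphereTangent (hq : q ∈ R.lateral) {X : ST} (hX : R.IsSphereTangent F q X) :
    X ∈ tangentSpaceAt R.lateral q :=
  Submodule.span_mono (tangentConeAt_mono inter_subset_left)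
    ((hR.mem_tangentSpaceAt_sphere_iff hF hq X).2 hX)

/-- A vector tangent to the lateral boundary and to the slice is tangent to `S_τ`. -/
lemma isSphereTangent_of (hq : q ∈ R.lateral) {X : ST} (h1 : F.g q (R.Nbar F q) X = 0)
    (h2 : F.g q (R.Nhat F q) X = 0) : R.IsSphereTangent F q X := by
  obtain ⟨C, hC⟩ := hR.exists_latChart hq
  have hr := hR.lateral_subset hq
  rw [← hR.mem_tangentSpaceAt_sphere_iff hF hq, C.mem_tangentSpaceAt_sphere hC hq,
    ← C.mem_tangentSpaceAt_lateral hC hq hR.T_pos, hR.mem_tangentSpaceAt_iff hF hq,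
    ← hR.g_Nhat_eq_zero_iff hF hr]
  exact ⟨h1, h2⟩

omit hF in
lemma g_N_B (hq : q ∈ R.lateral) : F.g q (R.N F q) (F.B q) = -1 := by
  rw [F.g_B_right, hR.N_time (hR.lateral_subset hq)]

lemma g_Nbar_B (hq : q ∈ R.lateral) : F.g q (R.Nbar F q) (F.B q) = -1 := by
  rw [F.g_B_right, hR.Nbar_time hF hq]

lemma h_eq (hq : q ∈ R.lateral) :
    R.h F q = fderiv ℝ R.tau q (R.H F q) / fderiv ℝ R.tau q (F.B q) := by
  have hr := hR.lateral_subset hq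
  rw [h, F.g_comm, hR.g_N hF hr, gradTau_eq_sharp, F.sharp_zero_comp]
  rw [inv_neg]
  ring

lemma H_tau_pos (hq : q ∈ R.lateral) : 0 < fderiv ℝ R.tau q (R.H F q) := by
  have h1 := hR.h_eq hF hq
  have h2 := hR.tau_past q (hR.lateral_subset hq)
  have h3 := hR.h_pos q hq
  rw [h1] at h3
  exact (div_pos_iff_of_pos_right h2).1 h3

lemma lapse_pos (hq : q ∈ R.lateral) : 0 < R.lapse F q := inv_pos.2 (hR.H_tau_pos hF hq)

lemma fderiv_tau_Hbreve (hq : q ∈ R.lateral) : fderiv ℝ R.tau q (R.Hbreve F q) = 1 := by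
  rw [Hbreve, map_smul, lapse, smul_eq_mul, inv_mul_cancel₀ (hR.H_tau_pos hF hq).ne']

end IsAdmissible

end Region

/-! ### Derivatives along the lateral boundary -/

namespace Region

variable {R : Region} {F : Fluid} {q X : ST}
variable {G : Type*} [NormedAddCommGroup G] [NormedSpace ℝ G]

/-- In tangential directions every derivative within the lateral boundary is the derivative, even
though the lateral boundary is not a set of unique differentiability. -/
lemma along_eq {f : ST → G} {f' : ST →L[ℝ] G} (h : HasFDerivWithinAt f f' R.lateral q)
    (hX : X ∈ tangentSpaceAt R.lateral q) : R.along f q X = f' X := by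
  have h1 := h.differentiableWithinAt.hasFDerivWithinAt
  have h2 : Set.EqOn (fderivWithin ℝ f R.lateral q) f' (tangentConeAt ℝ R.lateral q) :=
    h1.unique_on h
  exact LinearMap.eqOn_span (f := (fderivWithin ℝ f R.lateral q).toLinearMap)
    (g := f'.toLinearMap) h2 hX

lemma along_eq_fderiv {f : ST → G} (h : DifferentiableAt ℝ f q)
    (hX : X ∈ tangentSpaceAt R.lateral q) : R.along f q X = fderiv ℝ f q X :=
  along_eq h.hasFDerivAt.hasFDerivWithinAt hX

lemma along_congr {f f' : ST → G} (h : EqOn f f' R.lateral) (hq : q ∈ R.lateral) (X : ST) :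
    R.along f q X = R.along f' q X := by
  rw [along, along, fderivWithin_congr h (h hq)]

lemma along_add_right (f : ST → G) (X Y : ST) :
    R.along f q (X + Y) = R.along f q X + R.along f q Y := map_add _ _ _

lemma along_sub_right (f : ST → G) (X Y : ST) :
    R.along f q (X - Y) = R.along f q X - R.along f q Y := map_sub _ _ _

lemma along_smul_right (f : ST → G) (a : ℝ) (X : ST) :
    R.along f q (a • X) = a • R.along f q X := map_smul _ _ _

lemma along_sum_right {ι : Type*} (s : Finset ι) (f : ST → G) (X : ι → ST) :
    R.along f q (∑ i ∈ s, X i) = ∑ i ∈ s, R.along f q (X i) := map_sum _ _ _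

section

variable (hX : X ∈ tangentSpaceAt R.lateral q)
include hX

lemma along_mul {f f' : ST → ℝ} (hf : DifferentiableWithinAt ℝ f R.lateral q)
    (hf' : DifferentiableWithinAt ℝ f' R.lateral q) :
    R.along (fun p => f p * f' p) q X = f q * R.along f' q X + f' q * R.along f q X := by
  rw [along_eq (hf.hasFDerivWithinAt.fun_mul hf'.hasFDerivWithinAt) hX]
  simp [along]

lemma along_add {f f' : ST → G} (hf : DifferentiableWithinAt ℝ f R.lateral q)
    (hf' : DifferentiableWithinAt ℝ f' R.lateral q) :
    R.along (fun p => f p + f' p) q X = R.along f q X + R.along f' q X := by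
  rw [along_eq (hf.hasFDerivWithinAt.fun_add hf'.hasFDerivWithinAt) hX]
  simp [along]

lemma along_sub {f f' : ST → G} (hf : DifferentiableWithinAt ℝ f R.lateral q)
    (hf' : DifferentiableWithinAt ℝ f' R.lateral q) :
    R.along (fun p => f p - f' p) q X = R.along f q X - R.along f' q X := by
  rw [along_eq (hf.hasFDerivWithinAt.fun_sub hf'.hasFDerivWithinAt) hX]
  simp [along]

lemma along_sum {ι : Type*} (s : Finset ι) {f : ι → ST → G}
    (hf : ∀ i ∈ s, DifferentiableWithinAt ℝ (f i) R.lateral q) :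
    R.along (fun p => ∑ i ∈ s, f i p) q X = ∑ i ∈ s, R.along (f i) q X := by
  rw [along_eq (HasFDerivWithinAt.fun_sum fun i hi => (hf i hi).hasFDerivWithinAt) hX]
  simp [along]

lemma along_apply {f : ST → ST} (hf : DifferentiableWithinAt ℝ f R.lateral q) (α : Fin 4) :
    R.along (fun p => f p α) q X = R.along f q X α :=
  along_eq (hasFDerivWithinAt_pi'.1 hf.hasFDerivWithinAt α) hX

end

lemma differentiableWithinAt_apply {f : ST → ST} (hf : DifferentiableWithinAt ℝ f R.lateral q)
    (α : Fin 4) : DifferentiableWithinAt ℝ (fun p => f p α) R.lateral q :=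
  differentiableWithinAt_pi.1 hf α

/-- The derivative along a smooth tangential field of a smooth function on the lateral boundary is
continuous. -/
lemma continuousOn_along {f : ST → G} {X : ST → ST} (hf : ContDiffOn ℝ ∞ f R.lateral)
    (hX : ContinuousOn X R.lateral) (hT : ∀ p ∈ R.lateral, X p ∈ tangentSpaceAt R.lateral p) :
    ContinuousOn (fun p => R.along f p (X p)) R.lateral := by
  intro q hq
  have h1 : ContDiffWithinAt ℝ (0 + 1) f R.lateral q := (hf q hq).of_le (by simp)
  obtain ⟨u, hu, -, f', hf', hcont⟩ := (contDiffWithinAt_succ_iff_hasFDerivWithinAt (by simp)).1 h1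
  rw [insert_eq_of_mem hq] at hu
  have hev : ∀ᶠ p in 𝓝[R.lateral] q, R.along f p (X p) = f' p (X p) := by
    have hu' := eventually_nhdsWithin_iff.1 (eventually_eventually_nhdsWithin.2 hu)
    filter_upwards [self_mem_nhdsWithin, eventually_eventually_nhdsWithin.2 hu, hu]
      with p hp hpu hpu'
    exact along_eq ((hf' p hpu').mono_of_mem_nhdsWithin hpu) (hT p hp)
  have hc : ContinuousWithinAt f' R.lateral q :=
    hcont.continuousWithinAt.mono_of_mem_nhdsWithin hu
  exact (hc.clm_apply (hX q hq)).congr_of_eventuallyEq hev (hev.self_of_nhdsWithin hq)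

end Region

namespace Fluid

variable (F : Fluid) (q : ST)

/-- The directional derivative of the components of the acoustical metric. -/
def dMetric (W X Y : ST) : ℝ :=
  ∑ α, ∑ β, fderiv ℝ (fun p => F.gLow p α β) q W * X α * Y β

lemma dMetric_comm (W X Y : ST) : F.dMetric q W X Y = F.dMetric q W Y X := by
  rw [dMetric, Finset.sum_comm, dMetric]
  refine Finset.sum_congr rfl fun α _ => Finset.sum_congr rfl fun β _ => ?_
  simp only [F.gLow_comm _ β α]
  ring

end Fluid

namespace Region

/-! ### Projections and traces -/

section Algebra

variable (R : Region) (F : Fluid) (q : ST)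

lemma tang_eq (X : ST) : R.tang F q X
    = X + F.g q (R.Nhat F q) X • R.Nhat F q - F.g q (R.Z F q) X • R.Z F q := by
  ext α
  simp only [tang, sphProj, sliceProj, sub_mul, add_mul, Finset.sum_sub_distrib,
    Finset.sum_add_distrib, Pi.add_apply, Pi.sub_apply, Pi.smul_apply, smul_eq_mul,
    F.g_eq_sum_lower, Finset.sum_mul]
  refine congrArg₂ _ (congrArg₂ _ (by simp) ?_) ?_ <;>
    exact Finset.sum_congr rfl fun β _ => by ring

lemma angCoord_eq (β : Fin 4) : R.angCoord F β q = R.tang F q (coordVec β) := by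
  ext α
  simp [angCoord, tang, coordVec_apply]

/-- The projection onto the surfaces `S_τ` as a linear map. -/
def tangL : ST →ₗ[ℝ] ST where
  toFun := R.tang F q
  map_add' X Y := by simp only [tang_eq, F.g_add_right, add_smul]; abel
  map_smul' a X := by
    simp only [tang_eq, F.g_smul_right, RingHom.id_apply, smul_sub, smul_add, smul_smul]

lemma tangL_apply (X : ST) : R.tangL F q X = R.tang F q X := rfl

lemma tang_eq_sum (X : ST) : R.tang F q X = ∑ β, X β • R.angCoord F β q := by
  simp only [angCoord_eq, ← tangL_apply]
  conv_lhs => rw [← sum_smul_coordVec X]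
  simp [map_sum]

lemma sphForm_eq (X Y : ST) : R.sphForm F q X Y = F.g q X Y
    + F.g q (R.Nhat F q) X * F.g q (R.Nhat F q) Y - F.g q (R.Z F q) X * F.g q (R.Z F q) Y := by
  rw [F.g_eq_sum q X Y]
  simp only [sphForm, sphLow, sub_mul, add_mul, Finset.sum_sub_distrib, Finset.sum_add_distrib]
  simp only [F.g_eq_sum_lower, Finset.sum_mul_sum]
  refine congrArg₂ _ (congrArg₂ _ rfl ?_) ?_ <;>
    exact Finset.sum_congr rfl fun α _ => Finset.sum_congr rfl fun β _ => by ring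

lemma sphInv_comm (α β : Fin 4) : R.sphInv F q α β = R.sphInv F q β α := by
  simp only [sphInv, F.gInv_comm q α β]
  ring

lemma trace_eq_sum (L : ST →ₗ[ℝ] ST) : LinearMap.trace ℝ ST L = ∑ δ, L (coordVec δ) δ := by
  rw [LinearMap.trace_eq_matrix_trace ℝ (Pi.basisFun ℝ (Fin 4)), Matrix.trace]
  refine Finset.sum_congr rfl fun δ _ => ?_
  simp [coordVec]

variable {q} in
lemma sum_gInv_lower (hc : 0 < F.c q) (X : ST) (α : Fin 4) :
    ∑ β, F.gInv q α β * F.lower q X β = X α := by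
  simp only [F.lower_eq_sum, Finset.mul_sum, ← mul_assoc]
  rw [Finset.sum_comm]
  have : ∀ γ, ∑ β, F.gInv q α β * F.gLow q γ β * X γ = (if α = γ then 1 else 0) * X γ := by
    intro γ
    rw [← Finset.sum_mul, ← F.sharp_coord hc]
    simp only [F.gLow_comm q γ]
  rw [Finset.sum_congr rfl fun γ _ => this γ]
  simp

variable {q} in
lemma sum_sphInv_lower (hc : 0 < F.c q) (X : ST) (α : Fin 4) :
    ∑ β, R.sphInv F q α β * F.lower q X β = R.tang F q X α := by
  simp only [sphInv, sub_mul, add_mul, Finset.sum_sub_distrib, Finset.sum_add_distrib]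
  rw [sum_gInv_lower F hc, tang_eq]
  simp only [Pi.add_apply, Pi.sub_apply, Pi.smul_apply, smul_eq_mul, mul_assoc, ← Finset.mul_sum]
  rw [F.g_comm q _ X, F.g_comm q _ X, F.g_eq_sum_lower, F.g_eq_sum_lower]
  simp only [mul_comm (F.lower q X _)]
  ring

end Algebra

namespace IsAdmissible

variable {R : Region} {F : Fluid} {q : ST}
variable (hF : F.IsEulerSolution R.ambient R.region) (hR : R.IsAdmissible F)
include hF hR

lemma g_Nhat_tang (hq : q ∈ R.lateral) (X : ST) : F.g q (R.Nhat F q) (R.tang F q X) = 0 := by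
  rw [R.tang_eq, F.g_sub_right, F.g_add_right, F.g_smul_right, F.g_smul_right,
    hR.g_Nhat_self hF (hR.lateral_subset hq), hR.g_Nhat_Z hF hq]
  ring

lemma g_Z_tang (hq : q ∈ R.lateral) (X : ST) : F.g q (R.Z F q) (R.tang F q X) = 0 := by
  rw [R.tang_eq, F.g_sub_right, F.g_add_right, F.g_smul_right, F.g_smul_right,
    F.g_comm q _ (R.Nhat F q), hR.g_Nhat_Z hF hq, hR.g_Z_self hF hq]
  ring

lemma isSphereTangent_tang (hq : q ∈ R.lateral) (X : ST) :
    R.IsSphereTangent F q (R.tang F q X) := ⟨hR.g_Nhat_tang hF hq X, hR.g_Z_tang hF hq X⟩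

omit hF hR in
lemma _root_.EulerBdry.Region.IsSphereTangent.tang_eq {X : ST} (hX : R.IsSphereTangent F q X) :
    R.tang F q X = X := by
  rw [Region.tang_eq, hX.1, hX.2]; simp

lemma tang_tang (hq : q ∈ R.lateral) (X : ST) :
    R.tang F q (R.tang F q X) = R.tang F q X :=
  (hR.isSphereTangent_tang hF hq X).tang_eq

omit hF hR in
lemma g_tang_left (X Y : ST) : F.g q (R.tang F q X) Y = F.g q X (R.tang F q Y) := by
  simp only [Region.tang_eq, F.g_sub_left, F.g_add_left, F.g_smul_left, F.g_sub_right,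
    F.g_add_right, F.g_smul_right, F.g_comm q X (R.Nhat F q), F.g_comm q X (R.Z F q)]
  ring

lemma tang_tangent (hq : q ∈ R.lateral) (X : ST) :
    R.tang F q X ∈ tangentSpaceAt R.lateral q :=
  hR.tangent_of_isSphereTangent hF hq (hR.isSphereTangent_tang hF hq X)

lemma angCoord_tangent (hq : q ∈ R.lateral) (β : Fin 4) :
    R.angCoord F β q ∈ tangentSpaceAt R.lateral q := by
  rw [R.angCoord_eq]; exact hR.tang_tangent hF hq _

/-- The trace over `S_τ` of an endomorphism. -/
lemma sum_angCoord_eq_tang (hq : q ∈ R.lateral) (L : ST →ₗ[ℝ] ST) :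
    ∑ δ, R.tang F q (L (R.angCoord F δ q)) δ = ∑ δ, L (R.angCoord F δ q) δ := by
  have h1 := trace_eq_sum (R.tangL F q ∘ₗ (L ∘ₗ R.tangL F q))
  have h2 := trace_eq_sum (L ∘ₗ R.tangL F q)
  simp only [LinearMap.comp_apply, R.tangL_apply, ← R.angCoord_eq] at h1 h2
  rw [← h1, ← h2, LinearMap.trace_comp_comm', LinearMap.comp_assoc]
  congr 2
  exact LinearMap.ext fun X => hR.tang_tang hF hq X

/-- The columns of the inverse first fundamental form are tangent to `S_τ`. -/
lemma isSphereTangent_sphInv (hq : q ∈ R.lateral) (β : Fin 4) :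
    R.IsSphereTangent F q (fun α => R.sphInv F q α β) := by
  have hc := hR.c_pos hF (hR.lateral_subset hq)
  have key : ∀ X : ST, F.g q X (fun α => R.sphInv F q α β) = R.tang F q X β := by
    intro X
    rw [F.g_eq_sum_lower, ← R.sum_sphInv_lower F hc]
    exact Finset.sum_congr rfl fun α _ => by rw [R.sphInv_comm F q α β, mul_comm]
  constructor
  · rw [key, Region.tang_eq, hR.g_Nhat_self hF (hR.lateral_subset hq), F.g_comm q (R.Z F q),
      hR.g_Nhat_Z hF hq]
    simp
  · rw [key, Region.tang_eq, hR.g_Nhat_Z hF hq, hR.g_Z_self hF hq]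
    simp

lemma sum_sphInv_sphProj (hq : q ∈ R.lateral) (α ν : Fin 4) :
    ∑ μ, R.sphInv F q μ ν * R.angCoord F μ q α = R.sphInv F q α ν := by
  have h := congrFun ((hR.isSphereTangent_sphInv hF hq ν).tang_eq) α
  rw [R.tang_eq_sum] at h
  simpa using h

/-- The trace over `S_τ` of a bilinear form can be computed with or without projections. -/
lemma sum_sphInv_bilin (hq : q ∈ R.lateral) (b : Fin 4 → Fin 4 → ℝ) :
    ∑ μ, ∑ ν, R.sphInv F q μ ν * ∑ α, ∑ β, b α β * R.angCoord F μ q α * R.angCoord F ν q β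
      = ∑ α, ∑ β, R.sphInv F q α β * b α β := by
  calc _ = ∑ α, ∑ β, b α β * ∑ ν, (∑ μ, R.sphInv F q μ ν * R.angCoord F μ q α)
        * R.angCoord F ν q β := by
        simp only [Finset.mul_sum, Finset.sum_mul]
        rw [Finset.sum_congr rfl fun μ _ => Finset.sum_comm, Finset.sum_comm]
        refine Finset.sum_congr rfl fun α _ => ?_
        rw [Finset.sum_congr rfl fun μ _ => Finset.sum_comm, Finset.sum_comm]
        refine Finset.sum_congr rfl fun β _ => ?_
        rw [Finset.sum_comm]
        exact Finset.sum_congr rfl fun ν _ => Finset.sum_congr rfl fun μ _ => by ring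
    _ = _ := by
        refine Finset.sum_congr rfl fun α _ => Finset.sum_congr rfl fun β _ => ?_
        simp only [hR.sum_sphInv_sphProj hF hq]
        simp only [R.sphInv_comm F q α, hR.sum_sphInv_sphProj hF hq]
        ring

/-! ### The divergence on `S_τ` -/

lemma sum_sphProj_gInv (hq : q ∈ R.lateral) (γ ε : Fin 4) :
    ∑ δ, R.sphProj F q γ δ * F.gInv q δ ε = R.sphInv F q γ ε := by
  have hc := hR.c_pos hF (hR.lateral_subset hq)
  simp only [sphProj, sliceProj, sub_mul, add_mul, Finset.sum_sub_distrib, Finset.sum_add_distrib,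
    sphInv, mul_assoc, ← Finset.mul_sum]
  have := fun X : ST => sum_gInv_lower F hc X ε
  simp only [mul_comm (F.lower q _ _), F.gInv_comm q _ ε, this]
  simp

/-- Contracted with the projection onto `S_τ`, two of the three derivatives in the Christoffel symbols
cancel by symmetry. -/
lemma sum_christoffel (hq : q ∈ R.lateral) (X : ST) :
    ∑ γ, ∑ δ, ∑ κ, R.sphProj F q γ δ * F.christoffel q γ δ κ * X κ
      = 1 / 2 * ∑ γ, ∑ ε, R.sphInv F q γ ε * fderiv ℝ (fun p => F.gLow p γ ε) q X := by
  set D : Fin 4 → Fin 4 → Fin 4 → ℝ :=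
    fun α β κ => fderiv ℝ (fun p => F.gLow p α β) q (coordVec κ) with hD
  have h1 : ∀ γ, ∑ δ, ∑ κ, R.sphProj F q γ δ * F.christoffel q γ δ κ * X κ
      = 1 / 2 * ∑ ε, R.sphInv F q γ ε * ∑ κ, (D ε κ γ + D γ ε κ - D γ κ ε) * X κ := by
    intro γ
    have e : ∀ δ, ∑ κ, R.sphProj F q γ δ * F.christoffel q γ δ κ * X κ
        = ∑ ε, 1 / 2 * (R.sphProj F q γ δ * F.gInv q δ ε
          * ∑ κ, (D ε κ γ + D γ ε κ - D γ κ ε) * X κ) := by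
      intro δ
      simp only [Fluid.christoffel, Finset.mul_sum, Finset.sum_mul]
      rw [Finset.sum_comm]
      refine Finset.sum_congr rfl fun ε _ => Finset.sum_congr rfl fun κ _ => ?_
      simp only [hD]
      ring
    simp only [e, ← hR.sum_sphProj_gInv hF hq]
    rw [Finset.sum_comm, Finset.mul_sum]
    exact Finset.sum_congr rfl fun ε _ => by rw [← Finset.mul_sum, ← Finset.sum_mul]
  simp only [h1, ← Finset.mul_sum]
  congr 1
  have h2 : ∀ γ ε, fderiv ℝ (fun p => F.gLow p γ ε) q X = ∑ κ, D γ ε κ * X κ := by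
    intro γ ε
    rw [map_eq_sum]
    exact Finset.sum_congr rfl fun κ _ => by rw [smul_eq_mul, mul_comm]
  have h3 : ∀ γ ε, ∑ κ, (D ε κ γ + D γ ε κ - D γ κ ε) * X κ
      = (∑ κ, D γ ε κ * X κ) + ((∑ κ, D ε κ γ * X κ) - ∑ κ, D γ κ ε * X κ) := by
    intro γ ε
    rw [← Finset.sum_sub_distrib, ← Finset.sum_add_distrib]
    exact Finset.sum_congr rfl fun κ _ => by ring
  simp only [h2, h3, mul_add, mul_sub, Finset.sum_add_distrib, Finset.sum_sub_distrib]
  have h4 : ∑ γ, ∑ ε, R.sphInv F q γ ε * ∑ κ, D ε κ γ * X κ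
      = ∑ γ, ∑ ε, R.sphInv F q γ ε * ∑ κ, D γ κ ε * X κ := by
    rw [Finset.sum_comm]
    exact Finset.sum_congr rfl fun γ _ => Finset.sum_congr rfl fun ε _ => by
      rw [R.sphInv_comm F q ε γ]
  rw [h4]
  ring

/-- The divergence on `S_τ` in terms of derivatives of the metric components. -/
lemma sphDiv_eq (hq : q ∈ R.lateral) (X : ST → ST) : R.sphDiv F X q
    = ∑ δ, R.along (fun p => X p δ) q (R.angCoord F δ q)
      + 1 / 2 * ∑ γ, ∑ ε, R.sphInv F q γ ε * fderiv ℝ (fun p => F.gLow p γ ε) q (X q) := by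
  rw [sphDiv, hR.sum_christoffel hF hq]

lemma sphDiv_add (hq : q ∈ R.lateral) {X Y : ST → ST}
    (hX : DifferentiableWithinAt ℝ X R.lateral q) (hY : DifferentiableWithinAt ℝ Y R.lateral q) :
    R.sphDiv F (fun p => X p + Y p) q = R.sphDiv F X q + R.sphDiv F Y q := by
  simp only [hR.sphDiv_eq hF hq, map_add, mul_add, Finset.sum_add_distrib, Pi.add_apply]
  simp only [along_add (hR.angCoord_tangent hF hq _) (differentiableWithinAt_apply hX _)
    (differentiableWithinAt_apply hY _), Finset.sum_add_distrib]
  ring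

lemma sphDiv_smul (hq : q ∈ R.lateral) {f : ST → ℝ} {X : ST → ST}
    (hf : DifferentiableWithinAt ℝ f R.lateral q) (hX : DifferentiableWithinAt ℝ X R.lateral q) :
    R.sphDiv F (fun p => f p • X p) q
      = f q * R.sphDiv F X q + R.along f q (R.tang F q (X q)) := by
  simp only [hR.sphDiv_eq hF hq, map_smul, Pi.smul_apply, smul_eq_mul, R.tang_eq_sum,
    along_sum_right, along_smul_right]
  simp only [along_mul (hR.angCoord_tangent hF hq _) hf (differentiableWithinAt_apply hX _),
    Finset.sum_add_distrib, mul_add, Finset.mul_sum]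
  rw [add_right_comm]
  congr 2
  refine Finset.sum_congr rfl fun γ _ => Finset.sum_congr rfl fun ε _ => ?_
  ring

lemma sphDiv_sum (hq : q ∈ R.lateral) {ι : Type*} (s : Finset ι) {X : ι → ST → ST}
    (hX : ∀ i ∈ s, DifferentiableWithinAt ℝ (X i) R.lateral q) :
    R.sphDiv F (fun p => ∑ i ∈ s, X i p) q = ∑ i ∈ s, R.sphDiv F (X i) q := by
  simp only [hR.sphDiv_eq hF hq, map_sum, Finset.sum_apply, Finset.sum_add_distrib]
  congr 1
  · rw [Finset.sum_comm]
    refine Finset.sum_congr rfl fun δ _ => ?_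
    exact along_sum (hR.angCoord_tangent hF hq _) s
      fun i hi => differentiableWithinAt_apply (hX i hi) δ
  · rw [← Finset.mul_sum]
    congr 1
    simp only [Finset.mul_sum]
    rw [Finset.sum_congr rfl fun γ _ => Finset.sum_comm, Finset.sum_comm]

end IsAdmissible

end Region

namespace Region

variable {R : Region} {F : Fluid} {q : ST}

/-! ### Smoothness along the lateral boundary -/

namespace IsAdmissible

variable (hF : F.IsEulerSolution R.ambient R.region) (hR : R.IsAdmissible F)
include hF hR

omit hF in
lemma contDiffOn_lateral {G : Type*} [NormedAddCommGroup G] [NormedSpace ℝ G] {f : ST → G}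
    (h : ∀ q ∈ R.region, ContDiffAt ℝ ∞ f q) : ContDiffOn ℝ ∞ f R.lateral :=
  fun q hq => (h q (hR.lateral_subset hq)).contDiffWithinAt

lemma g_contDiffOn {X Y : ST → ST} (hX : ContDiffOn ℝ ∞ X R.lateral)
    (hY : ContDiffOn ℝ ∞ Y R.lateral) :
    ContDiffOn ℝ ∞ (fun p => F.g p (X p) (Y p)) R.lateral := fun q hq =>
  hF.g_contDiffWithinAt hR.ambient_open le_rfl (hR.mem_goodSet hF (hR.lateral_subset hq))
    (hX q hq) (hY q hq)

lemma Nhat_contDiffOn : ContDiffOn ℝ ∞ (R.Nhat F) R.lateral :=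
  hR.contDiffOn_lateral fun _ hq => hR.Nhat_contDiffAt hF hq

lemma N_contDiffOn : ContDiffOn ℝ ∞ (R.N F) R.lateral :=
  hR.contDiffOn_lateral fun _ hq => hR.N_contDiffAt hF hq

lemma B_contDiffOn : ContDiffOn ℝ ∞ F.B R.lateral :=
  hR.contDiffOn_lateral fun _ hq => hF.B_contDiffAt hR.ambient_open (hR.region_subset hq)

lemma z_contDiffOn : ContDiffOn ℝ ∞ (R.z F) R.lateral :=
  (hR.g_contDiffOn hF (hR.Z_contDiffOn hF) (hR.Nbar_contDiffOn hF)).neg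

lemma h_contDiffOn : ContDiffOn ℝ ∞ (R.h F) R.lateral :=
  (hR.g_contDiffOn hF (hR.H_contDiffOn hF) (hR.N_contDiffOn hF)).neg

omit hF in
lemma fderiv_tau_contDiffOn {X : ST → ST} (hX : ContDiffOn ℝ ∞ X R.lateral) :
    ContDiffOn ℝ ∞ (fun p => fderiv ℝ R.tau p (X p)) R.lateral :=
  (hR.contDiffOn_lateral fun _ hq => hR.fderiv_tau_contDiffAt hq).clm_apply hX

lemma lapse_contDiffOn : ContDiffOn ℝ ∞ (R.lapse F) R.lateral :=
  (hR.fderiv_tau_contDiffOn (hR.H_contDiffOn hF)).inv fun _ hq => (hR.H_tau_pos hF hq).ne'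

lemma Hbreve_contDiffOn : ContDiffOn ℝ ∞ (R.Hbreve F) R.lateral :=
  (hR.lapse_contDiffOn hF).smul (hR.H_contDiffOn hF)

lemma Theta_contDiffOn : ContDiffOn ℝ ∞ (R.Theta F) R.lateral :=
  ((hR.B_contDiffOn hF).sub
    (((hR.h_contDiffOn hF).inv fun q hq => (hR.h_pos q hq).ne').smul (hR.H_contDiffOn hF))).sub
    (((hR.z_contDiffOn hF).inv fun q hq => (hR.z_pos q hq).ne').smul (hR.Z_contDiffOn hF))

lemma tang_contDiffOn {X : ST → ST} (hX : ContDiffOn ℝ ∞ X R.lateral) :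
    ContDiffOn ℝ ∞ (fun p => R.tang F p (X p)) R.lateral := by
  simp only [tang_eq]
  exact (hX.add ((hR.g_contDiffOn hF (hR.Nhat_contDiffOn hF) hX).smul (hR.Nhat_contDiffOn hF))).sub
    ((hR.g_contDiffOn hF (hR.Z_contDiffOn hF) hX).smul (hR.Z_contDiffOn hF))

lemma angCoord_contDiffOn (β : Fin 4) : ContDiffOn ℝ ∞ (R.angCoord F β) R.lateral := by
  have : R.angCoord F β = fun p => R.tang F p (coordVec β) := funext fun p => R.angCoord_eq F p β
  rw [this]
  exact hR.tang_contDiffOn hF contDiffOn_const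

lemma sphInv_contDiffOn (α β : Fin 4) :
    ContDiffOn ℝ ∞ (fun p => R.sphInv F p α β) R.lateral := by
  have h1 := contDiffOn_pi.1 (hR.Nhat_contDiffOn hF)
  have h2 := contDiffOn_pi.1 (hR.Z_contDiffOn hF)
  exact ((hR.contDiffOn_lateral fun q hq => hF.gInv_contDiffAt hR.ambient_open
    (hR.mem_goodSet hF hq) α β).add ((h1 α).mul (h1 β))).sub ((h2 α).mul (h2 β))

lemma normSq_eq (hq : q ∈ R.lateral) (V : ST → ST) :
    R.normSq F V q = F.g q (V q) (R.tang F q (V q)) := by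
  rw [normSq, sphForm_eq, hR.g_Nhat_tang hF hq, hR.g_Z_tang hF hq,
    Region.IsAdmissible.g_tang_left, hR.tang_tang hF hq]
  ring

lemma normSq_contDiffOn {V : ST → ST} (hV : ContDiffOn ℝ ∞ V R.lateral) :
    ContDiffOn ℝ ∞ (R.normSq F V) R.lateral :=
  (hR.g_contDiffOn hF hV (hR.tang_contDiffOn hF hV)).congr fun _ hq => hR.normSq_eq hF hq V

omit hF hR in
lemma _root_.ContDiffOn.diffWithin {G : Type*} [NormedAddCommGroup G] [NormedSpace ℝ G]
    {f : ST → G} {s : Set ST} (h : ContDiffOn ℝ ∞ f s) (hq : q ∈ s) :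
    DifferentiableWithinAt ℝ f s q := (h q hq).differentiableWithinAt (by simp)

lemma gLow_differentiableAt (hq : q ∈ R.region) (α β : Fin 4) :
    DifferentiableAt ℝ (fun p => F.gLow p α β) q :=
  (hF.gLow_contDiffAt hR.ambient_open (hR.mem_goodSet hF hq) α β).differentiableAt (by simp)

/-! ### Product rules -/

lemma along_g (hq : q ∈ R.lateral) {W : ST} (hW : W ∈ tangentSpaceAt R.lateral q) {X Y : ST → ST}
    (hX : DifferentiableWithinAt ℝ X R.lateral q) (hY : DifferentiableWithinAt ℝ Y R.lateral q) :
    R.along (fun p => F.g p (X p) (Y p)) q W = F.dMetric q W (X q) (Y q)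
      + F.g q (R.along X q W) (Y q) + F.g q (X q) (R.along Y q W) := by
  have hg := fun α β => (hR.gLow_differentiableAt hF (hR.lateral_subset hq) α β)
  have hg' := fun α β => (hg α β).differentiableWithinAt (s := R.lateral)
  have hX' := differentiableWithinAt_apply hX
  have hY' := differentiableWithinAt_apply hY
  simp only [F.g_eq_sum, Fluid.dMetric, ← along_apply hW hX, ← along_apply hW hY]
  have hterm := fun α β => ((hg' α β).fun_mul (hX' α)).fun_mul (hY' β)
  rw [along_sum hW _ fun α _ => DifferentiableWithinAt.fun_sum fun β _ => hterm α β]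
  rw [← Finset.sum_add_distrib, ← Finset.sum_add_distrib]
  refine Finset.sum_congr rfl fun α _ => ?_
  rw [along_sum hW _ fun β _ => hterm α β, ← Finset.sum_add_distrib, ← Finset.sum_add_distrib]
  refine Finset.sum_congr rfl fun β _ => ?_
  rw [along_mul hW ((hg' α β).fun_mul (hX' α)) (hY' β), along_mul hW (hg' α β) (hX' α),
    along_eq_fderiv (hg α β) hW]
  ring

lemma lower_contDiffOn {X : ST → ST} (hX : ContDiffOn ℝ ∞ X R.lateral) (β : Fin 4) :
    ContDiffOn ℝ ∞ (fun p => F.lower p (X p) β) R.lateral :=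
  hR.g_contDiffOn hF hX contDiffOn_const

/-- The product rule for a contraction `X_β Y^β`. -/
lemma along_contract (hq : q ∈ R.lateral) {W : ST} (hW : W ∈ tangentSpaceAt R.lateral q)
    {X Y : ST → ST} (hX : ContDiffOn ℝ ∞ X R.lateral) (hY : ContDiffOn ℝ ∞ Y R.lateral) :
    R.along (fun p => F.g p (X p) (Y p)) q W
      = ∑ β, R.along (fun p => F.lower p (X p) β) q W * Y q β
        + ∑ β, F.lower q (X q) β * R.along (fun p => Y p β) q W := by
  have hX' := fun β => (hR.lower_contDiffOn hF hX β).diffWithin hq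
  have hY' := differentiableWithinAt_apply (hY.diffWithin hq)
  simp only [F.g_eq_sum_lower]
  rw [along_sum hW _ fun β _ => (hX' β).fun_mul (hY' β), ← Finset.sum_add_distrib]
  refine Finset.sum_congr rfl fun β _ => ?_
  rw [along_mul hW (hX' β) (hY' β)]
  ring

/-! ### The Lie derivative of the first fundamental form -/

lemma lieSph_eq (hq : q ∈ R.lateral) {X : ST → ST}
    (hT : X q ∈ tangentSpaceAt R.lateral q) {Y₁ Y₂ : ST} (h₁ : R.IsSphereTangent F q Y₁)
    (h₂ : R.IsSphereTangent F q Y₂) :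
    R.lieSph F X q Y₁ Y₂ = F.dMetric q (X q) Y₁ Y₂
      + F.g q (R.along X q Y₁) Y₂ + F.g q Y₁ (R.along X q Y₂) := by
  have e : ∀ α β, R.along (fun p => R.sphLow F p α β) q (X q)
      = fderiv ℝ (fun p => F.gLow p α β) q (X q)
        + (F.lower q (R.Nhat F q) α * R.along (fun p => F.lower p (R.Nhat F p) β) q (X q)
          + F.lower q (R.Nhat F q) β * R.along (fun p => F.lower p (R.Nhat F p) α) q (X q))
        - (F.lower q (R.Z F q) α * R.along (fun p => F.lower p (R.Z F p) β) q (X q)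
          + F.lower q (R.Z F q) β * R.along (fun p => F.lower p (R.Z F p) α) q (X q)) := by
    intro α β
    have hN := fun β => (hR.lower_contDiffOn hF (hR.Nhat_contDiffOn hF) β).diffWithin hq
    have hZ := fun β => (hR.lower_contDiffOn hF (hR.Z_contDiffOn hF) β).diffWithin hq
    have hg := hR.gLow_differentiableAt hF (hR.lateral_subset hq) α β
    have hg' := hg.differentiableWithinAt (s := R.lateral)
    simp only [sphLow]
    rw [along_sub hT (hg'.fun_add ((hN α).fun_mul (hN β))) ((hZ α).fun_mul (hZ β)),
      along_add hT hg' ((hN α).fun_mul (hN β)), along_mul hT (hN α) (hN β),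
      along_mul hT (hZ α) (hZ β), along_eq_fderiv hg hT]
  have key : ∀ (c d : Fin 4 → ℝ), (∑ α, c α * Y₁ α = 0) → (∑ α, c α * Y₂ α = 0) →
      ∑ α, ∑ β, (c α * d β + c β * d α) * Y₁ α * Y₂ β = 0 := by
    intro c d hc1 hc2
    have : ∑ α, ∑ β, (c α * d β + c β * d α) * Y₁ α * Y₂ β
        = (∑ α, c α * Y₁ α) * (∑ β, d β * Y₂ β) + (∑ α, d α * Y₁ α) * ∑ β, c β * Y₂ β := by
      simp only [Finset.sum_mul_sum, ← Finset.sum_add_distrib]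
      exact Finset.sum_congr rfl fun α _ => Finset.sum_congr rfl fun β _ => by ring
    rw [this, hc1, hc2]; ring
  have kN := key (F.lower q (R.Nhat F q))
    (fun β => R.along (fun p => F.lower p (R.Nhat F p) β) q (X q))
    (by rw [← F.g_eq_sum_lower]; exact h₁.1) (by rw [← F.g_eq_sum_lower]; exact h₂.1)
  have kZ := key (F.lower q (R.Z F q))
    (fun β => R.along (fun p => F.lower p (R.Z F p) β) q (X q))
    (by rw [← F.g_eq_sum_lower]; exact h₁.2) (by rw [← F.g_eq_sum_lower]; exact h₂.2)
  rw [lieSph, sphForm_eq, sphForm_eq, h₁.1, h₁.2, h₂.1, h₂.2]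
  simp only [e, add_mul, sub_mul, Finset.sum_add_distrib, Finset.sum_sub_distrib] at kN kZ ⊢
  rw [Fluid.dMetric]
  linear_combination kN - kZ

/-- Half the trace of the Lie derivative of the first fundamental form is the divergence. -/
lemma trLieSph_eq (hq : q ∈ R.lateral) {X : ST → ST} (hX : DifferentiableWithinAt ℝ X R.lateral q)
    (hT : X q ∈ tangentSpaceAt R.lateral q) : R.trLieSph F X q = 2 * R.sphDiv F X q := by
  have hc := hR.c_pos hF (hR.lateral_subset hq)
  have hS := fun μ => (R.angCoord_eq F q μ) ▸ hR.isSphereTangent_tang hF hq (coordVec μ)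
  have h1 := hR.sum_sphInv_bilin hF hq (fun α β => fderiv ℝ (fun p => F.gLow p α β) q (X q))
  have h2 : ∑ μ, ∑ ν, R.sphInv F q μ ν * F.g q (R.along X q (R.angCoord F μ q)) (R.angCoord F ν q)
      = ∑ δ, R.along (fun p => X p δ) q (R.angCoord F δ q) := by
    have e : ∀ μ ν, F.g q (R.along X q (R.angCoord F μ q)) (R.angCoord F ν q)
        = F.lower q (R.tang F q (R.along X q (R.angCoord F μ q))) ν := by
      intro μ ν
      rw [R.angCoord_eq F q ν, ← g_tang_left]; rfl
    simp only [e, R.sum_sphInv_lower F hc, hR.tang_tang hF hq]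
    have := hR.sum_angCoord_eq_tang hF hq (fderivWithin ℝ X R.lateral q).toLinearMap
    simp only [ContinuousLinearMap.coe_coe] at this
    simp only [along_apply (hR.angCoord_tangent hF hq _) hX]
    exact this
  have h3 : ∑ μ, ∑ ν, R.sphInv F q μ ν * F.g q (R.angCoord F μ q) (R.along X q (R.angCoord F ν q))
      = ∑ δ, R.along (fun p => X p δ) q (R.angCoord F δ q) := by
    rw [← h2, Finset.sum_comm]
    exact Finset.sum_congr rfl fun ν _ => Finset.sum_congr rfl fun μ _ => by
      rw [R.sphInv_comm F q μ ν, F.g_comm]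
  simp only [trLieSph, hR.lieSph_eq hF hq hT (hS _) (hS _), mul_add, Finset.sum_add_distrib]
  rw [h2, h3, hR.sphDiv_eq hF hq]
  simp only [Fluid.dMetric]
  rw [h1]
  ring

end IsAdmissible

end Region

/-! ### The pointwise divergence identity -/

namespace Region

variable {R : Region} {F : Fluid} {q : ST}

/-- The divergence, with respect to `tau` and the area forms of the surfaces `S_τ`, of a vector
field `ξ` tangent to the lateral boundary. -/
def lateralDiv (R : Region) (F : Fluid) (ξ : ST → ST) (q : ST) : ℝ :=
  R.along (fun p => fderiv ℝ R.tau p (ξ p)) q (R.Hbreve F q) + R.sphDiv F ξ q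

/-- The `S_τ`-tangent part of the boundary current. -/
def sphFlux (R : Region) (F : Fluid) (V : ST → ST) (p : ST) : ST :=
  F.g p (R.Z F p) (V p) • R.tang F p (V p) + (R.z F p * R.normSq F V p) • R.Theta F p

/-- The boundary current whose divergence connects the two sides of the integral identity. Its flux
through the surfaces `S_τ` is the density of the integrals over `S_τ`. -/
def flux (R : Region) (F : Fluid) (V : ST → ST) (p : ST) : ST :=
  R.sphereDensity F V p • R.Hbreve F p + R.sphFlux F V p

/-- The exterior derivative of the covector field `V_β`, evaluated at `X` and `Y`. -/
def dLower (F : Fluid) (V : ST → ST) (q X Y : ST) : ℝ :=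
  ∑ β, (fderiv ℝ (fun p => F.lower p (V p) β) q X * Y β
    - fderiv ℝ (fun p => F.lower p (V p) β) q Y * X β)

section

variable (R F)

/-- The projection onto the slices. -/
def sliceTang (q X : ST) : ST := X + F.g q (R.Nhat F q) X • R.Nhat F q

lemma sum_sliceProj (X : ST) (α : Fin 4) :
    ∑ β, R.sliceProj F q α β * X β = R.sliceTang F q X α := by
  simp only [sliceProj, add_mul, Finset.sum_add_distrib, sliceTang, Pi.add_apply, Pi.smul_apply,
    smul_eq_mul, F.g_eq_sum_lower, Finset.sum_mul]
  exact congrArg₂ _ (by simp) (Finset.sum_congr rfl fun β _ => by ring)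

lemma sliceTang_eq (X : ST) :
    R.sliceTang F q X = R.tang F q X + F.g q (R.Z F q) X • R.Z F q := by
  rw [tang_eq, sliceTang]; abel

end

namespace IsAdmissible

variable (hF : F.IsEulerSolution R.ambient R.region) (hR : R.IsAdmissible F)
include hF hR

lemma Theta_isSphereTangent (hq : q ∈ R.lateral) : R.IsSphereTangent F q (R.Theta F q) := by
  have hr := hR.lateral_subset hq
  have hz := (hR.z_pos q hq).ne'
  have hh := (hR.h_pos q hq).ne'
  have h1 : F.g q (R.Nbar F q) (R.Z F q) = -R.z F q := by rw [z, F.g_comm]; ring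
  have h2 : F.g q (R.N F q) (R.H F q) = -R.h F q := by rw [h, F.g_comm]; ring
  have h3 : F.g q (R.N F q) (R.Z F q) = 0 := by
    have := hR.g_Nhat_Z hF hq
    rw [Nhat, F.g_smul_left] at this
    simpa [(hR.nu_pos hF hr).ne'] using this
  refine hR.isSphereTangent_of hF hq ?_ ?_
  · rw [Theta, F.g_sub_right, F.g_sub_right, F.g_smul_right, F.g_smul_right, hR.g_Nbar_B hF hq,
      hR.g_Nbar_H hF hq, h1]
    field_simp
    ring
  · rw [Nhat, F.g_smul_left, Theta, F.g_sub_right, F.g_sub_right, F.g_smul_right, F.g_smul_right,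
      hR.g_N_B hq, h2, h3]
    field_simp
    ring

omit hF in
lemma H_tangent (hq : q ∈ R.lateral) : R.H F q ∈ tangentSpaceAt R.lateral q :=
  (hR.isGenerator_H hq).1

omit hF in
lemma Hbreve_tangent (hq : q ∈ R.lateral) : R.Hbreve F q ∈ tangentSpaceAt R.lateral q :=
  Submodule.smul_mem _ _ (hR.isGenerator_H hq).1

lemma Theta_tangent (hq : q ∈ R.lateral) : R.Theta F q ∈ tangentSpaceAt R.lateral q :=
  hR.tangent_of_isSphereTangent hF hq (hR.Theta_isSphereTangent hF hq)

lemma tang_Hbreve (hq : q ∈ R.lateral) : R.tang F q (R.Hbreve F q) = 0 := by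
  have hT := hR.isSphereTangent_tang hF hq (R.H F q)
  have h0 : F.g q (R.tang F q (R.H F q)) (R.tang F q (R.H F q)) = 0 := by
    rw [g_tang_left, hR.tang_tang hF hq, hR.g_H_of_isSphereTangent hF hq hT]
  have h1 : R.tang F q (R.H F q) = 0 := by
    by_contra hne
    have := hR.g_pos_of_tau hF (hR.lateral_subset hq)
      ((hR.g_Nhat_eq_zero_iff hF (hR.lateral_subset hq) _).1 hT.1) hne
    linarith
  rw [Hbreve, ← R.tangL_apply, map_smul, R.tangL_apply, h1, smul_zero]

omit hF hR in
lemma E_eq (q : ST) : R.E F q = (R.h F q)⁻¹ • R.H F q + R.Theta F q := by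
  rw [E, Theta]; abel

lemma E_tangent (hq : q ∈ R.lateral) : R.E F q ∈ tangentSpaceAt R.lateral q := by
  rw [E_eq]
  exact Submodule.add_mem _ (Submodule.smul_mem _ _ (hR.H_tangent hq)) (hR.Theta_tangent hF hq)

lemma fderiv_tau_of_isSphereTangent (hq : q ∈ R.lateral) {X : ST} (hX : R.IsSphereTangent F q X) :
    fderiv ℝ R.tau q X = 0 :=
  (hR.g_Nhat_eq_zero_iff hF (hR.lateral_subset hq) X).1 hX.1

lemma sphFlux_isSphereTangent (hq : q ∈ R.lateral) (V : ST → ST) :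
    R.IsSphereTangent F q (R.sphFlux F V q) := by
  obtain ⟨h1, h2⟩ := hR.isSphereTangent_tang hF hq (V q)
  obtain ⟨h3, h4⟩ := hR.Theta_isSphereTangent hF hq
  constructor <;>
  simp only [sphFlux, F.g_add_right, F.g_smul_right, h1, h2, h3, h4] <;> ring

lemma flux_tangent (hq : q ∈ R.lateral) (V : ST → ST) :
    R.flux F V q ∈ tangentSpaceAt R.lateral q :=
  Submodule.add_mem _ (Submodule.smul_mem _ _ (hR.Hbreve_tangent hq))
    (hR.tangent_of_isSphereTangent hF hq (hR.sphFlux_isSphereTangent hF hq V))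

lemma fderiv_tau_flux (hq : q ∈ R.lateral) (V : ST → ST) :
    fderiv ℝ R.tau q (R.flux F V q) = R.sphereDensity F V q := by
  rw [flux, map_add, map_smul, hR.fderiv_tau_Hbreve hF hq,
    hR.fderiv_tau_of_isSphereTangent hF hq (hR.sphFlux_isSphereTangent hF hq V)]
  simp

variable {V : ST → ST}

lemma coef_contDiffOn : ContDiffOn ℝ ∞ (fun p => R.z F p / (R.h F p * R.lapse F p)) R.lateral :=
  (hR.z_contDiffOn hF).div ((hR.h_contDiffOn hF).mul (hR.lapse_contDiffOn hF)) fun q hq =>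
    mul_ne_zero (hR.h_pos q hq).ne' (hR.lapse_pos hF hq).ne'

lemma sphereDensity_contDiffOn (hV : ContDiffOn ℝ ∞ V R.lateral) :
    ContDiffOn ℝ ∞ (R.sphereDensity F V) R.lateral :=
  (hR.coef_contDiffOn hF).mul (hR.normSq_contDiffOn hF hV)

lemma sphFlux_contDiffOn (hV : ContDiffOn ℝ ∞ V R.lateral) :
    ContDiffOn ℝ ∞ (R.sphFlux F V) R.lateral :=
  ((hR.g_contDiffOn hF (hR.Z_contDiffOn hF) hV).smul (hR.tang_contDiffOn hF hV)).add
    (((hR.z_contDiffOn hF).mul (hR.normSq_contDiffOn hF hV)).smul (hR.Theta_contDiffOn hF))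

lemma flux_contDiffOn (hV : ContDiffOn ℝ ∞ V R.lateral) :
    ContDiffOn ℝ ∞ (R.flux F V) R.lateral :=
  ((hR.sphereDensity_contDiffOn hF hV).smul (hR.Hbreve_contDiffOn hF)).add
    (hR.sphFlux_contDiffOn hF hV)

/-- The product rule for `φ |V̸|²`, with the inverse first fundamental form differentiated
together with `φ`. -/
lemma along_mul_normSq (hq : q ∈ R.lateral) {W : ST} (hW : W ∈ tangentSpaceAt R.lateral q)
    (hV : ContDiffOn ℝ ∞ V R.lateral) {φ : ST → ℝ} (hφ : ContDiffOn ℝ ∞ φ R.lateral) :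
    R.along (fun p => φ p * R.normSq F V p) q W
      = ∑ α, ∑ β, R.along (fun p => φ p * R.sphInv F p α β) q W
          * F.lower q (V q) α * F.lower q (V q) β
        + 2 * φ q * ∑ β, R.along (fun p => F.lower p (V p) β) q W * R.tang F q (V q) β := by
  have hc : EqOn (fun p => φ p * R.normSq F V p) (fun p => ∑ α, ∑ β,
      φ p * R.sphInv F p α β * F.lower p (V p) α * F.lower p (V p) β) R.lateral := by
    intro p hp
    have hcp := hR.c_pos hF (hR.lateral_subset hp)
    simp only [hR.normSq_eq hF hp, F.g_eq_sum_lower, ← R.sum_sphInv_lower F hcp, Finset.mul_sum]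
    exact Finset.sum_congr rfl fun α _ => Finset.sum_congr rfl fun β _ => by ring
  rw [along_congr hc hq]
  have hs := fun α β => (hφ.mul (hR.sphInv_contDiffOn hF α β)).diffWithin hq
  have hl := fun β => (hR.lower_contDiffOn hF hV β).diffWithin hq
  have hterm := fun α β => ((hs α β).fun_mul (hl α)).fun_mul (hl β)
  rw [along_sum hW _ fun α _ => DifferentiableWithinAt.fun_sum fun β _ => hterm α β]
  have e : ∀ α, R.along (fun p => ∑ β, φ p * R.sphInv F p α β * F.lower p (V p) α
      * F.lower p (V p) β) q W
      = ∑ β, R.along (fun p => φ p * R.sphInv F p α β) q W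
          * F.lower q (V q) α * F.lower q (V q) β
        + φ q * ∑ β, R.sphInv F q α β * F.lower q (V q) β
            * R.along (fun p => F.lower p (V p) α) q W
        + φ q * ∑ β, R.sphInv F q α β * F.lower q (V q) α
            * R.along (fun p => F.lower p (V p) β) q W := by
    intro α
    rw [along_sum hW _ fun β _ => hterm α β, Finset.mul_sum, Finset.mul_sum,
      ← Finset.sum_add_distrib, ← Finset.sum_add_distrib]
    refine Finset.sum_congr rfl fun β _ => ?_
    rw [along_mul hW ((hs α β).fun_mul (hl α)) (hl β), along_mul hW (hs α β) (hl α)]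
    ring
  have hcq := hR.c_pos hF (hR.lateral_subset hq)
  simp only [e, Finset.sum_add_distrib, ← Finset.mul_sum, ← Finset.sum_mul,
    R.sum_sphInv_lower F hcq]
  have e2 : ∑ α, ∑ β, R.sphInv F q α β * F.lower q (V q) α
      * R.along (fun p => F.lower p (V p) β) q W
      = ∑ β, R.along (fun p => F.lower p (V p) β) q W * R.tang F q (V q) β := by
    rw [Finset.sum_comm]
    refine Finset.sum_congr rfl fun β _ => ?_
    rw [← Finset.sum_mul, ← R.sum_sphInv_lower F hcq, mul_comm]
    simp only [R.sphInv_comm F q β]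
  rw [e2]
  simp only [mul_comm (R.tang F q (V q) _)]
  ring

/-- Only derivatives tangent to `S_τ` enter the normal component of the current. -/
lemma ZJ_eq (hq : q ∈ R.lateral) (V : ST → ST) : R.ZJ F V q
    = F.g q (R.Z F q) (fderiv ℝ V q (R.tang F q (V q)))
      - F.g q (R.Z F q) (V q) * ∑ δ, fderiv ℝ V q (R.angCoord F δ q) δ := by
  set L := fderiv ℝ V q with hL
  have hsw : ∀ X : ST, L (R.sliceTang F q X) = ∑ l, (∑ γ, R.sliceProj F q l γ * X γ) • L (coordVec l) := by
    intro X
    rw [map_eq_sum L]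
    exact Finset.sum_congr rfl fun l _ => by rw [sum_sliceProj]
  have hcol : ∀ l, (fun κ => R.sliceProj F q κ l) = R.sliceTang F q (coordVec l) := by
    intro l
    ext κ
    rw [← sum_sliceProj]
    simp [coordVec_apply]
  have hcur : R.current F V q = R.sliceTang F q (L (R.sliceTang F q (V q)))
      - (∑ l, L (R.sliceTang F q (coordVec l)) l) • R.sliceTang F q (V q) := by
    ext α
    rw [Pi.sub_apply, Pi.smul_apply, ← sum_sliceProj, ← sum_sliceProj, current]
    congr 1
    · simp only [hsw, Finset.sum_apply, Pi.smul_apply, smul_eq_mul, Finset.mul_sum, Finset.sum_mul]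
      rw [Finset.sum_comm, Finset.sum_congr rfl fun l _ => Finset.sum_comm, Finset.sum_comm]
      refine Finset.sum_congr rfl fun κ _ => Finset.sum_congr rfl fun l _ =>
        Finset.sum_congr rfl fun γ _ => ?_
      ring
    · rw [smul_eq_mul, Finset.mul_sum]
      refine Finset.sum_congr rfl fun γ _ => ?_
      rw [Finset.sum_mul]
      refine Finset.sum_congr rfl fun l _ => ?_
      rw [map_eq_sum L, ← hcol l, Finset.sum_apply, Finset.sum_mul]
      refine Finset.sum_congr rfl fun κ _ => ?_
      simp only [Pi.smul_apply, smul_eq_mul]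
      ring
  have hgs : ∀ X, F.g q (R.Z F q) (R.sliceTang F q X) = F.g q (R.Z F q) X := by
    intro X
    rw [sliceTang, F.g_add_right, F.g_smul_right, F.g_comm q (R.Z F q) (R.Nhat F q),
      hR.g_Nhat_Z hF hq]
    ring
  have htr : ∑ l, L (R.sliceTang F q (coordVec l)) l
      = ∑ δ, L (R.angCoord F δ q) δ + F.g q (R.Z F q) (L (R.Z F q)) := by
    rw [F.g_eq_sum_lower, ← Finset.sum_add_distrib]
    refine Finset.sum_congr rfl fun l _ => ?_
    rw [sliceTang_eq, R.angCoord_eq, map_add, map_smul, Pi.add_apply, Pi.smul_apply, smul_eq_mul]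
    rfl
  rw [ZJ, hcur, F.g_sub_right, F.g_smul_right, hgs, hgs, htr, sliceTang_eq, map_add, map_smul,
    F.g_add_right, F.g_smul_right]
  ring

/-- The pointwise identity behind the integral identities: the difference of the two lateral
integrands is a divergence along the lateral boundary. -/
theorem errors_eq_lateralDiv (hq : q ∈ R.lateral) (hV : ∀ p ∈ R.lateral, ContDiffAt ℝ ∞ V p)
    (hV0 : ∀ p, V p 0 = 0) {W : ST → ℝ} (hW : ContDiffOn ℝ ∞ W R.lateral) {errV : ℝ}
    (herr : errV = -2 * R.z F q * dLower F V q (R.tang F q (V q)) (R.E F q)) :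
    R.errWeight F W V q + W q * R.errCommon F V q + W q * errV
      = W q * R.ZJ F V q + R.lateralDiv F (fun p => W p • R.flux F V p) q := by
  have hVc : ContDiffOn ℝ ∞ V R.lateral := fun p hp => (hV p hp).contDiffWithinAt
  have hVd : DifferentiableAt ℝ V q := (hV q hq).differentiableAt (by simp)
  have hhp := (hR.h_pos q hq).ne'
  have hzp := (hR.z_pos q hq).ne'
  have hlp := (hR.lapse_pos hF hq).ne'
  set T := R.tang F q (V q) with hT
  have hTt : T ∈ tangentSpaceAt R.lateral q := hR.tang_tangent hF hq (V q)
  have hHt := hR.Hbreve_tangent hq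
  have hΘt := hR.Theta_tangent hF hq
  have hEt := hR.E_tangent hF hq
  have hTd := (hR.tang_contDiffOn hF hVc).diffWithin hq
  have hWd := hW.diffWithin hq
  have hfc := hR.sphereDensity_contDiffOn hF hVc
  have hXc := hR.sphFlux_contDiffOn hF hVc
  set A : Fin 4 → ST → ℝ := fun β X => R.along (fun p => F.lower p (V p) β) q X with hA
  -- the weight splits off
  have s1 : R.lateralDiv F (fun p => W p • R.flux F V p) q
      = W q * R.along (R.sphereDensity F V) q (R.Hbreve F q)
        + R.sphereDensity F V q * R.along W q (R.Hbreve F q)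
        + W q * R.sphDiv F (R.flux F V) q + R.along W q (R.tang F q (R.flux F V q)) := by
    rw [lateralDiv, hR.sphDiv_smul hF hq hWd ((hR.flux_contDiffOn hF hVc).diffWithin hq)]
    have : EqOn (fun p => fderiv ℝ R.tau p (W p • R.flux F V p))
        (fun p => W p * R.sphereDensity F V p) R.lateral := by
      intro p hp
      simp only [map_smul, smul_eq_mul, hR.fderiv_tau_flux hF hp]
    rw [along_congr this hq, along_mul hHt hWd (hfc.diffWithin hq)]
    ring
  have s2 : R.tang F q (R.flux F V q) = R.sphFlux F V q := by
    rw [flux, ← R.tangL_apply, map_add, map_smul, R.tangL_apply, R.tangL_apply,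
      hR.tang_Hbreve hF hq, (hR.sphFlux_isSphereTangent hF hq V).tang_eq]
    simp
  have s3 : R.sphDiv F (R.flux F V) q
      = R.sphereDensity F V q * R.sphDiv F (R.Hbreve F) q + R.sphDiv F (R.sphFlux F V) q := by
    rw [show R.flux F V = fun p => R.sphereDensity F V p • R.Hbreve F p + R.sphFlux F V p from rfl,
      hR.sphDiv_add hF hq ((hfc.diffWithin hq).fun_smul ((hR.Hbreve_contDiffOn hF).diffWithin hq))
      (hXc.diffWithin hq), hR.sphDiv_smul hF hq (hfc.diffWithin hq)
      ((hR.Hbreve_contDiffOn hF).diffWithin hq), hR.tang_Hbreve hF hq]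
    simp [along]
  have hVZc := hR.g_contDiffOn hF (hR.Z_contDiffOn hF) hVc
  have hznc := (hR.z_contDiffOn hF).mul (hR.normSq_contDiffOn hF hVc)
  have s4 : R.sphDiv F (R.sphFlux F V) q
      = F.g q (R.Z F q) (V q) * R.sphDiv F (fun p => R.tang F p (V p)) q
        + R.along (fun p => F.g p (R.Z F p) (V p)) q T
        + R.z F q * R.normSq F V q * R.sphDiv F (R.Theta F) q
        + R.along (fun p => R.z F p * R.normSq F V p) q (R.Theta F q) := by
    rw [show R.sphFlux F V = fun p => F.g p (R.Z F p) (V p) • R.tang F p (V p)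
        + (R.z F p * R.normSq F V p) • R.Theta F p from rfl,
      hR.sphDiv_add hF hq ((hVZc.diffWithin hq).fun_smul hTd)
      ((hznc.diffWithin hq).fun_smul ((hR.Theta_contDiffOn hF).diffWithin hq)),
      hR.sphDiv_smul hF hq (hVZc.diffWithin hq) hTd,
      hR.sphDiv_smul hF hq (hznc.diffWithin hq) ((hR.Theta_contDiffOn hF).diffWithin hq),
      (hR.Theta_isSphereTangent hF hq).tang_eq, hR.tang_tang hF hq]
    ring
  have s5 : R.sphDiv F (fun p => R.tang F p (V p)) q
      = ∑ β, V q β * R.sphDiv F (R.angCoord F β) q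
        + ∑ δ, fderiv ℝ V q (R.angCoord F δ q) δ := by
    have hVβ := fun β => differentiableWithinAt_apply (hVc.diffWithin hq) β
    have hang := fun β => (hR.angCoord_contDiffOn hF β).diffWithin hq
    rw [show (fun p => R.tang F p (V p)) = fun p => ∑ β, V p β • R.angCoord F β p from
      funext fun p => R.tang_eq_sum F p (V p),
      hR.sphDiv_sum hF hq _ fun β _ => (hVβ β).fun_smul (hang β), ← Finset.sum_add_distrib]
    refine Finset.sum_congr rfl fun β _ => ?_
    have htt : R.tang F q (R.angCoord F β q) = R.angCoord F β q := by
      rw [R.angCoord_eq, hR.tang_tang hF hq]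
    rw [hR.sphDiv_smul hF hq (hVβ β) (hang β), htt,
      along_apply (hR.angCoord_tangent hF hq β) (hVc.diffWithin hq),
      along_eq_fderiv hVd (hR.angCoord_tangent hF hq β)]
  have s6 := hR.along_mul_normSq hF hq hHt hVc (hR.coef_contDiffOn hF)
  have s7 := hR.along_mul_normSq hF hq hΘt hVc (hR.z_contDiffOn hF)
  change R.along (R.sphereDensity F V) q (R.Hbreve F q) = _ at s6
  have s8 := hR.trLieSph_eq hF hq ((hR.Hbreve_contDiffOn hF).diffWithin hq) hHt
  -- `E = h⁻¹ H + Θ`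
  have s9 : ∀ β, R.z F q / (R.h F q * R.lapse F q) * A β (R.Hbreve F q)
      + R.z F q * A β (R.Theta F q) = R.z F q * A β (R.E F q) := by
    intro β
    rw [E_eq, Hbreve]
    simp only [hA, along_add_right, along_smul_right, smul_eq_mul]
    field_simp
  have s10 : R.z F q / (R.h F q * R.lapse F q) * ∑ β, A β (R.Hbreve F q) * T β
      + R.z F q * ∑ β, A β (R.Theta F q) * T β = R.z F q * ∑ β, A β (R.E F q) * T β := by
    simp only [Finset.mul_sum, ← Finset.sum_add_distrib]
    refine Finset.sum_congr rfl fun β _ => ?_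
    linear_combination T β * s9 β
  -- the two product rules for `V_Z` and the one for `g(V, B) = 0`
  have s11 := hR.along_g hF hq hTt ((hR.Z_contDiffOn hF).diffWithin hq) (hVc.diffWithin hq)
  have s12 := hR.along_contract hF hq hTt hVc (hR.Z_contDiffOn hF)
  have s12' : R.along (fun p => F.g p (V p) (R.Z F p)) q T
      = R.along (fun p => F.g p (R.Z F p) (V p)) q T := by
    simp only [F.g_comm _ (V _)]
  have s13 := hR.along_contract hF hq hTt hVc (hR.B_contDiffOn hF)
  have s13' : R.along (fun p => F.g p (V p) (F.B p)) q T = 0 := by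
    have : (fun p => F.g p (V p) (F.B p)) = fun _ => (0 : ℝ) := by
      ext p; rw [F.g_B_right, hV0, neg_zero]
    rw [this]
    simp [along]
  have hBd : ∀ α, R.along (fun p => F.B p α) q T = fderiv ℝ (fun p => F.B p α) q T := fun α =>
    along_eq_fderiv ((contDiffAt_pi.1 (hF.B_contDiffAt hR.ambient_open
      (hR.region_subset (hR.lateral_subset hq))) α).differentiableAt (by simp)) hTt
  simp only [hBd] at s13
  have s14 : ∀ β, A β T = fderiv ℝ (fun p => F.lower p (V p) β) q T ∧
      A β (R.E F q) = fderiv ℝ (fun p => F.lower p (V p) β) q (R.E F q) := by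
    intro β
    have hd : DifferentiableAt ℝ (fun p => F.lower p (V p) β) q := by
      have := hF.g_contDiffWithinAt hR.ambient_open (n := ∞) le_rfl
        (hR.mem_goodSet hF (hR.lateral_subset hq)) (s := univ) (X := V)
        (Y := fun _ => coordVec β) (hV q hq).contDiffWithinAt contDiffWithinAt_const
      rw [contDiffWithinAt_univ] at this
      exact this.differentiableAt (by simp)
    exact ⟨along_eq_fderiv hd hTt, along_eq_fderiv hd hEt⟩
  have s15 : dLower F V q T (R.E F q) = ∑ β, A β T * F.B q β
      - (R.z F q)⁻¹ * ∑ β, A β T * R.Z F q β - ∑ β, A β (R.E F q) * T β := by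
    simp only [dLower, ← (s14 _).1, ← (s14 _).2, Finset.mul_sum, ← Finset.sum_sub_distrib]
    refine Finset.sum_congr rfl fun β _ => ?_
    have : R.E F q β = F.B q β - (R.z F q)⁻¹ * R.Z F q β := rfl
    rw [this]; ring
  have s16 : ∑ α, ∑ β, V q α * R.Z F q β * fderiv ℝ (fun p => F.gLow p α β) q T
      = F.dMetric q T (R.Z F q) (V q) := by
    rw [F.dMetric_comm, Fluid.dMetric]
    exact Finset.sum_congr rfl fun α _ => Finset.sum_congr rfl fun β _ => by ring
  have s17 : ∑ β, F.lower q (V q) β * R.along (fun p => R.Z F p β) q T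
      = F.g q (R.along (R.Z F) q T) (V q) := by
    rw [F.g_comm, F.g_eq_sum_lower]
    exact Finset.sum_congr rfl fun β _ => by
      rw [along_apply hTt ((hR.Z_contDiffOn hF).diffWithin hq)]
  have s18 := hR.ZJ_eq hF hq V
  rw [along_eq_fderiv hVd hTt] at s11
  rw [s12'] at s12
  rw [s13'] at s13
  have s19 : R.along W q (R.Hbreve F q) = R.lapse F q * R.along W q (R.H F q) := by
    rw [Hbreve, along_smul_right, smul_eq_mul]
  have s20 : R.along W q (R.sphFlux F V q) = F.g q (R.Z F q) (V q) * R.along W q T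
      + R.z F q * R.normSq F V q * R.along W q (R.Theta F q) := by
    rw [sphFlux, along_add_right, along_smul_right, along_smul_right]; rfl
  have s21 : R.sphereDensity F V q * R.along W q (R.Hbreve F q)
      = R.z F q / R.h F q * R.normSq F V q * R.along W q (R.H F q) := by
    rw [s19, sphereDensity]; field_simp
  rw [s17] at s12
  rw [← hT] at s6 s7
  change R.along (R.sphereDensity F V) q (R.Hbreve F q) = _ at s6
  change _ = ∑ β, A β T * R.Z F q β + _ at s12
  change _ = ∑ β, A β T * F.B q β + _ at s13
  have hzz : R.z F q * (R.z F q)⁻¹ = 1 := mul_inv_cancel₀ hzp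
  have hdens : R.sphereDensity F V q = R.z F q / (R.h F q * R.lapse F q) * R.normSq F V q := rfl
  rw [← hT] at s18
  rw [herr, s15, s1, s21, s2, s20, s3, s4, s5, s6, s7, s18, errWeight, errCommon, ← hT, s8, s16, s17,
    F.g_comm q (V q) (R.Z F q), hdens]
  simp only [hA] at s10 s12 s13 s15 hzz ⊢
  linear_combination W q * 2 * (∑ β, A β T * R.Z F q β) * hzz
    - 2 * W q * s10 + W q * s11 - 2 * W q * s12 + 2 * R.z F q * W q * s13

end IsAdmissible

end Region

/-! ### The area measure -/

/-- The measure `√det(g(∂_A ψ, ∂_C ψ)) dy¹ dy²` of a parametrized patch. -/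
def patchMeasure (F : Fluid) (D : Set (Fin 2 → ℝ)) (ψ : (Fin 2 → ℝ) → ST) : Measure ST :=
  ((volume.restrict D).withDensity fun y => ENNReal.ofReal (Real.sqrt (paramGram F ψ y))).map ψ

lemma IsParam.aemeasurable {F : Fluid} {A : Set ST} {D : Set (Fin 2 → ℝ)}
    {ψ : (Fin 2 → ℝ) → ST} (h : IsParam A D ψ) :
    AEMeasurable ψ ((volume.restrict D).withDensity
      fun y => ENNReal.ofReal (Real.sqrt (paramGram F ψ y))) :=
  (h.2.1.continuousOn.aemeasurable h.1.measurableSet).mono_ac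
    (withDensity_absolutelyContinuous _ _)

lemma IsParam.patchMeasure_apply {F : Fluid} {A : Set ST} {D : Set (Fin 2 → ℝ)}
    {ψ : (Fin 2 → ℝ) → ST} (h : IsParam A D ψ) {E : Set ST} (hE : MeasurableSet E) :
    patchMeasure F D ψ E
      = ∫⁻ y in ψ ⁻¹' E ∩ D, ENNReal.ofReal (Real.sqrt (paramGram F ψ y)) := by
  rw [patchMeasure, Measure.map_apply_of_aemeasurable h.aemeasurable hE, withDensity_apply',
    Measure.restrict_restrict' h.1.measurableSet]

lemma measurableSet_preimage_inter {D : Set (Fin 2 → ℝ)} {ψ : (Fin 2 → ℝ) → ST}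
    (hD : MeasurableSet D) (hψ : ContinuousOn ψ D) {E : Set ST} (hE : MeasurableSet E) :
    MeasurableSet (ψ ⁻¹' E ∩ D) := by
  have h1 : MeasurableSet (D.domRestrict ψ ⁻¹' E) := hψ.domRestrict.measurable hE
  have h2 : ψ ⁻¹' E ∩ D = Subtype.val '' (D.domRestrict ψ ⁻¹' E) := by
    ext y
    simp [and_comm, Set.domRestrict]
  rw [h2]
  exact hD.subtype_image h1

/-- The Gram determinants of two parametrizations of a surface differ by the square of the
Jacobian determinant of the transition map. -/
lemma paramGram_comp (F : Fluid) {ψ₁ ψ₂ : (Fin 2 → ℝ) → ST} {φ : (Fin 2 → ℝ) → Fin 2 → ℝ}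
    {y : Fin 2 → ℝ} {φ' : (Fin 2 → ℝ) →L[ℝ] Fin 2 → ℝ} (h : ψ₁ (φ y) = ψ₂ y)
    (hd : fderiv ℝ ψ₂ y = (fderiv ℝ ψ₁ (φ y)).comp φ') :
    paramGram F ψ₂ y = φ'.det ^ 2 * paramGram F ψ₁ (φ y) := by
  have hexp : ∀ A : Fin 2, φ' (Pi.single A 1)
      = φ' (Pi.single A 1) 0 • Pi.single 0 1 + φ' (Pi.single A 1) 1 • Pi.single 1 1 := by
    intro A
    funext i
    fin_cases i <;> simp
  have hdet : φ'.det = φ' (Pi.single 0 1) 0 * φ' (Pi.single 1 1) 1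
      - φ' (Pi.single 1 1) 0 * φ' (Pi.single 0 1) 1 := by
    have : φ'.det = Matrix.det (LinearMap.toMatrix' (φ' : (Fin 2 → ℝ) →ₗ[ℝ] Fin 2 → ℝ)) := by
      rw [LinearMap.det_toMatrix']
    rw [this, Matrix.det_fin_two]
    simp [LinearMap.toMatrix'_apply]
  rw [hdet]
  unfold paramGram
  rw [Matrix.det_fin_two, Matrix.det_fin_two, hd, h]
  simp only [Matrix.of_apply, ContinuousLinearMap.comp_apply]
  have e0 := hexp 0
  have e1 := hexp 1
  generalize φ' (Pi.single 0 1) 0 = a at *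
  generalize φ' (Pi.single 0 1) 1 = b at *
  generalize φ' (Pi.single 1 1) 0 = c at *
  generalize φ' (Pi.single 1 1) 1 = d at *
  rw [e0, e1]
  simp only [map_add, map_smul, F.g_add_left, F.g_add_right, F.g_smul_left, F.g_smul_right]
  rw [F.g_comm _ (fderiv ℝ ψ₁ (φ y) (Pi.single 1 1)) (fderiv ℝ ψ₁ (φ y) (Pi.single 0 1))]
  ring

/-- The patch measures agree on overlaps, by the change of variables formula. -/
lemma IsParam.patchMeasure_eq {F : Fluid} {A : Set ST} {D₁ D₂ : Set (Fin 2 → ℝ)}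
    {ψ₁ ψ₂ : (Fin 2 → ℝ) → ST} (h₁ : IsParam A D₁ ψ₁) (h₂ : IsParam A D₂ ψ₂) {E : Set ST}
    (hE : MeasurableSet E) (hE₁ : E ⊆ ψ₁ '' D₁) (hE₂ : E ⊆ ψ₂ '' D₂) :
    patchMeasure F D₁ ψ₁ E = patchMeasure F D₂ ψ₂ E := by
  rw [h₁.patchMeasure_apply hE, h₂.patchMeasure_apply hE]
  have hm := measurableSet_preimage_inter h₂.1.measurableSet h₂.2.1.continuousOn hE
  obtain ⟨O₁, χ₁, hO₁, hχ₁, him₁, hinv₁⟩ := h₁.2.2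
  obtain ⟨O₂, χ₂, hO₂, hχ₂, him₂, hinv₂⟩ := h₂.2.2
  set φ := fun y => χ₁ (ψ₂ y) with hφ
  have key : ∀ y ∈ D₂, ψ₂ y ∈ ψ₁ '' D₁ → φ y ∈ D₁ ∧ ψ₁ (φ y) = ψ₂ y := by
    rintro y - ⟨x, hx, hxy⟩
    have : φ y = x := by rw [hφ]; simp only; rw [← hxy, hinv₁ x hx]
    rw [this]
    exact ⟨hx, hxy⟩
  have hmemO : ∀ y ∈ D₂, ψ₂ y ∈ ψ₁ '' D₁ → ψ₂ y ∈ O₁ := fun y _ h => (him₁ ▸ h).2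
  have hψ₂ : ∀ y ∈ D₂, DifferentiableAt ℝ ψ₂ y := fun y hy =>
    (h₂.2.1.contDiffAt (h₂.1.mem_nhds hy)).differentiableAt (by simp)
  have hψ₁ : ∀ y ∈ D₁, DifferentiableAt ℝ ψ₁ y := fun y hy =>
    (h₁.2.1.contDiffAt (h₁.1.mem_nhds hy)).differentiableAt (by simp)
  have hφd : ∀ y ∈ D₂, ψ₂ y ∈ ψ₁ '' D₁ → DifferentiableAt ℝ φ y := fun y hy h =>
    ((hχ₁.contDiffAt (hO₁.mem_nhds (hmemO y hy h))).differentiableAt (by simp)).comp y (hψ₂ y hy)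
  have himage : φ '' (ψ₂ ⁻¹' E ∩ D₂) = ψ₁ ⁻¹' E ∩ D₁ := by
    ext x
    constructor
    · rintro ⟨y, ⟨hyE, hy⟩, rfl⟩
      obtain ⟨ha, hb⟩ := key y hy (hE₁ hyE)
      refine ⟨?_, ha⟩
      rw [mem_preimage, hb]
      exact hyE
    · rintro ⟨hxE, hx⟩
      obtain ⟨y, hy, hyx⟩ := hE₂ hxE
      refine ⟨y, ⟨?_, hy⟩, ?_⟩
      · rw [mem_preimage, hyx]; exact hxE
      · simp only [hφ]
        rw [hyx, hinv₁ x hx]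
  have hinj : InjOn φ (ψ₂ ⁻¹' E ∩ D₂) := by
    rintro y ⟨hyE, hy⟩ y' ⟨hyE', hy'⟩ hyy
    have := (key y hy (hE₁ hyE)).2
    rw [hyy, (key y' hy' (hE₁ hyE')).2] at this
    rw [← hinv₂ y hy, ← hinv₂ y' hy', this]
  rw [← himage, lintegral_image_eq_lintegral_abs_det_fderiv_mul volume hm
    (fun y hy => (hφd y hy.2 (hE₁ hy.1)).hasFDerivAt.hasFDerivWithinAt) hinj]
  refine setLIntegral_congr_fun hm ?_
  rintro y ⟨hyE, hy⟩
  obtain ⟨ha, hb⟩ := key y hy (hE₁ hyE)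
  have hev : ψ₂ =ᶠ[𝓝 y] fun y' => ψ₁ (φ y') := by
    have h1 : ∀ᶠ y' in 𝓝 y, ψ₂ y' ∈ O₁ :=
      (hψ₂ y hy).continuousAt (hO₁.mem_nhds (hmemO y hy (hE₁ hyE)))
    filter_upwards [h1, h₂.1.mem_nhds hy] with y' hy1 hy2
    have hA : ψ₂ y' ∈ A := (him₂ ▸ mem_image_of_mem ψ₂ hy2 : ψ₂ y' ∈ A ∩ O₂).1
    exact (key y' hy2 (him₁ ▸ ⟨hA, hy1⟩)).2.symm
  have hd : fderiv ℝ ψ₂ y = (fderiv ℝ ψ₁ (φ y)).comp (fderiv ℝ φ y) := by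
    rw [hev.fderiv_eq]
    exact ((hψ₁ _ ha).hasFDerivAt.comp y (hφd y hy (hE₁ hyE)).hasFDerivAt).fderiv
  simp only
  rw [paramGram_comp F hb hd, Real.sqrt_mul (sq_nonneg _), Real.sqrt_sq_eq_abs,
    ENNReal.ofReal_mul (abs_nonneg _)]

lemma IsParam.patchMeasure_le {F : Fluid} {A : Set ST} {D : Set (Fin 2 → ℝ)}
    {ψ : (Fin 2 → ℝ) → ST} (h : IsParam A D ψ) : patchMeasure F D ψ ≤ areaMeasure F A := by
  unfold areaMeasure
  exact le_iSup_of_le D (le_iSup_of_le ψ (le_iSup_of_le h le_rfl))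

lemma IsParam.image_subset {A : Set ST} {D : Set (Fin 2 → ℝ)} {ψ : (Fin 2 → ℝ) → ST}
    (h : IsParam A D ψ) : ψ '' D ⊆ A := by
  obtain ⟨O, χ, hO, hχ, him, hinv⟩ := h.2.2
  rw [him]
  exact inter_subset_left

lemma IsParam.measurableSet_image {A : Set ST} (hA : MeasurableSet A) {D : Set (Fin 2 → ℝ)}
    {ψ : (Fin 2 → ℝ) → ST} (h : IsParam A D ψ) : MeasurableSet (ψ '' D) := by
  obtain ⟨O, χ, hO, hχ, him, hinv⟩ := h.2.2
  rw [him]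
  exact hA.inter hO.measurableSet

lemma IsParam.patchMeasure_compl {F : Fluid} {A : Set ST} (hA : MeasurableSet A)
    {D : Set (Fin 2 → ℝ)} {ψ : (Fin 2 → ℝ) → ST} (h : IsParam A D ψ) :
    patchMeasure F D ψ (ψ '' D)ᶜ = 0 := by
  rw [h.patchMeasure_apply (h.measurableSet_image hA).compl]
  have : ψ ⁻¹' (ψ '' D)ᶜ ∩ D = ∅ := by
    ext y
    simp only [mem_inter_iff, mem_preimage, mem_compl_iff, mem_empty_iff_false, iff_false, not_and]
    exact fun h1 h2 => h1 (mem_image_of_mem ψ h2)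
  rw [this]
  simp

/-- A measure that dominates all patch measures on the subsets of `P` dominates the area measure
there; the proof compares with the measure that is infinite on nonempty sets outside `P`. -/
lemma areaMeasure_apply_le {F : Fluid} {A P : Set ST} (ν : Measure ST)
    (h : ∀ D ψ, IsParam A D ψ → ∀ E, MeasurableSet E → E ⊆ P → patchMeasure F D ψ E ≤ ν E)
    {E : Set ST} (hE : MeasurableSet E) (hEP : E ⊆ P) : areaMeasure F A E ≤ ν E := by
  set κ : Measure ST := ν + ((⊤ : ENNReal) • Measure.count).restrict Pᶜ with hκ
  have hle : areaMeasure F A ≤ κ := by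
    unfold areaMeasure
    refine iSup_le fun D => iSup_le fun ψ => iSup_le fun hψ => ?_
    change patchMeasure F D ψ ≤ κ
    rw [Measure.le_iff]
    intro E' hE'
    by_cases hsub : E' ⊆ P
    · refine (h D ψ hψ E' hE' hsub).trans ?_
      rw [hκ, Measure.add_apply]
      exact le_self_add
    · have hne : (E' ∩ Pᶜ).Nonempty := by
        obtain ⟨x, hx, hxP⟩ := not_subset.1 hsub
        exact ⟨x, hx, hxP⟩
      have : κ E' = ⊤ := by
        rw [hκ, Measure.add_apply, Measure.restrict_apply hE', Measure.smul_apply, smul_eq_mul,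
          ENNReal.top_mul (Measure.count_ne_zero hne)]
        simp
      rw [this]
      exact le_top
  refine (hle E).trans ?_
  have : E ∩ Pᶜ = ∅ := by
    rw [← disjoint_iff_inter_eq_empty]
    exact disjoint_compl_right_iff_subset.2 hEP
  rw [hκ, Measure.add_apply, Measure.restrict_apply hE, this]
  simp

lemma areaMeasure_compl {F : Fluid} {A : Set ST} (hA : MeasurableSet A) :
    areaMeasure F A Aᶜ = 0 := by
  refine le_antisymm ?_ zero_le
  have := areaMeasure_apply_le (F := F) (A := A) (0 : Measure ST) (fun D ψ hψ E _ hEP => ?_)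
    hA.compl subset_rfl
  · simpa using this
  · refine (measure_mono (hEP.trans (compl_subset_compl.2 hψ.image_subset))).trans ?_
    rw [hψ.patchMeasure_compl hA]
    simp

/-- The area measure restricts to the patch measure on every parametrized patch. -/
lemma IsParam.areaMeasure_restrict {F : Fluid} {A : Set ST} (hA : MeasurableSet A)
    {D : Set (Fin 2 → ℝ)} {ψ : (Fin 2 → ℝ) → ST} (h : IsParam A D ψ) :
    (areaMeasure F A).restrict (ψ '' D) = patchMeasure F D ψ := by
  have hP := h.measurableSet_image hA
  ext E hE
  rw [Measure.restrict_apply hE]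
  have h0 : patchMeasure F D ψ E = patchMeasure F D ψ (E ∩ ψ '' D) := by
    rw [← measure_inter_add_sdiff E hP]
    rw [measure_mono_null (fun x hx => hx.2 : E \ ψ '' D ⊆ (ψ '' D)ᶜ) (h.patchMeasure_compl hA),
      add_zero]
  rw [h0]
  refine le_antisymm ?_ (h.patchMeasure_le _)
  refine areaMeasure_apply_le _ (fun D' ψ' hψ' E' hE' hEP => ?_) (hE.inter hP) inter_subset_right
  have hP' := hψ'.measurableSet_image hA
  have h1 : patchMeasure F D' ψ' E' = patchMeasure F D' ψ' (E' ∩ ψ' '' D') := by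
    rw [← measure_inter_add_sdiff E' hP']
    rw [measure_mono_null (fun x hx => hx.2 : E' \ ψ' '' D' ⊆ (ψ' '' D')ᶜ)
      (hψ'.patchMeasure_compl hA), add_zero]
  rw [h1, hψ'.patchMeasure_eq h (hE'.inter hP') inter_subset_right (inter_subset_left.trans hEP)]
  exact measure_mono inter_subset_left

/-- The integral with respect to the area measure of a function supported in one patch. -/
lemma IsParam.integral_areaMeasure {F : Fluid} {A : Set ST} (hA : MeasurableSet A)
    {D : Set (Fin 2 → ℝ)} {ψ : (Fin 2 → ℝ) → ST} (h : IsParam A D ψ) {f : ST → ℝ}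
    (hf : ContinuousOn f A) (hg : ContinuousOn (paramGram F ψ) D)
    (h0 : ∀ q ∈ A, q ∉ ψ '' D → f q = 0)
    (hint : IntegrableOn (fun y => Real.sqrt (paramGram F ψ y) * f (ψ y)) D) :
    Integrable f (areaMeasure F A) ∧
      ∫ q, f q ∂(areaMeasure F A) = ∫ y in D, Real.sqrt (paramGram F ψ y) * f (ψ y) := by
  have hae : ∀ᵐ q ∂(areaMeasure F A), q ∉ ψ '' D → f q = 0 := by
    have : ∀ᵐ q ∂(areaMeasure F A), q ∈ A := by
      rw [ae_iff]
      exact areaMeasure_compl hA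
    filter_upwards [this] with q hq hq'
    exact h0 q hq hq'
  have hm : AEStronglyMeasurable f (patchMeasure F D ψ) := by
    have : (patchMeasure F D ψ).restrict A = patchMeasure F D ψ := by
      refine Measure.restrict_eq_self_of_ae_mem ?_
      rw [ae_iff]
      exact measure_mono_null (compl_subset_compl.2 h.image_subset) (h.patchMeasure_compl hA)
    rw [← this]
    exact hf.aestronglyMeasurable hA
  have hdens : AEMeasurable (fun y => ENNReal.ofReal (Real.sqrt (paramGram F ψ y)))
      (volume.restrict D) :=
    ((Real.continuous_sqrt.comp_continuousOn hg).aemeasurable h.1.measurableSet).ennreal_ofReal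
  have hlt : ∀ᵐ y ∂(volume.restrict D), ENNReal.ofReal (Real.sqrt (paramGram F ψ y)) < ⊤ :=
    Eventually.of_forall fun y => ENNReal.ofReal_lt_top
  constructor
  · refine IntegrableOn.integrable_of_ae_notMem_eq_zero (s := ψ '' D) ?_ hae
    rw [IntegrableOn, h.areaMeasure_restrict hA, patchMeasure,
      integrable_map_measure hm h.aemeasurable,
      integrable_withDensity_iff_integrable_smul₀' hdens hlt]
    simpa [ENNReal.toReal_ofReal, Real.sqrt_nonneg, IntegrableOn] using hint
  · rw [← setIntegral_eq_integral_of_ae_compl_eq_zero hae, h.areaMeasure_restrict hA, patchMeasure,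
      integral_map h.aemeasurable hm, integral_withDensity_eq_integral_toReal_smul₀ hdens hlt]
    simp [ENNReal.toReal_ofReal, Real.sqrt_nonneg]

/-! ### Frames of the surfaces `S_τ` -/

/-- The Gram determinant of two vectors. -/
def gram2 (F : Fluid) (q b₁ b₂ : ST) : ℝ := F.g q b₁ b₁ * F.g q b₂ b₂ - F.g q b₁ b₂ ^ 2

/-- `b₁, b₂` is a basis of the tangent space of `S_τ` at `q`. -/
structure IsSphereFrame (R : Region) (F : Fluid) (q b₁ b₂ : ST) : Prop where
  left : R.IsSphereTangent F q b₁
  right : R.IsSphereTangent F q b₂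
  span : ∀ X, R.IsSphereTangent F q X → ∃ x₁ x₂ : ℝ, X = x₁ • b₁ + x₂ • b₂
  indep : ∀ x₁ x₂ : ℝ, x₁ • b₁ + x₂ • b₂ = 0 → x₁ = 0 ∧ x₂ = 0

namespace IsSphereFrame

variable {R : Region} {F : Fluid} {q b₁ b₂ : ST}
variable (hF : F.IsEulerSolution R.ambient R.region) (hR : R.IsAdmissible F)
  (hb : IsSphereFrame R F q b₁ b₂)
include hF hR hb

lemma gram2_pos (hq : q ∈ R.lateral) : 0 < gram2 F q b₁ b₂ := by
  have hpos : ∀ x₁ x₂ : ℝ, x₁ • b₁ + x₂ • b₂ ≠ 0 →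
      0 < F.g q (x₁ • b₁ + x₂ • b₂) (x₁ • b₁ + x₂ • b₂) := by
    intro x₁ x₂ h
    refine hR.g_pos_of_tau hF (hR.lateral_subset hq) ?_ h
    rw [map_add, map_smul, map_smul, hR.fderiv_tau_of_isSphereTangent hF hq hb.left,
      hR.fderiv_tau_of_isSphereTangent hF hq hb.right]
    simp
  have h1 := hpos 1 0 fun h => by simpa using (hb.indep 1 0 h).1
  simp only [one_smul, zero_smul, add_zero] at h1
  have h2 := hpos (F.g q b₁ b₂) (-F.g q b₁ b₁) fun h =>
    h1.ne' (neg_eq_zero.1 (hb.indep _ _ h).2)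
  simp only [F.g_add_left, F.g_add_right, F.g_smul_left, F.g_smul_right] at h2
  rw [F.g_comm q b₂ b₁] at h2
  unfold gram2
  by_contra hcon
  push Not at hcon
  nlinarith [mul_nonneg h1.le (neg_nonneg.2 hcon)]

/-- The expansion of the projection onto `S_τ` in a frame, multiplied by the Gram determinant instead
of using the inverse of the Gram matrix. -/
lemma gram2_smul_tang (hq : q ∈ R.lateral) (X : ST) :
    gram2 F q b₁ b₂ • R.tang F q X
      = (F.g q b₂ b₂ * F.g q X b₁ - F.g q b₁ b₂ * F.g q X b₂) • b₁
        + (F.g q b₁ b₁ * F.g q X b₂ - F.g q b₁ b₂ * F.g q X b₁) • b₂ := by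
  obtain ⟨x₁, x₂, hx⟩ := hb.span _ (hR.isSphereTangent_tang hF hq X)
  have h1 : F.g q X b₁ = x₁ * F.g q b₁ b₁ + x₂ * F.g q b₁ b₂ := by
    conv_lhs => rw [← hb.left.tang_eq, ← Region.IsAdmissible.g_tang_left, hx]
    rw [F.g_add_left, F.g_smul_left, F.g_smul_left, F.g_comm q b₂ b₁]
  have h2 : F.g q X b₂ = x₁ * F.g q b₁ b₂ + x₂ * F.g q b₂ b₂ := by
    conv_lhs => rw [← hb.right.tang_eq, ← Region.IsAdmissible.g_tang_left, hx]
    rw [F.g_add_left, F.g_smul_left, F.g_smul_left]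
  rw [hx, h1, h2, gram2]
  module

/-- The trace over `S_τ` of a linear map, in terms of a frame. -/
lemma gram2_mul_trace (hq : q ∈ R.lateral) (L : ST →ₗ[ℝ] ST) :
    gram2 F q b₁ b₂ * ∑ δ, L (R.angCoord F δ q) δ
      = F.g q b₂ b₂ * F.g q (L b₁) b₁ - F.g q b₁ b₂ * F.g q (L b₁) b₂
        + (F.g q b₁ b₁ * F.g q (L b₂) b₂ - F.g q b₁ b₂ * F.g q (L b₂) b₁) := by
  have hsum : ∀ Y b : ST, F.g q Y b = ∑ δ, F.g q (coordVec δ) b * Y δ := by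
    intro Y b
    rw [F.g_comm, F.g_eq_sum_lower]
    exact Finset.sum_congr rfl fun δ _ => by rw [Fluid.lower, F.g_comm]
  rw [hsum (L b₁) b₁, hsum (L b₁) b₂, hsum (L b₂) b₁, hsum (L b₂) b₂]
  simp only [Finset.mul_sum, ← Finset.sum_sub_distrib, ← Finset.sum_add_distrib]
  refine Finset.sum_congr rfl fun δ _ => ?_
  have h := congrArg (fun X => L X δ) (hb.gram2_smul_tang hF hR hq (coordVec δ))
  simp only [map_add, map_smul, Pi.add_apply, Pi.smul_apply, smul_eq_mul] at h
  rw [Region.angCoord_eq, h]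
  ring

lemma gram2_mul_sphInv (hq : q ∈ R.lateral) (γ ε : Fin 4) :
    gram2 F q b₁ b₂ * R.sphInv F q γ ε
      = F.g q b₂ b₂ * (b₁ γ * b₁ ε) - F.g q b₁ b₂ * (b₁ γ * b₂ ε + b₂ γ * b₁ ε)
        + F.g q b₁ b₁ * (b₂ γ * b₂ ε) := by
  have hc := hR.c_pos hF (hR.lateral_subset hq)
  set X : ST := fun α => F.gInv q α ε with hX
  have hl : ∀ β, F.lower q X β = if ε = β then 1 else 0 := by
    intro β
    rw [F.lower_eq_sum, ← F.sharp_coord hc ε β]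
    exact Finset.sum_congr rfl fun α _ => by rw [hX, F.gInv_comm]; ring
  have hg : ∀ b, F.g q X b = b ε := by
    intro b
    rw [F.g_eq_sum_lower]
    simp [hl]
  have h1 : R.tang F q X γ = R.sphInv F q γ ε := by
    rw [← Region.sum_sphInv_lower R F hc X γ]
    simp [hl]
  have h := congrArg (fun Y => Y γ) (hb.gram2_smul_tang hF hR hq X)
  simp only [Pi.add_apply, Pi.smul_apply, smul_eq_mul, h1, hg] at h
  rw [h]
  ring

lemma gram2_mul_sphDiv (hq : q ∈ R.lateral) {ξ : ST → ST}
    (hξ : DifferentiableWithinAt ℝ ξ R.lateral q) :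
    gram2 F q b₁ b₂ * R.sphDiv F ξ q
      = F.g q b₂ b₂ * (F.g q (R.along ξ q b₁) b₁ + F.dMetric q (ξ q) b₁ b₁ / 2)
        + F.g q b₁ b₁ * (F.g q (R.along ξ q b₂) b₂ + F.dMetric q (ξ q) b₂ b₂ / 2)
        - F.g q b₁ b₂ * (F.g q (R.along ξ q b₁) b₂ + F.g q (R.along ξ q b₂) b₁
          + F.dMetric q (ξ q) b₁ b₂) := by
  have h1 := hb.gram2_mul_trace hF hR hq (fderivWithin ℝ ξ R.lateral q : ST →ₗ[ℝ] ST)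
  have h2 : gram2 F q b₁ b₂
        * ∑ γ, ∑ ε, R.sphInv F q γ ε * fderiv ℝ (fun p => F.gLow p γ ε) q (ξ q)
      = F.g q b₂ b₂ * F.dMetric q (ξ q) b₁ b₁
        - F.g q b₁ b₂ * (F.dMetric q (ξ q) b₁ b₂ + F.dMetric q (ξ q) b₂ b₁)
        + F.g q b₁ b₁ * F.dMetric q (ξ q) b₂ b₂ := by
    simp only [Fluid.dMetric, Finset.mul_sum, mul_add, ← Finset.sum_sub_distrib,
      ← Finset.sum_add_distrib]
    refine Finset.sum_congr rfl fun γ _ => Finset.sum_congr rfl fun ε _ => ?_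
    rw [← mul_assoc, hb.gram2_mul_sphInv hF hR hq]
    ring
  rw [F.dMetric_comm q (ξ q) b₂ b₁] at h2
  have h3 : ∀ δ, R.along (fun p => ξ p δ) q (R.angCoord F δ q)
      = (fderivWithin ℝ ξ R.lateral q : ST →ₗ[ℝ] ST) (R.angCoord F δ q) δ := fun δ =>
    Region.along_apply (hR.angCoord_tangent hF hq δ) hξ δ
  rw [hR.sphDiv_eq hF hq, mul_add, Finset.sum_congr rfl fun δ _ => h3 δ, h1]
  have h4 : gram2 F q b₁ b₂ * (1 / 2 * ∑ γ, ∑ ε, R.sphInv F q γ ε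
      * fderiv ℝ (fun p => F.gLow p γ ε) q (ξ q)) = 1 / 2 * (gram2 F q b₁ b₂
        * ∑ γ, ∑ ε, R.sphInv F q γ ε * fderiv ℝ (fun p => F.gLow p γ ε) q (ξ q)) := by ring
  rw [h4, h2]
  simp only [Region.along, ContinuousLinearMap.coe_coe]
  ring

end IsSphereFrame

/-! ### Coordinates on the lateral boundary -/

namespace LatChart

variable {R : Region} {F : Fluid} (C : LatChart R) {x : Fin 3 → ℝ}

/-- The embedding of the coordinate space `ℝ³` of the lateral boundary into `ℝ⁴`. -/
def incl : (Fin 3 → ℝ) →L[ℝ] (Fin 4 → ℝ) :=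
  ContinuousLinearMap.pi (Fin.cons 0 fun i => ContinuousLinearMap.proj i)

@[simp] lemma incl_zero (x : Fin 3 → ℝ) : incl x 0 = 0 := rfl

@[simp] lemma incl_succ (x : Fin 3 → ℝ) (i : Fin 3) : incl x i.succ = x i := rfl

@[simp] lemma incl_one (x : Fin 3 → ℝ) : incl x 1 = x 0 := rfl

/-- The coordinate domain of the lateral boundary. -/
def dom : Set (Fin 3 → ℝ) := incl ⁻¹' C.chart.target

/-- The parametrization of the lateral boundary by the last three coordinates of the chart, the
first of which is `tau`. -/
def param (x : Fin 3 → ℝ) : ST := C.chart.symm (incl x)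

/-- The coordinate vector fields of the lateral boundary. -/
def frame (i : Fin 3) (x : Fin 3 → ℝ) : ST := fderiv ℝ C.param x (Pi.single i 1)

/-- The components of a vector field along the lateral boundary in the coordinates. -/
def comp (ξ : ST → ST) (i : Fin 3) (x : Fin 3 → ℝ) : ℝ :=
  fderiv ℝ C.chart (C.param x) (ξ (C.param x)) i.succ

/-- The density of the area forms in the coordinates. -/
def gram (F : Fluid) (x : Fin 3 → ℝ) : ℝ := gram2 F (C.param x) (C.frame 1 x) (C.frame 2 x)

lemma isOpen_dom : IsOpen C.dom := C.chart.open_target.preimage incl.continuous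

lemma param_mem_source (hx : x ∈ C.dom) : C.param x ∈ C.chart.source := C.chart.map_target hx

lemma chart_param (hx : x ∈ C.dom) : C.chart (C.param x) = incl x := C.chart.right_inv hx

lemma tau_param (hx : x ∈ C.dom) : R.tau (C.param x) = x 0 := by
  rw [← C.chart_one, C.chart_param hx]
  rfl

lemma param_mem_lateral_iff (hx : x ∈ C.dom) : C.param x ∈ R.lateral ↔ x 0 ∈ Icc 0 R.T := by
  rw [C.lateral_iff _ (C.param_mem_source hx), C.tau_param hx, C.chart_param hx]
  simp

lemma exists_param {p : ST} (hp : p ∈ C.chart.source) (hl : p ∈ R.lateral) :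
    ∃ x ∈ C.dom, C.param x = p ∧ ∀ i : Fin 3, x i = C.chart p i.succ := by
  have h : incl (fun i => C.chart p i.succ) = C.chart p := by
    funext j
    refine Fin.cases ?_ (fun i => rfl) j
    rw [incl_zero, ((C.lateral_iff p hp).1 hl).1]
  refine ⟨fun i => C.chart p i.succ, ?_, ?_, fun i => rfl⟩
  · rw [dom, mem_preimage, h]
    exact C.chart.map_source hp
  · rw [param, h, C.chart.left_inv hp]

lemma param_contDiffOn : ContDiffOn ℝ ∞ C.param C.dom :=
  C.symm_smooth.comp incl.contDiff.contDiffOn fun _ h => h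

lemma param_contDiffAt (hx : x ∈ C.dom) : ContDiffAt ℝ ∞ C.param x :=
  C.param_contDiffOn.contDiffAt (C.isOpen_dom.mem_nhds hx)

lemma param_hasFDerivAt (hx : x ∈ C.dom) : HasFDerivAt C.param (fderiv ℝ C.param x) x :=
  ((C.param_contDiffAt hx).differentiableAt (by simp)).hasFDerivAt

lemma frame_contDiffAt (hx : x ∈ C.dom) (i : Fin 3) : ContDiffAt ℝ ∞ (C.frame i) x :=
  ((C.param_contDiffAt hx).fderiv_right (by simp)).clm_apply contDiffAt_const

lemma fderiv_chart_param (hx : x ∈ C.dom) (w : Fin 3 → ℝ) :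
    fderiv ℝ C.chart (C.param x) (fderiv ℝ C.param x w) = incl w := by
  have h1 : fderiv ℝ C.param x = (fderiv ℝ C.chart.symm (incl x)).comp incl := by
    have h2 := C.symm_hasFDerivAt (y := incl x) hx
    exact (h2.comp x incl.hasFDerivAt).fderiv
  rw [h1, ContinuousLinearMap.comp_apply]
  have h3 := C.fderiv_fderiv_symm (C.param_mem_source hx) (incl w)
  rwa [C.chart_param hx] at h3

lemma fderiv_chart_frame (hx : x ∈ C.dom) (i : Fin 3) :
    fderiv ℝ C.chart (C.param x) (C.frame i x) = incl (Pi.single i 1) :=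
  C.fderiv_chart_param hx _

/-- A vector tangent to the lateral boundary is the combination of the coordinate vectors with its
coordinate components. -/
lemma sum_frame (hx : x ∈ C.dom) {X : ST} (hX : fderiv ℝ C.chart (C.param x) X 0 = 0) :
    X = ∑ i : Fin 3, fderiv ℝ C.chart (C.param x) X i.succ • C.frame i x := by
  have hp := C.param_mem_source hx
  have hinj : ∀ Y Y' : ST, fderiv ℝ C.chart (C.param x) Y = fderiv ℝ C.chart (C.param x) Y' →
      Y = Y' := fun Y Y' h => by
    rw [← C.fderiv_symm_fderiv hp Y, h, C.fderiv_symm_fderiv hp]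
  apply hinj
  rw [map_sum]
  simp only [map_smul, C.fderiv_chart_frame hx]
  funext j
  refine Fin.cases ?_ (fun i => ?_) j
  · simp [hX]
  · simp [Pi.single_apply]

variable (hF : F.IsEulerSolution R.ambient R.region) (hR : R.IsAdmissible F)
include hF hR

lemma isSphereTangent_iff (hx : x ∈ C.dom) (hl : C.param x ∈ R.lateral) (X : ST) :
    R.IsSphereTangent F (C.param x) X ↔ fderiv ℝ C.chart (C.param x) X 0 = 0
      ∧ fderiv ℝ C.chart (C.param x) X 1 = 0 := by
  rw [← hR.mem_tangentSpaceAt_sphere_iff hF hl, C.mem_tangentSpaceAt_sphere (C.param_mem_source hx)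
    hl, C.fderiv_u (C.param_mem_source hx), C.fderiv_tau (C.param_mem_source hx)]

omit hF in
lemma mem_tangent_iff (hx : x ∈ C.dom) (hl : C.param x ∈ R.lateral) (X : ST) :
    X ∈ tangentSpaceAt R.lateral (C.param x) ↔ fderiv ℝ C.chart (C.param x) X 0 = 0 := by
  rw [C.mem_tangentSpaceAt_lateral (C.param_mem_source hx) hl hR.T_pos,
    C.fderiv_u (C.param_mem_source hx)]

lemma isSphereFrame (hx : x ∈ C.dom) (hl : C.param x ∈ R.lateral) :
    IsSphereFrame R F (C.param x) (C.frame 1 x) (C.frame 2 x) := by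
  have h01 : ∀ X, fderiv ℝ C.chart (C.param x) X 1
      = fderiv ℝ C.chart (C.param x) X (Fin.succ 0) := fun X => rfl
  refine ⟨?_, ?_, fun X hX => ?_, fun x₁ x₂ h => ?_⟩
  · rw [C.isSphereTangent_iff hF hR hx hl, C.fderiv_chart_frame hx]
    simp
  · rw [C.isSphereTangent_iff hF hR hx hl, C.fderiv_chart_frame hx]
    simp
  · rw [C.isSphereTangent_iff hF hR hx hl] at hX
    have h := C.sum_frame hx hX.1
    rw [Fin.sum_univ_three, ← h01, hX.2, zero_smul, zero_add] at h
    exact ⟨_, _, h⟩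
  · have h' := congrArg (fun X => fderiv ℝ C.chart (C.param x) X) h
    simp only [map_add, map_smul, C.fderiv_chart_frame hx, map_zero] at h'
    have h1 := congrFun h' (Fin.succ 1)
    have h2 := congrFun h' (Fin.succ 2)
    simp only [Pi.add_apply, Pi.smul_apply, incl_succ, Pi.zero_apply, smul_eq_mul] at h1 h2
    simpa using And.intro h1 h2

lemma gram_pos (hx : x ∈ C.dom) (hl : C.param x ∈ R.lateral) : 0 < C.gram F x :=
  (C.isSphereFrame hF hR hx hl).gram2_pos hF hR hl

/-- The coordinate vector `∂_τ` differs from the normalized generator by a vector tangent to `S_τ`,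
because both are tangent to the lateral boundary and satisfy `X tau = 1`. -/
lemma tang_frame_zero (hx : x ∈ C.dom) (hl : C.param x ∈ R.lateral) :
    R.tang F (C.param x) (C.frame 0 x) = C.frame 0 x - R.Hbreve F (C.param x) := by
  have hT : R.IsSphereTangent F (C.param x) (C.frame 0 x - R.Hbreve F (C.param x)) := by
    rw [C.isSphereTangent_iff hF hR hx hl, map_sub]
    have h1 := (C.mem_tangent_iff hR hx hl _).1 (hR.Hbreve_tangent hl)
    have h2 := hR.fderiv_tau_Hbreve hF hl
    rw [C.fderiv_tau (C.param_mem_source hx)] at h2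
    simp only [Pi.sub_apply, C.fderiv_chart_frame hx, h1, h2]
    simp
  have h := hT.tang_eq
  have hlin : R.tang F (C.param x) (C.frame 0 x - R.Hbreve F (C.param x))
      = R.tang F (C.param x) (C.frame 0 x) - R.tang F (C.param x) (R.Hbreve F (C.param x)) :=
    map_sub (R.tangL F (C.param x)) _ _
  rwa [hlin, hR.tang_Hbreve hF hl, sub_zero] at h

end LatChart

/-! ### The divergence in coordinates -/

lemma Fluid.g_comp_hasFDerivAt {E : Type*} [NormedAddCommGroup E] [NormedSpace ℝ E] (F : Fluid)
    {x : E} {φ X Y : E → ST}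
    (hg : ∀ α β, DifferentiableAt ℝ (fun p => F.gLow p α β) (φ x))
    (hφ : DifferentiableAt ℝ φ x) (hX : DifferentiableAt ℝ X x) (hY : DifferentiableAt ℝ Y x) :
    DifferentiableAt ℝ (fun x' => F.g (φ x') (X x') (Y x')) x ∧
    ∀ w, fderiv ℝ (fun x' => F.g (φ x') (X x') (Y x')) x w
      = F.dMetric (φ x) (fderiv ℝ φ x w) (X x) (Y x)
        + F.g (φ x) (fderiv ℝ X x w) (Y x) + F.g (φ x) (X x) (fderiv ℝ Y x w) := by
  have h1 := fun α β => (hg α β).hasFDerivAt.comp x hφ.hasFDerivAt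
  have hX' := fun α : Fin 4 => hasFDerivAt_pi'.1 hX.hasFDerivAt α
  have hY' := fun α : Fin 4 => hasFDerivAt_pi'.1 hY.hasFDerivAt α
  have h2 := fun α β => ((h1 α β).fun_mul (hX' α)).fun_mul (hY' β)
  have h3 : HasFDerivAt (𝕜 := ℝ) (fun x' => ∑ α, ∑ β, F.gLow (φ x') α β * X x' α * Y x' β) _ x :=
    HasFDerivAt.fun_sum (u := Finset.univ) fun α _ =>
    HasFDerivAt.fun_sum (u := Finset.univ) fun β _ => h2 α β
  have h4 : (fun x' => F.g (φ x') (X x') (Y x'))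
      = fun x' => ∑ α, ∑ β, F.gLow (φ x') α β * X x' α * Y x' β :=
    funext fun x' => F.g_eq_sum _ _ _
  rw [h4]
  refine ⟨h3.differentiableAt, fun w => ?_⟩
  rw [h3.fderiv]
  simp only [F.g_eq_sum, Fluid.dMetric, ← Finset.sum_add_distrib, sum_apply]
  refine Finset.sum_congr rfl fun α _ => Finset.sum_congr rfl fun β _ => ?_
  simp only [add_apply, smul_apply, smul_eq_mul,
    ContinuousLinearMap.comp_apply, ContinuousLinearMap.proj_apply,
    Function.comp_apply]
  ring

lemma fderiv_eq_sum_single {G : Type*} [AddCommGroup G] [Module ℝ G] [TopologicalSpace G]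
    (L : (Fin 3 → ℝ) →L[ℝ] G) (a : Fin 3 → ℝ) : L a = ∑ i, a i • L (Pi.single i 1) := by
  conv_lhs => rw [pi_eq_sum_univ' a]
  rw [map_sum]
  exact Finset.sum_congr rfl fun i _ => by rw [map_smul]

namespace LatChart

variable {R : Region} {F : Fluid} (C : LatChart R) {x : Fin 3 → ℝ}

lemma eventually_lateral (hx : x ∈ C.dom) (h0 : x 0 ∈ Ioo 0 R.T) :
    ∀ᶠ x' in 𝓝 x, x' ∈ C.dom ∧ C.param x' ∈ R.lateral := by
  have h1 : ∀ᶠ x' in 𝓝 x, x' 0 ∈ Ioo 0 R.T :=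
    (continuous_apply 0).continuousAt (isOpen_Ioo.mem_nhds h0)
  filter_upwards [C.isOpen_dom.mem_nhds hx, h1] with x' h2 h3
  exact ⟨h2, (C.param_mem_lateral_iff h2).2 ⟨h3.1.le, h3.2.le⟩⟩

/-- For `0 < tau < T` the parametrization maps a neighborhood into the lateral boundary, so derivatives
within the lateral boundary become derivatives. -/
lemma hasFDerivAt_comp_param {G : Type*} [NormedAddCommGroup G] [NormedSpace ℝ G] {f : ST → G}
    (hf : ContDiffOn ℝ ∞ f R.lateral) (hx : x ∈ C.dom) (h0 : x 0 ∈ Ioo 0 R.T) :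
    HasFDerivAt (fun x' => f (C.param x'))
      ((fderivWithin ℝ f R.lateral (C.param x)).comp (fderiv ℝ C.param x)) x := by
  have hev := C.eventually_lateral hx h0
  have h1 := (hf.diffWithin hev.self_of_nhds.2).hasFDerivWithinAt
  have h2 : HasFDerivWithinAt (fun x' => f (C.param x')) _ (C.param ⁻¹' R.lateral) x :=
    h1.comp x (C.param_hasFDerivAt hx).hasFDerivWithinAt (fun _ h => h)
  exact h2.hasFDerivAt (by filter_upwards [hev] with x' h using h.2)

lemma sum_comp_frame (hR : R.IsAdmissible F) {ξ : ST → ST}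
    (hT : ∀ p ∈ R.lateral, ξ p ∈ tangentSpaceAt R.lateral p)
    (hx : x ∈ C.dom) (hl : C.param x ∈ R.lateral) :
    ξ (C.param x) = fderiv ℝ C.param x fun i => C.comp ξ i x := by
  rw [fderiv_eq_sum_single]
  exact C.sum_frame hx ((C.mem_tangent_iff hR hx hl _).1 (hT _ hl))

lemma comp_zero (hx : x ∈ C.dom) (ξ : ST → ST) :
    C.comp ξ 0 x = fderiv ℝ R.tau (C.param x) (ξ (C.param x)) := by
  rw [C.fderiv_tau (C.param_mem_source hx)]
  rfl

lemma fderiv_chart_contDiffAt {p : ST} (hp : p ∈ C.chart.source) :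
    ContDiffAt ℝ ∞ (fderiv ℝ C.chart) p :=
  (C.contDiffAt hp).fderiv_right (by simp)

variable (hF : F.IsEulerSolution R.ambient R.region) (hR : R.IsAdmissible F)

lemma comp_differentiableAt {ξ : ST → ST} (hξ : ContDiffOn ℝ ∞ ξ R.lateral) (hx : x ∈ C.dom)
    (h0 : x 0 ∈ Ioo 0 R.T) (i : Fin 3) : DifferentiableAt ℝ (C.comp ξ i) x := by
  have h1 : DifferentiableAt ℝ (fun x' => fderiv ℝ C.chart (C.param x')) x :=
    ((C.fderiv_chart_contDiffAt (C.param_mem_source hx)).differentiableAt (by simp)).comp x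
      (C.param_hasFDerivAt hx).differentiableAt
  have h2 := h1.clm_apply (C.hasFDerivAt_comp_param hξ hx h0).differentiableAt
  exact differentiableAt_pi.1 h2 i.succ

include hF hR

lemma g_frame_hasFDerivAt (hx : x ∈ C.dom) (hl : C.param x ∈ R.lateral) (i j : Fin 3) :
    DifferentiableAt ℝ (fun x' => F.g (C.param x') (C.frame i x') (C.frame j x')) x ∧
    ∀ w, fderiv ℝ (fun x' => F.g (C.param x') (C.frame i x') (C.frame j x')) x w
      = F.dMetric (C.param x) (fderiv ℝ C.param x w) (C.frame i x) (C.frame j x)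
        + F.g (C.param x) (fderiv ℝ (C.frame i) x w) (C.frame j x)
        + F.g (C.param x) (C.frame i x) (fderiv ℝ (C.frame j) x w) :=
  F.g_comp_hasFDerivAt (hR.gLow_differentiableAt hF (hR.lateral_subset hl))
    (C.param_hasFDerivAt hx).differentiableAt
    ((C.frame_contDiffAt hx i).differentiableAt (by simp))
    ((C.frame_contDiffAt hx j).differentiableAt (by simp))

lemma gram_hasFDerivAt (hx : x ∈ C.dom) (hl : C.param x ∈ R.lateral) :
    DifferentiableAt ℝ (C.gram F) x ∧ ∀ w, fderiv ℝ (C.gram F) x w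
      = fderiv ℝ (fun x' => F.g (C.param x') (C.frame 1 x') (C.frame 1 x')) x w
          * F.g (C.param x) (C.frame 2 x) (C.frame 2 x)
        + F.g (C.param x) (C.frame 1 x) (C.frame 1 x)
          * fderiv ℝ (fun x' => F.g (C.param x') (C.frame 2 x') (C.frame 2 x')) x w
        - 2 * F.g (C.param x) (C.frame 1 x) (C.frame 2 x)
          * fderiv ℝ (fun x' => F.g (C.param x') (C.frame 1 x') (C.frame 2 x')) x w := by
  have h11 := (C.g_frame_hasFDerivAt hF hR hx hl 1 1).1.hasFDerivAt
  have h12 := (C.g_frame_hasFDerivAt hF hR hx hl 1 2).1.hasFDerivAt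
  have h22 := (C.g_frame_hasFDerivAt hF hR hx hl 2 2).1.hasFDerivAt
  have h := (h11.mul h22).sub (h12.pow 2)
  have h' : HasFDerivAt (C.gram F) _ x := h
  refine ⟨h'.differentiableAt, fun w => ?_⟩
  rw [h'.fderiv]
  simp only [sub_apply, add_apply,
    smul_apply, smul_eq_mul]
  simp
  ring

/-- The divergence on the lateral boundary in coordinates: `√Δ` times it is the coordinate
divergence of `√Δ ξ`. -/
theorem sum_fderiv_sqrt_gram_mul_comp {ξ : ST → ST} (hξ : ContDiffOn ℝ ∞ ξ R.lateral)
    (hT : ∀ p ∈ R.lateral, ξ p ∈ tangentSpaceAt R.lateral p)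
    (hx : x ∈ C.dom) (h0 : x 0 ∈ Ioo 0 R.T) :
    (∀ i, DifferentiableAt ℝ (fun x' => Real.sqrt (C.gram F x') * C.comp ξ i x') x) ∧
    ∑ i, fderiv ℝ (fun x' => Real.sqrt (C.gram F x') * C.comp ξ i x') x (Pi.single i 1)
      = Real.sqrt (C.gram F x) * R.lateralDiv F ξ (C.param x) := by
  have hev := C.eventually_lateral hx h0
  have hl := hev.self_of_nhds.2
  set q := C.param x with hq
  set b := fun i => C.frame i x with hb
  set a : Fin 3 → ℝ := fun i => C.comp ξ i x with ha
  have hpos := C.gram_pos hF hR hx hl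
  have hc := fun i => (C.comp_differentiableAt hξ hx h0 i)
  have hs : HasFDerivAt (fun x' => Real.sqrt (C.gram F x')) _ x :=
    (C.gram_hasFDerivAt hF hR hx hl).1.hasFDerivAt.sqrt hpos.ne'
  have hprod := fun i => hs.fun_mul (hc i).hasFDerivAt
  refine ⟨fun i => (hprod i).differentiableAt, ?_⟩
  have hsum : ∑ i, fderiv ℝ (fun x' => Real.sqrt (C.gram F x') * C.comp ξ i x') x (Pi.single i 1)
      = Real.sqrt (C.gram F x) * ∑ i, fderiv ℝ (C.comp ξ i) x (Pi.single i 1)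
        + 1 / (2 * Real.sqrt (C.gram F x)) * fderiv ℝ (C.gram F) x a := by
    rw [fderiv_eq_sum_single (fderiv ℝ (C.gram F) x) a, Finset.mul_sum, Finset.mul_sum,
      ← Finset.sum_add_distrib]
    refine Finset.sum_congr rfl fun i _ => ?_
    rw [(hprod i).fderiv]
    simp only [add_apply, smul_apply, smul_eq_mul, ha]
    ring
  -- the components of `ξ` and their derivatives
  have hξq : ξ q = fderiv ℝ C.param x a := C.sum_comp_frame hR hT hx hl
  have hD2 : ContDiffAt ℝ ∞ (fderiv ℝ C.param) x := (C.param_contDiffAt hx).fderiv_right (by simp)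
  have hD2' := (hD2.differentiableAt (by simp)).hasFDerivAt
  have hframe : ∀ i w, fderiv ℝ (C.frame i) x w
      = fderiv ℝ (fderiv ℝ C.param) x w (Pi.single i 1) := by
    intro i w
    have h : HasFDerivAt (C.frame i) _ x := hD2'.clm_apply (hasFDerivAt_const (Pi.single i 1) x)
    rw [h.fderiv]
    simp
  have hsymm : IsSymmSndFDerivAt ℝ C.param x := (C.param_contDiffAt hx).isSymmSndFDerivAt
    (by simpa using WithTop.coe_le_coe.2 (le_top : (2 : ℕ∞) ≤ ⊤))
  have halong : ∀ i, R.along ξ q (b i)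
      = fderiv ℝ (C.frame i) x a + ∑ j, fderiv ℝ (C.comp ξ j) x (Pi.single i 1) • b j := by
    intro i
    have h1 := (C.hasFDerivAt_comp_param hξ hx h0)
    have h2 : HasFDerivAt (fun x' => fderiv ℝ C.param x' fun j => C.comp ξ j x') _ x :=
      hD2'.clm_apply (hasFDerivAt_pi.2 fun j => (hc j).hasFDerivAt)
    have h3 := h1.unique (h2.congr_of_eventuallyEq (by
      filter_upwards [hev] with x' hx'
      exact C.sum_comp_frame hR hT hx'.1 hx'.2))
    have h4 := congrArg (fun L => L (Pi.single i 1)) h3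
    simp only [ContinuousLinearMap.comp_apply, add_apply,
      ContinuousLinearMap.flip_apply] at h4
    rw [hframe, hsymm.eq a (Pi.single i 1)]
    change fderivWithin ℝ ξ R.lateral q (fderiv ℝ C.param x (Pi.single i 1)) = _
    rw [h4, fderiv_eq_sum_single (fderiv ℝ C.param x), add_comm]
    simp only [ContinuousLinearMap.pi_apply]
    rfl
  -- the derivative of `ξ tau` along the normalized generator
  have hτ : ContDiffOn ℝ ∞ (fun p => fderiv ℝ R.tau p (ξ p)) R.lateral := hR.fderiv_tau_contDiffOn hξ
  have hτi : ∀ i, R.along (fun p => fderiv ℝ R.tau p (ξ p)) q (b i)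
      = fderiv ℝ (C.comp ξ 0) x (Pi.single i 1) := by
    intro i
    have h1 := (C.hasFDerivAt_comp_param hτ hx h0)
    have h2 : HasFDerivAt (C.comp ξ 0) _ x := h1.congr_of_eventuallyEq (by
      filter_upwards [hev] with x' hx'
      exact C.comp_zero hx'.1 ξ)
    rw [h2.fderiv]
    rfl
  have hfr := C.isSphereFrame hF hR hx hl
  have hH : C.gram F x * R.along (fun p => fderiv ℝ R.tau p (ξ p)) q (R.Hbreve F q)
      = C.gram F x * fderiv ℝ (C.comp ξ 0) x (Pi.single 0 1)
        - ((F.g q (b 2) (b 2) * F.g q (b 0) (b 1) - F.g q (b 1) (b 2) * F.g q (b 0) (b 2))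
            * fderiv ℝ (C.comp ξ 0) x (Pi.single 1 1)
          + (F.g q (b 1) (b 1) * F.g q (b 0) (b 2) - F.g q (b 1) (b 2) * F.g q (b 0) (b 1))
            * fderiv ℝ (C.comp ξ 0) x (Pi.single 2 1)) := by
    have h1 : R.Hbreve F q = b 0 - R.tang F q (b 0) := by
      rw [C.tang_frame_zero hF hR hx hl]
      simp [hb, hq]
    have h2 := congrArg (fun X => R.along (fun p => fderiv ℝ R.tau p (ξ p)) q X)
      (hfr.gram2_smul_tang hF hR hl (b 0))
    simp only [Region.along_smul_right, Region.along_add_right, smul_eq_mul] at h2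
    rw [h1, Region.along_sub_right, mul_sub, hτi 0]
    have h3 : C.gram F x = gram2 F q (C.frame 1 x) (C.frame 2 x) := rfl
    rw [h3, h2, ← hτi 1, ← hτi 2]
  have hS := hfr.gram2_mul_sphDiv hF hR hl (hξ.diffWithin hl)
  change C.gram F x * R.sphDiv F ξ q = _ at hS
  have hgr := (C.gram_hasFDerivAt hF hR hx hl).2 a
  rw [(C.g_frame_hasFDerivAt hF hR hx hl 1 1).2 a, (C.g_frame_hasFDerivAt hF hR hx hl 2 2).2 a,
    (C.g_frame_hasFDerivAt hF hR hx hl 1 2).2 a, ← hξq] at hgr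
  have h1 := halong 1
  have h2 := halong 2
  simp only [hb] at h1 h2
  rw [h1, h2] at hS
  simp only [Fin.sum_univ_three, F.g_add_left, F.g_smul_left] at hS
  have hkey : C.gram F x * R.lateralDiv F ξ q
      = C.gram F x * ∑ i, fderiv ℝ (C.comp ξ i) x (Pi.single i 1)
        + 1 / 2 * fderiv ℝ (C.gram F) x a := by
    rw [Region.lateralDiv, mul_add, hH, hS, hgr, Fin.sum_univ_three]
    simp only [hb, gram, gram2, ← hq]
    rw [F.g_comm q (C.frame 2 x) (C.frame 1 x),
      F.g_comm q (C.frame 1 x) (fderiv ℝ (C.frame 1) x a),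
      F.g_comm q (C.frame 2 x) (fderiv ℝ (C.frame 2) x a),
      F.g_comm q (C.frame 1 x) (fderiv ℝ (C.frame 2) x a)]
    ring
  rw [hsum]
  have hsq : Real.sqrt (C.gram F x) * Real.sqrt (C.gram F x) = C.gram F x :=
    Real.mul_self_sqrt hpos.le
  have hsp := Real.sqrt_pos.2 hpos
  refine mul_left_cancel₀ hsp.ne' ?_
  rw [← mul_assoc, hsq, hkey, mul_add, ← mul_assoc, hsq]
  field_simp

end LatChart

/-! ### Closedness of the lateral boundary -/

namespace Region.IsAdmissible

variable {R : Region} {F : Fluid} (hR : R.IsAdmissible F)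
include hR

/-- The lateral boundary is closed: near a point of the region that is not on it the region is a
full slab, which excludes points of the lateral boundary because `u > 0` on one side of them. -/
lemma isCompact_lateral : IsCompact R.lateral := by
  refine hR.region_compact.of_isClosed_subset ?_ hR.lateral_subset
  refine isClosed_of_closure_subset fun q hq => ?_
  have hqr : q ∈ R.region :=
    hR.region_compact.isClosed.closure_subset_iff.2 hR.lateral_subset hq
  by_contra hql
  obtain ⟨O, hO, hqO, -, hreg⟩ := hR.local_interior q ⟨hqr, hql⟩
  obtain ⟨p, hpO, hpl⟩ := mem_closure_iff.1 hq O hO hqO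
  obtain ⟨C, hp⟩ := hR.exists_latChart hpl
  set w : Fin 4 → ℝ := Pi.single 0 1 with hw
  have hcont := (C.hasDerivAt_line hp w).continuousAt.tendsto
  rw [zero_smul, add_zero, C.chart.left_inv hp] at hcont
  have h1 : ∀ᶠ s in 𝓝[>] (0 : ℝ), C.chart.symm (C.chart p + s • w) ∈ O :=
    (hcont.mono_left nhdsWithin_le_nhds).eventually (hO.mem_nhds hpO)
  obtain ⟨s, hs1, hs2, hs3⟩ :=
    (h1.and ((C.line_mem_target hp w).and self_mem_nhdsWithin)).exists
  have hlat := (C.lateral_iff p hp).1 hpl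
  set p' := C.chart.symm (C.chart p + s • w) with hp'
  have hp's : p' ∈ C.chart.source := C.chart.map_target hs2
  have hchart : C.chart p' = C.chart p + s • w := C.chart.right_inv hs2
  have hτ : R.tau p' = R.tau p := by
    rw [← C.chart_one, ← C.chart_one, hchart]
    simp [hw]
  have hmem : p' ∈ R.region ∩ O := by
    rw [hreg]
    exact ⟨hs1, hτ ▸ hlat.2⟩
  have := ((C.region_iff p' hp's).1 hmem.1).1
  rw [hchart] at this
  simp only [hw, Pi.add_apply, Pi.smul_apply, Pi.single_eq_same, smul_eq_mul, mul_one, hlat.1,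
    zero_add] at this
  exact absurd hs3 (not_lt.2 this)

lemma sphere_eq (t : ℝ) : R.sphere t = R.lateral ∩ {q | R.tau q = t} := by
  ext q
  exact ⟨fun h => ⟨h.1, h.2.2⟩, fun h => ⟨h.1, hR.lateral_subset h.1, h.2⟩⟩

lemma isClosed_sphere (t : ℝ) : IsClosed (R.sphere t) := by
  rw [hR.sphere_eq]
  have hc : ContinuousOn R.tau R.lateral := hR.tau_smooth.continuousOn.mono
    (hR.lateral_subset.trans hR.region_subset)
  exact hc.preimage_isClosed_of_isClosed hR.isCompact_lateral.isClosed (isClosed_singleton (x := t))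

lemma measurableSet_sphere (t : ℝ) : MeasurableSet (R.sphere t) :=
  (hR.isClosed_sphere t).measurableSet

lemma ae_sphereMeasure (t : ℝ) : ∀ᵐ q ∂(R.sphereMeasure F t), q ∈ R.lateral := by
  have h := areaMeasure_compl (F := F) (hR.measurableSet_sphere t)
  have h' : ∀ᵐ q ∂(R.sphereMeasure F t), q ∈ R.sphere t := by
    rw [ae_iff]
    exact h
  filter_upwards [h'] with q hq using hq.1

lemma sphereIntegral_congr {f f' : ST → ℝ} (h : EqOn f f' R.lateral) (t : ℝ) :
    R.sphereIntegral F t f = R.sphereIntegral F t f' :=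
  integral_congr_ae (by filter_upwards [hR.ae_sphereMeasure t] with q hq using h hq)

lemma sphere_integrable_congr {f f' : ST → ℝ} (h : EqOn f f' R.lateral) {t : ℝ}
    (hf : Integrable f (R.sphereMeasure F t)) : Integrable f' (R.sphereMeasure F t) :=
  hf.congr (by filter_upwards [hR.ae_sphereMeasure t] with q hq using h hq)

end Region.IsAdmissible

/-! ### Integrals over the lateral boundary in coordinates -/

/-- The point `(s, y)` of `ℝ³`. -/
def cons3 (s : ℝ) (y : Fin 2 → ℝ) : Fin 3 → ℝ := Fin.cons s y

@[simp] lemma cons3_zero (s : ℝ) (y : Fin 2 → ℝ) : cons3 s y 0 = s := rfl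

@[simp] lemma cons3_succ (s : ℝ) (y : Fin 2 → ℝ) (A : Fin 2) : cons3 s y A.succ = y A := rfl

/-- The inclusion of `ℝ²` into `ℝ³` as `{0} × ℝ²`. -/
def incl2 : (Fin 2 → ℝ) →L[ℝ] (Fin 3 → ℝ) :=
  ContinuousLinearMap.pi (Fin.cons 0 fun i => ContinuousLinearMap.proj i)

lemma cons3_eq (s : ℝ) (y : Fin 2 → ℝ) : cons3 s y = Pi.single 0 s + incl2 y := by
  funext j
  refine Fin.cases ?_ (fun i => ?_) j
  · simp [incl2]
  · simp [incl2]

lemma continuous_cons3 : Continuous fun p : ℝ × (Fin 2 → ℝ) => cons3 p.1 p.2 := by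
  refine continuous_pi fun j => ?_
  refine Fin.cases ?_ (fun i => ?_) j
  · exact continuous_fst
  · exact (continuous_apply i).comp continuous_snd

lemma cons3_hasFDerivAt (s : ℝ) (y : Fin 2 → ℝ) : HasFDerivAt (cons3 s) incl2 y := by
  have h : cons3 s = fun y => Pi.single 0 s + incl2 y := funext (cons3_eq s)
  rw [h]
  exact incl2.hasFDerivAt.const_add _

lemma incl2_single (A : Fin 2) : incl2 (Pi.single A 1) = Pi.single A.succ 1 := by
  funext j
  refine Fin.cases ?_ (fun i => ?_) j
  · simp [incl2]
  · simp [incl2, Pi.single_apply]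

/-- Fubini's theorem for a box in `ℝ³`. -/
lemma integral_box {g : (Fin 3 → ℝ) → ℝ} {a₀ b₀ : ℝ} {a b : Fin 2 → ℝ}
    (hg : IntegrableOn g (Icc (cons3 a₀ a) (cons3 b₀ b))) :
    ∫ x in Icc (cons3 a₀ a) (cons3 b₀ b), g x
        = ∫ s in Icc a₀ b₀, ∫ y in Icc a b, g (cons3 s y) ∧
      IntegrableOn (fun s => ∫ y in Icc a b, g (cons3 s y)) (Icc a₀ b₀) := by
  set e := MeasurableEquiv.piFinSuccAbove (fun _ : Fin 3 => ℝ) 0 with he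
  have hmp := (volume_preserving_piFinSuccAbove (fun _ : Fin 3 => ℝ) 0).symm
  have hes : ∀ p : ℝ × (Fin 2 → ℝ), e.symm p = cons3 p.1 p.2 := by
    intro p
    simp [he, MeasurableEquiv.piFinSuccAbove, cons3, Fin.insertNthEquiv]
  have hpre : e.symm ⁻¹' Icc (cons3 a₀ a) (cons3 b₀ b) = Icc a₀ b₀ ×ˢ Icc a b := by
    ext p
    rw [mem_preimage, hes]
    simp only [mem_Icc, Pi.le_def, Fin.forall_fin_succ (n := 2), cons3_zero, cons3_succ, mem_prod]
    tauto
  have h1 := hmp.setIntegral_preimage_emb e.symm.measurableEmbedding g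
    (Icc (cons3 a₀ a) (cons3 b₀ b))
  have h2 : IntegrableOn (fun p => g (e.symm p)) (Icc a₀ b₀ ×ˢ Icc a b) (volume.prod volume) := by
    rw [← hpre]
    exact (hmp.integrableOn_comp_preimage e.symm.measurableEmbedding).2 hg
  simp only [hes] at h2
  constructor
  · rw [← h1]
    change ∫ x in e.symm ⁻¹' Icc (cons3 a₀ a) (cons3 b₀ b), g (e.symm x) ∂_ = _
    rw [hpre]
    simp only [hes]
    exact setIntegral_prod (μ := volume) (ν := volume) (fun p : ℝ × (Fin 2 → ℝ) => g (cons3 p.1 p.2)) h2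
  · rw [IntegrableOn, ← Measure.prod_restrict] at h2
    exact h2.integral_prod_left

namespace LatChart

variable {R : Region} {F : Fluid} (C : LatChart R)

/-- The parameter domain of the surface `S_t`. -/
def sliceDom (t : ℝ) : Set (Fin 2 → ℝ) := {y | cons3 t y ∈ C.dom}

/-- The parametrization of the surface `S_t`. -/
def sliceParam (t : ℝ) (y : Fin 2 → ℝ) : ST := C.param (cons3 t y)

lemma isOpen_sliceDom (t : ℝ) : IsOpen (C.sliceDom t) :=
  C.isOpen_dom.preimage (continuous_cons3.comp (by fun_prop : Continuous fun y => (t, y)))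

lemma image_sliceParam (hR : R.IsAdmissible F) {t : ℝ} (ht : t ∈ Icc 0 R.T) :
    C.sliceParam t '' C.sliceDom t = R.sphere t ∩ C.chart.source := by
  rw [hR.sphere_eq]
  ext p
  constructor
  · rintro ⟨y, hy, rfl⟩
    exact ⟨⟨(C.param_mem_lateral_iff hy).2 ht, C.tau_param hy⟩, C.param_mem_source hy⟩
  · rintro ⟨⟨hl, hτ⟩, hs⟩
    obtain ⟨x, hx, rfl, -⟩ := C.exists_param hs hl
    have h0 : x 0 = t := (C.tau_param hx).symm.trans hτ
    have hxe : cons3 t (fun A => x A.succ) = x := by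
      funext j
      refine Fin.cases h0.symm (fun i => rfl) j
    refine ⟨fun A => x A.succ, ?_, ?_⟩
    · change cons3 t (fun A => x A.succ) ∈ C.dom
      rwa [hxe]
    · rw [sliceParam, hxe]

lemma isParam_slice (hR : R.IsAdmissible F) {t : ℝ} (ht : t ∈ Icc 0 R.T) :
    IsParam (R.sphere t) (C.sliceDom t) (C.sliceParam t) := by
  refine ⟨C.isOpen_sliceDom t, ?_, C.chart.source, fun p A => C.chart p A.succ.succ,
    C.chart.open_source, ?_, ?_, ?_⟩
  · refine C.param_contDiffOn.comp (ContDiff.contDiffOn ?_) fun y hy => hy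
    have h : cons3 t = fun y => Pi.single 0 t + incl2 y := funext (cons3_eq t)
    rw [h]
    exact contDiff_const.add incl2.contDiff
  · exact contDiffOn_pi.2 fun A => contDiffOn_pi.1 C.smooth _
  · exact C.image_sliceParam hR ht
  · intro y hy
    funext A
    change C.chart (C.param (cons3 t y)) A.succ.succ = y A
    rw [C.chart_param hy, incl_succ, cons3_succ]

lemma paramGram_slice {t : ℝ} {y : Fin 2 → ℝ} (hy : y ∈ C.sliceDom t) :
    paramGram F (C.sliceParam t) y = C.gram F (cons3 t y) := by
  have h1 : HasFDerivAt (C.sliceParam t) ((fderiv ℝ C.param (cons3 t y)).comp incl2) y :=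
    (C.param_hasFDerivAt hy).comp y (cons3_hasFDerivAt t y)
  have h2 : ∀ A : Fin 2, fderiv ℝ (C.sliceParam t) y (Pi.single A 1)
      = C.frame A.succ (cons3 t y) := by
    intro A
    rw [h1.fderiv, ContinuousLinearMap.comp_apply, incl2_single]
    rfl
  rw [paramGram, Matrix.det_fin_two]
  simp only [Matrix.of_apply, h2]
  rw [gram, gram2, sq, F.g_comm _ (C.frame (Fin.succ 1) _) (C.frame (Fin.succ 0) _)]
  rfl

/-- The function `φ` on the coordinate domain, extended by zero. -/
def extend (φ : (Fin 3 → ℝ) → ℝ) : (Fin 3 → ℝ) → ℝ := C.dom.indicator φ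

/-- The coordinate expression of the integrand of `f`, including the density of the area forms. -/
def integrand (F : Fluid) (f : ST → ℝ) : (Fin 3 → ℝ) → ℝ :=
  C.extend fun x => Real.sqrt (C.gram F x) * f (C.param x)

/-- The coordinate image of a set. -/
def coordImage (K : Set ST) : Set (Fin 3 → ℝ) := incl ⁻¹' (C.chart '' K)

lemma isCompact_coordImage {K : Set ST} (hK : IsCompact K) (hKs : K ⊆ C.chart.source) :
    IsCompact (C.coordImage K) := by
  have h1 : IsCompact (C.chart '' K) := hK.image_of_continuousOn (C.smooth.continuousOn.mono hKs)
  have h2 : Topology.IsClosedEmbedding (incl : (Fin 3 → ℝ) → Fin 4 → ℝ) := by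
    refine LinearMap.isClosedEmbedding_of_injective (f := (incl : (Fin 3 → ℝ) →ₗ[ℝ] Fin 4 → ℝ)) ?_
    rw [LinearMap.ker_eq_bot]
    intro x y h
    funext i
    exact congrFun h i.succ
  exact h2.isCompact_preimage h1

lemma mem_of_param_mem {K : Set ST} {x : Fin 3 → ℝ} (hx : x ∈ C.dom)
    (h : C.param x ∈ K) : x ∈ C.coordImage K :=
  ⟨C.param x, h, C.chart_param hx⟩

/-- The slab of `ℝ³` over which `tau` has values in `[0, T]`. -/
def slab (R : Region) : Set (Fin 3 → ℝ) := {x | x 0 ∈ Icc 0 R.T}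

variable {K : Set ST} {φ : (Fin 3 → ℝ) → ℝ}

lemma extend_eq_zero (h0 : ∀ x ∈ C.dom ∩ slab R, x ∉ C.coordImage K → φ x = 0)
    {x : Fin 3 → ℝ} (hx : x ∈ slab R) (hxK : x ∉ C.coordImage K) : C.extend φ x = 0 := by
  by_cases hd : x ∈ C.dom
  · rw [extend, indicator_of_mem hd, h0 x ⟨hd, hx⟩ hxK]
  · rw [extend, indicator_of_notMem hd]

lemma coordImage_subset_dom (hKs : K ⊆ C.chart.source) : C.coordImage K ⊆ C.dom := by
  rintro x ⟨p, hp, hpx⟩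
  rw [dom, mem_preimage, ← hpx]
  exact C.chart.map_source (hKs hp)

lemma extend_continuousOn (hK : IsCompact K) (hKs : K ⊆ C.chart.source)
    (hφ : ContinuousOn φ (C.dom ∩ slab R))
    (h0 : ∀ x ∈ C.dom ∩ slab R, x ∉ C.coordImage K → φ x = 0) :
    ContinuousOn (C.extend φ) (slab R) := by
  intro x hx
  by_cases hd : x ∈ C.dom
  · have h1 : ContinuousWithinAt φ (slab R) x :=
      (hφ x ⟨hd, hx⟩).mono_of_mem_nhdsWithin (by
        rw [inter_comm]
        exact inter_mem self_mem_nhdsWithin (mem_nhdsWithin_of_mem_nhds (C.isOpen_dom.mem_nhds hd)))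
    refine h1.congr_of_eventuallyEq ?_ (indicator_of_mem hd φ)
    filter_upwards [mem_nhdsWithin_of_mem_nhds (C.isOpen_dom.mem_nhds hd)] with x' hx'
    exact indicator_of_mem hx' φ
  · have hxK : x ∉ C.coordImage K := fun h => hd (C.coordImage_subset_dom hKs h)
    have hopen := (C.isCompact_coordImage hK hKs).isClosed.isOpen_compl.mem_nhds hxK
    refine (continuousWithinAt_const (b := (0 : ℝ))).congr_of_eventuallyEq ?_
      (indicator_of_notMem hd φ)
    filter_upwards [mem_nhdsWithin_of_mem_nhds hopen, self_mem_nhdsWithin] with x' h1 h2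
    exact C.extend_eq_zero h0 h2 h1

section integrals

variable (hF : F.IsEulerSolution R.ambient R.region) (hR : R.IsAdmissible F)
include hF hR

lemma sqrt_gram_mul_continuousOn {f : ST → ℝ} (hf : ContinuousOn f R.lateral) :
    ContinuousOn (fun x => Real.sqrt (C.gram F x) * f (C.param x)) (C.dom ∩ slab R) := by
  have hl : ∀ x ∈ C.dom ∩ slab R, C.param x ∈ R.lateral := fun x hx =>
    (C.param_mem_lateral_iff hx.1).2 hx.2
  refine ContinuousOn.mul (fun x hx => ?_) (hf.comp (C.param_contDiffOn.continuousOn.mono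
    inter_subset_left) hl)
  exact ((C.gram_hasFDerivAt hF hR hx.1 (hl x hx)).1.continuousAt.sqrt).continuousWithinAt

omit hF hR in
lemma integrand_zero {f : ST → ℝ} (h0 : ∀ p ∈ R.lateral, p ∉ K → f p = 0) :
    ∀ x ∈ C.dom ∩ slab R, x ∉ C.coordImage K → Real.sqrt (C.gram F x) * f (C.param x) = 0 := by
  intro x hx hxK
  rw [h0 _ ((C.param_mem_lateral_iff hx.1).2 hx.2) fun h => hxK (C.mem_of_param_mem hx.1 h),
    mul_zero]

lemma integrand_continuousOn (hK : IsCompact K) (hKs : K ⊆ C.chart.source) {f : ST → ℝ}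
    (hf : ContinuousOn f R.lateral) (h0 : ∀ p ∈ R.lateral, p ∉ K → f p = 0) :
    ContinuousOn (C.integrand F f) (slab R) :=
  C.extend_continuousOn hK hKs (C.sqrt_gram_mul_continuousOn hF hR hf) (C.integrand_zero h0)

/-- The integral over `S_t` of a function supported in the domain of a chart. -/
lemma sphereIntegral_eq (hK : IsCompact K) (hKs : K ⊆ C.chart.source) {f : ST → ℝ}
    (hf : ContinuousOn f R.lateral) (h0 : ∀ p ∈ R.lateral, p ∉ K → f p = 0) {t : ℝ}
    (ht : t ∈ Icc 0 R.T) {r : ℝ} (hr : ∀ x ∈ C.coordImage K, ∀ A : Fin 2, |x A.succ| ≤ r) :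
    Integrable f (R.sphereMeasure F t) ∧ R.sphereIntegral F t f
      = ∫ y in Icc (fun _ : Fin 2 => -r) (fun _ => r), C.integrand F f (cons3 t y) := by
  have hpar := C.isParam_slice hR ht
  have hm := hR.measurableSet_sphere t
  have hcts : Continuous fun y => C.integrand F f (cons3 t y) :=
    (C.integrand_continuousOn hF hR hK hKs hf h0).comp_continuous
      (continuous_cons3.comp (by fun_prop : Continuous fun y : Fin 2 → ℝ => (t, y)))
      fun y => by simpa [slab] using ht
  have hslab : ∀ y, cons3 t y ∈ slab R := fun y => by simpa [slab] using ht
  have hzero : ∀ y, y ∉ Icc (fun _ : Fin 2 => -r) (fun _ => r) →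
      C.integrand F f (cons3 t y) = 0 := by
    intro y hy
    refine C.extend_eq_zero (C.integrand_zero h0) (hslab y) fun h => hy ?_
    have := hr _ h
    simp only [cons3_succ, abs_le] at this
    exact ⟨fun A => (this A).1, fun A => (this A).2⟩
  have heq : ∀ y ∈ C.sliceDom t, Real.sqrt (paramGram F (C.sliceParam t) y) * f (C.sliceParam t y)
      = C.integrand F f (cons3 t y) := by
    intro y hy
    rw [integrand, extend, indicator_of_mem (show cons3 t y ∈ C.dom from hy), C.paramGram_slice hy]
    rfl
  have hint : IntegrableOn (fun y => C.integrand F f (cons3 t y))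
      (Icc (fun _ : Fin 2 => -r) fun _ => r) := hcts.continuousOn.integrableOn_Icc
  have hint' : Integrable fun y => C.integrand F f (cons3 t y) :=
    hint.integrable_of_forall_notMem_eq_zero hzero
  have hmD := (C.isOpen_sliceDom t).measurableSet
  have h := hpar.integral_areaMeasure (F := F) hm (f := f) (hf.mono fun q hq => hq.1) ?_ ?_ ?_
  · refine ⟨h.1, ?_⟩
    rw [Region.sphereIntegral, Region.sphereMeasure, h.2, setIntegral_congr_fun hmD heq,
      setIntegral_eq_integral_of_forall_compl_eq_zero (s := C.sliceDom t),
      setIntegral_eq_integral_of_forall_compl_eq_zero hzero]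
    intro y hy
    have hy' : cons3 t y ∉ C.dom := hy
    simp only [integrand, extend, indicator_of_notMem hy']
  · intro y hy
    have hl := (C.param_mem_lateral_iff (x := cons3 t y) hy).2 (by simpa using ht)
    have h1 : ContinuousAt (fun y => C.gram F (cons3 t y)) y :=
      ContinuousAt.comp (f := cons3 t) (C.gram_hasFDerivAt hF hR hy hl).1.continuousAt
        (cons3_hasFDerivAt t y).continuousAt
    refine (h1.continuousWithinAt).congr (fun y' hy' => C.paramGram_slice hy') ?_
    exact C.paramGram_slice hy
  · intro q hq hqD
    refine h0 q hq.1 fun hqK => hqD ?_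
    rw [C.image_sliceParam hR ht]
    exact ⟨hq, hKs hqK⟩
  · exact (hint'.integrableOn).congr_fun (fun y hy => (heq y hy).symm) hmD

omit hF hR in
lemma exists_radius (hK : IsCompact K) (hKs : K ⊆ C.chart.source) :
    ∃ r : ℝ, 0 < r ∧ ∀ x ∈ C.coordImage K, ∀ A : Fin 2, |x A.succ| < r := by
  obtain ⟨r, hr0, hr⟩ := (C.isCompact_coordImage hK hKs).isBounded.exists_pos_norm_lt
  exact ⟨r, hr0, fun x hx A => (norm_le_pi_norm x A.succ).trans_lt (hr x hx)⟩

end integrals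

end LatChart

/-! ### Continuity and locality of the divergence -/

namespace Region.IsAdmissible

variable {R : Region} {F : Fluid} (hF : F.IsEulerSolution R.ambient R.region)
  (hR : R.IsAdmissible F)
include hF hR

lemma sphDiv_continuousOn {ξ : ST → ST} (hξ : ContDiffOn ℝ ∞ ξ R.lateral) :
    ContinuousOn (R.sphDiv F ξ) R.lateral := by
  have h : ContinuousOn (fun q => ∑ δ, R.along (fun p => ξ p δ) q (R.angCoord F δ q)
      + 1 / 2 * ∑ γ, ∑ ε, R.sphInv F q γ ε * fderiv ℝ (fun p => F.gLow p γ ε) q (ξ q))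
      R.lateral := by
    refine ContinuousOn.add (continuousOn_finsetSum _ fun δ _ => ?_) (continuousOn_const.mul
      (continuousOn_finsetSum _ fun γ _ => continuousOn_finsetSum _ fun ε _ => ?_))
    · exact continuousOn_along (contDiffOn_pi.1 hξ δ) (hR.angCoord_contDiffOn hF δ).continuousOn
        fun p hp => hR.angCoord_tangent hF hp δ
    · refine (hR.sphInv_contDiffOn hF γ ε).continuousOn.mul ?_
      refine ContinuousOn.clm_apply (fun q hq => ?_) hξ.continuousOn
      have h1 := hF.gLow_contDiffAt hR.ambient_open
        (hR.mem_goodSet hF (hR.lateral_subset hq)) γ ε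
      exact ((h1.fderiv_right (m := 0) (by simp)).continuousAt).continuousWithinAt
  exact h.congr fun q hq => hR.sphDiv_eq hF hq ξ

lemma lateralDiv_continuousOn {ξ : ST → ST} (hξ : ContDiffOn ℝ ∞ ξ R.lateral) :
    ContinuousOn (R.lateralDiv F ξ) R.lateral :=
  (continuousOn_along (hR.fderiv_tau_contDiffOn hξ) (hR.Hbreve_contDiffOn hF).continuousOn
    fun _ hp => hR.Hbreve_tangent hp).add (hR.sphDiv_continuousOn hF hξ)

lemma ZJ_continuousOn {V : ST → ST} (hV : ∀ p ∈ R.lateral, ContDiffAt ℝ ∞ V p) :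
    ContinuousOn (R.ZJ F V) R.lateral := by
  have hV' : ContDiffOn ℝ ∞ V R.lateral := fun p hp => (hV p hp).contDiffWithinAt
  have hd : ContDiffOn ℝ ∞ (fderiv ℝ V) R.lateral := fun p hp =>
    ((hV p hp).fderiv_right (m := ∞) (by simp)).contDiffWithinAt
  have h1 : ContDiffOn ℝ ∞ (fun q => F.g q (R.Z F q) (fderiv ℝ V q (R.tang F q (V q)))
      - F.g q (R.Z F q) (V q) * ∑ δ, fderiv ℝ V q (R.angCoord F δ q) δ) R.lateral :=
    (hR.g_contDiffOn hF (hR.Z_contDiffOn hF) (hd.clm_apply (hR.tang_contDiffOn hF hV'))).sub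
      ((hR.g_contDiffOn hF (hR.Z_contDiffOn hF) hV').mul
        (ContDiffOn.sum fun δ _ =>
          contDiffOn_pi.1 (hd.clm_apply (hR.angCoord_contDiffOn hF δ)) δ))
  exact h1.continuousOn.congr fun q hq => hR.ZJ_eq hF hq V

lemma lateralDiv_congr {ξ ξ' : ST → ST} (h : EqOn ξ ξ' R.lateral) {q : ST} (hq : q ∈ R.lateral) :
    R.lateralDiv F ξ q = R.lateralDiv F ξ' q := by
  rw [lateralDiv, lateralDiv, hR.sphDiv_eq hF hq, hR.sphDiv_eq hF hq, h hq,
    along_congr (f := fun p => fderiv ℝ R.tau p (ξ p)) (f' := fun p => fderiv ℝ R.tau p (ξ' p))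
      (fun p hp => by simp only [h hp]) hq]
  congr 2
  refine Finset.sum_congr rfl fun δ _ => ?_
  exact along_congr (fun p hp => by simp only [h hp]) hq _

lemma lateralDiv_sum {ι : Type*} (s : Finset ι) {ξ : ι → ST → ST}
    (hξ : ∀ i, ContDiffOn ℝ ∞ (ξ i) R.lateral) {q : ST} (hq : q ∈ R.lateral) :
    R.lateralDiv F (fun p => ∑ i ∈ s, ξ i p) q = ∑ i ∈ s, R.lateralDiv F (ξ i) q := by
  simp only [lateralDiv, map_sum]
  rw [along_sum (hR.Hbreve_tangent hq) s fun i _ =>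
    (hR.fderiv_tau_contDiffOn (hξ i)).diffWithin hq,
    hR.sphDiv_sum hF hq s fun i _ => (hξ i).diffWithin hq, Finset.sum_add_distrib]

/-- The divergence vanishes where the vector field vanishes locally. -/
lemma lateralDiv_eq_zero {ξ : ST → ST} {q : ST} (hq : q ∈ R.lateral)
    (h : ξ =ᶠ[𝓝[R.lateral] q] fun _ => 0) : R.lateralDiv F ξ q = 0 := by
  have h0 : ξ q = 0 := h.self_of_nhdsWithin hq
  have h1 : R.along (fun p => fderiv ℝ R.tau p (ξ p)) q (R.Hbreve F q) = 0 := by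
    rw [along, Filter.EventuallyEq.fderivWithin_eq (f := fun _ => (0 : ℝ)) ?_ (by simp [h0])]
    · simp
    · filter_upwards [h] with p hp
      simp [hp]
  have h2 : ∀ δ X, R.along (fun p => ξ p δ) q X = 0 := by
    intro δ X
    rw [along, Filter.EventuallyEq.fderivWithin_eq (f := fun _ => (0 : ℝ)) ?_ (by simp [h0])]
    · simp
    · filter_upwards [h] with p hp
      simp [hp]
  rw [lateralDiv, hR.sphDiv_eq hF hq, h0, h1]
  simp [h2]

end Region.IsAdmissible

/-! ### The divergence theorem in a chart -/

namespace LatChart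

variable {R : Region} {F : Fluid} (C : LatChart R) {K : Set ST}
variable (hF : F.IsEulerSolution R.ambient R.region) (hR : R.IsAdmissible F)
include hF hR

omit hF hR in
lemma box_subset_slab {t : ℝ} (ht : t ∈ Icc 0 R.T) {a b : Fin 2 → ℝ} :
    Icc (cons3 0 a) (cons3 t b) ⊆ slab R := fun _ hx =>
  ⟨hx.1 0, (hx.2 0).trans ht.2⟩

lemma intervalIntegrable_sphereIntegral (hK : IsCompact K) (hKs : K ⊆ C.chart.source) {f : ST → ℝ}
    (hf : ContinuousOn f R.lateral) (h0 : ∀ p ∈ R.lateral, p ∉ K → f p = 0) {t : ℝ}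
    (ht : t ∈ Icc 0 R.T) {r : ℝ} (hr : ∀ x ∈ C.coordImage K, ∀ A : Fin 2, |x A.succ| < r) :
    IntervalIntegrable (fun s => R.sphereIntegral F s f) volume 0 t ∧
      ∫ s in (0 : ℝ)..t, R.sphereIntegral F s f
        = ∫ x in Icc (cons3 0 fun _ => -r) (cons3 t fun _ => r), C.integrand F f x := by
  have hint : IntegrableOn (C.integrand F f) (Icc (cons3 0 fun _ => -r) (cons3 t fun _ => r)) :=
    ((C.integrand_continuousOn hF hR hK hKs hf h0).mono
      (box_subset_slab ht)).integrableOn_Icc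
  obtain ⟨h1, h2⟩ := integral_box hint
  have heq : ∀ s ∈ Icc 0 t, ∫ y in Icc (fun _ : Fin 2 => -r) (fun _ => r),
      C.integrand F f (cons3 s y) = R.sphereIntegral F s f := fun s hs =>
    (C.sphereIntegral_eq hF hR hK hKs hf h0 ⟨hs.1, hs.2.trans ht.2⟩
      fun x hx A => (hr x hx A).le).2.symm
  constructor
  · rw [intervalIntegrable_iff_integrableOn_Icc_of_le ht.1]
    exact h2.congr_fun heq measurableSet_Icc
  · rw [h1, intervalIntegral.integral_of_le ht.1, ← integral_Icc_eq_integral_Ioc]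
    exact (setIntegral_congr_fun measurableSet_Icc heq).symm

/-- The divergence theorem for a vector field along the lateral boundary that is supported in the
domain of a chart: the divergence theorem on a box in the coordinate space. -/
theorem integral_lateralDiv (hK : IsCompact K) (hKs : K ⊆ C.chart.source) {ξ : ST → ST}
    (hξ : ContDiffOn ℝ ∞ ξ R.lateral) (hT : ∀ p ∈ R.lateral, ξ p ∈ tangentSpaceAt R.lateral p)
    (h0 : ∀ p ∈ R.lateral, p ∉ K → ξ p = 0) {t : ℝ} (ht : t ∈ Icc 0 R.T) :
    ∫ s in (0 : ℝ)..t, R.sphereIntegral F s (R.lateralDiv F ξ)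
      = R.sphereIntegral F t (fun p => fderiv ℝ R.tau p (ξ p))
        - R.sphereIntegral F 0 (fun p => fderiv ℝ R.tau p (ξ p)) := by
  obtain ⟨r, hr0, hr⟩ := C.exists_radius hK hKs
  have hT0 : (0 : ℝ) ∈ Icc 0 R.T := ⟨le_rfl, hR.T_pos.le⟩
  have hdiv0 : ∀ p ∈ R.lateral, p ∉ K → R.lateralDiv F ξ p = 0 := by
    intro p hp hpK
    refine hR.lateralDiv_eq_zero hF hp ?_
    filter_upwards [self_mem_nhdsWithin,
      mem_nhdsWithin_of_mem_nhds (hK.isClosed.isOpen_compl.mem_nhds hpK)] with p' h1 h2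
    exact h0 p' h1 h2
  have hτ : ContDiffOn ℝ ∞ (fun p => fderiv ℝ R.tau p (ξ p)) R.lateral := hR.fderiv_tau_contDiffOn hξ
  have hτ0 : ∀ p ∈ R.lateral, p ∉ K → fderiv ℝ R.tau p (ξ p) = 0 := fun p hp hpK => by
    rw [h0 p hp hpK, map_zero]
  rw [(C.intervalIntegrable_sphereIntegral hF hR hK hKs (hR.lateralDiv_continuousOn hF hξ) hdiv0 ht
    hr).2, (C.sphereIntegral_eq hF hR hK hKs hτ.continuousOn hτ0 ht fun x hx A => (hr x hx A).le).2,
    (C.sphereIntegral_eq hF hR hK hKs hτ.continuousOn hτ0 hT0 fun x hx A => (hr x hx A).le).2]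
  set f : Fin 3 → (Fin 3 → ℝ) → ℝ := fun i =>
    C.extend fun x => Real.sqrt (C.gram F x) * C.comp ξ i x with hf
  have hl : ∀ x ∈ C.dom ∩ slab R, C.param x ∈ R.lateral := fun x hx =>
    (C.param_mem_lateral_iff hx.1).2 hx.2
  have hcomp0 : ∀ i, ∀ x ∈ C.dom ∩ slab R, x ∉ C.coordImage K →
      Real.sqrt (C.gram F x) * C.comp ξ i x = 0 := by
    intro i x hx hxK
    rw [comp, h0 _ (hl x hx) fun h => hxK (C.mem_of_param_mem hx.1 h)]
    simp
  have hfc : ∀ i, ContinuousOn (f i) (slab R) := by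
    intro i
    refine C.extend_continuousOn hK hKs (ContinuousOn.mul (fun x hx => ?_) (fun x hx => ?_))
      (hcomp0 i)
    · exact ((C.gram_hasFDerivAt hF hR hx.1 (hl x hx)).1.continuousAt.sqrt).continuousWithinAt
    · have h1 : ContinuousWithinAt (fun x => fderiv ℝ C.chart (C.param x)) (C.dom ∩ slab R) x :=
        (ContinuousAt.comp (C.fderiv_chart_contDiffAt (C.param_mem_source hx.1)).continuousAt
          (C.param_hasFDerivAt hx.1).continuousAt).continuousWithinAt
      have h2 : ContinuousOn (fun x => ξ (C.param x)) (C.dom ∩ slab R) :=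
        hξ.continuousOn.comp (C.param_contDiffOn.continuousOn.mono inter_subset_left) hl
      exact (continuousWithinAt_pi.1 (h1.clm_apply (h2 x hx))) i.succ
  have hfzero : ∀ i, ∀ x ∈ slab R, x ∉ C.coordImage K → f i x = 0 := fun i x hx hxK =>
    C.extend_eq_zero (hcomp0 i) hx hxK
  have hf0 : f 0 = C.integrand F fun p => fderiv ℝ R.tau p (ξ p) := by
    funext x
    simp only [hf, integrand, extend]
    by_cases hx : x ∈ C.dom
    · rw [indicator_of_mem hx, indicator_of_mem hx, C.comp_zero hx]
    · rw [indicator_of_notMem hx, indicator_of_notMem hx]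
  set a : Fin 3 → ℝ := cons3 0 fun _ => -r with ha
  set b : Fin 3 → ℝ := cons3 t fun _ => r with hb
  have hle : a ≤ b := by
    intro j
    refine Fin.cases ?_ (fun i => ?_) j
    · exact ht.1
    · simp only [ha, hb, cons3_succ]
      linarith
  have hbox : Icc a b ⊆ slab R := box_subset_slab ht
  -- the divergence in the interior of the box
  have hinner : ∀ x ∈ pi univ fun i => Ioo (a i) (b i),
      (∀ i, DifferentiableAt ℝ (f i) x) ∧ ∑ i, fderiv ℝ (f i) x (Pi.single i 1)
        = C.integrand F (R.lateralDiv F ξ) x := by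
    intro x hx
    have hx0 : x 0 ∈ Ioo 0 R.T := ⟨(hx 0 trivial).1, (hx 0 trivial).2.trans_le ht.2⟩
    by_cases hd : x ∈ C.dom
    · obtain ⟨h1, h2⟩ := C.sum_fderiv_sqrt_gram_mul_comp hF hR hξ hT hd hx0
      have hev : ∀ i, f i =ᶠ[𝓝 x] fun x' => Real.sqrt (C.gram F x') * C.comp ξ i x' := by
        intro i
        filter_upwards [C.isOpen_dom.mem_nhds hd] with x' hx'
        exact indicator_of_mem hx' _
      refine ⟨fun i => (h1 i).congr_of_eventuallyEq (hev i), ?_⟩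
      rw [Finset.sum_congr rfl fun i _ => by rw [(hev i).fderiv_eq], h2, integrand, extend,
        indicator_of_mem hd]
    · have hxK : x ∉ C.coordImage K := fun h => hd (C.coordImage_subset_dom hKs h)
      have hev : ∀ i, f i =ᶠ[𝓝 x] fun _ => 0 := by
        intro i
        have h3 : ∀ᶠ x' in 𝓝 x, x' 0 ∈ Ioo 0 R.T :=
          (continuous_apply 0).continuousAt (isOpen_Ioo.mem_nhds hx0)
        filter_upwards [(C.isCompact_coordImage hK hKs).isClosed.isOpen_compl.mem_nhds hxK, h3]
          with x' h1 h2
        exact hfzero i x' ⟨h2.1.le, h2.2.le⟩ h1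
      refine ⟨fun i => (differentiableAt_const (0 : ℝ)).congr_of_eventuallyEq (hev i), ?_⟩
      rw [Finset.sum_congr rfl fun i _ => by rw [(hev i).fderiv_eq], integrand, extend,
        indicator_of_notMem hd]
      simp
  have hae : (pi univ fun i => Ioo (a i) (b i)) =ᵐ[volume] Icc a b :=
    Measure.univ_pi_Ioo_ae_eq_Icc
  have hmI : MeasurableSet (pi univ fun i => Ioo (a i) (b i)) :=
    MeasurableSet.univ_pi fun i => measurableSet_Ioo
  have hintD : IntegrableOn (C.integrand F (R.lateralDiv F ξ)) (Icc a b) :=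
    ((C.integrand_continuousOn hF hR hK hKs (hR.lateralDiv_continuousOn hF hξ) hdiv0).mono
      hbox).integrableOn_Icc
  have hHi : IntegrableOn (fun x => ∑ i, fderiv ℝ (f i) x (Pi.single i 1)) (Icc a b) := by
    refine IntegrableOn.congr_set_ae ?_ hae.symm
    exact (hintD.congr_set_ae hae).congr_fun (fun x hx => (hinner x hx).2.symm) hmI
  have hmain := integral_divergence_of_hasFDerivAt_off_countable' a b hle f
    (fun i => fderiv ℝ (f i)) ∅ countable_empty (fun i => (hfc i).mono hbox)
    (fun x hx i => ((hinner x hx.1).1 i).hasFDerivAt) hHi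
  rw [← setIntegral_congr_set hae, setIntegral_congr_fun hmI fun x hx => (hinner x hx).2,
    setIntegral_congr_set hae] at hmain
  rw [hmain, Fin.sum_univ_succ]
  -- the components vanish on the lateral faces of the box, which lie outside the support
  have hface : ∀ (A : Fin 2) (c : ℝ), |c| = r →
      ∀ x ∈ Icc (a ∘ A.succ.succAbove) (b ∘ A.succ.succAbove),
        f A.succ (A.succ.insertNth c x) = 0 := by
    intro A c hc x hx
    refine hfzero _ _ ?_ fun h => ?_
    · have h1 : (A.succ.insertNth c x : Fin 3 → ℝ) 0 = x 0 := by
        have := Fin.insertNth_apply_succAbove (α := fun _ => ℝ) A.succ c x 0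
        rwa [Fin.succ_succAbove_zero] at this
      change (A.succ.insertNth c x : Fin 3 → ℝ) 0 ∈ Icc 0 R.T
      rw [h1]
      have h2 := hx.1 0
      have h3 := hx.2 0
      simp only [Function.comp_apply, Fin.succ_succAbove_zero, ha, hb, cons3_zero] at h2 h3
      exact ⟨h2, h3.trans ht.2⟩
    · have := hr _ h A
      rw [Fin.insertNth_apply_same, hc] at this
      exact lt_irrefl _ this
  have hfaces : ∀ A : Fin 2,
      (∫ x in Icc (a ∘ A.succ.succAbove) (b ∘ A.succ.succAbove),
        f A.succ (A.succ.insertNth (b A.succ) x))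
      - ∫ x in Icc (a ∘ A.succ.succAbove) (b ∘ A.succ.succAbove),
        f A.succ (A.succ.insertNth (a A.succ) x) = 0 := by
    intro A
    rw [setIntegral_eq_zero_of_forall_eq_zero (hface A _ ?_),
      setIntegral_eq_zero_of_forall_eq_zero (hface A _ ?_), sub_zero]
    · simp only [ha, cons3_succ, abs_neg, abs_of_pos hr0]
    · simp only [hb, cons3_succ, abs_of_pos hr0]
  rw [Finset.sum_eq_zero fun A _ => hfaces A, add_zero, hf0]
  have hia : a ∘ Fin.succAbove 0 = fun _ : Fin 2 => -r := by
    funext i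
    simp [ha]
  have hib : b ∘ Fin.succAbove 0 = fun _ : Fin 2 => r := by
    funext i
    simp [hb]
  have hins : ∀ (s : ℝ) (y : Fin 2 → ℝ), (Fin.insertNth 0 s y : Fin 3 → ℝ) = cons3 s y := by
    intro s y
    simp [cons3]
  rw [hia, hib]
  simp only [hins]
  rfl

end LatChart

/-! ### The divergence theorem and the integral identity -/

namespace Region.IsAdmissible

variable {R : Region} {F : Fluid} (hF : F.IsEulerSolution R.ambient R.region)
  (hR : R.IsAdmissible F)
include hR

open scoped Manifold in
/-- A finite smooth partition of unity along the compact lateral boundary, subordinate to adapted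
charts. -/
lemma exists_partition : ∃ (ι : Type) (_ : Fintype ι) (C : ι → LatChart R) (ρ : ι → ST → ℝ)
    (K : ι → Set ST), (∀ i, ContDiff ℝ ∞ (ρ i)) ∧ (∀ i, IsCompact (K i)) ∧
      (∀ i, K i ⊆ (C i).chart.source) ∧ (∀ i, ∀ p ∈ R.lateral, p ∉ K i → ρ i p = 0) ∧
      ∀ p ∈ R.lateral, ∑ i, ρ i p = 1 := by
  have hex : ∀ q : R.lateral, ∃ C : LatChart R, (q : ST) ∈ C.chart.source := fun q =>
    hR.exists_latChart q.2
  choose C hC using hex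
  obtain ⟨s, hs⟩ := hR.isCompact_lateral.elim_finite_subcover (fun q => (C q).chart.source)
    (fun q => (C q).chart.open_source) fun q hq => mem_iUnion.2 ⟨⟨q, hq⟩, hC ⟨q, hq⟩⟩
  obtain ⟨f, hf⟩ := SmoothPartitionOfUnity.exists_isSubordinate 𝓘(ℝ, ST)
    hR.isCompact_lateral.isClosed (fun q : s => (C q).chart.source)
    (fun q => (C q).chart.open_source) (by
      intro q hq
      obtain ⟨i, hi, hqi⟩ := mem_iUnion₂.1 (hs hq)
      exact mem_iUnion.2 ⟨⟨i, hi⟩, hqi⟩)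
  refine ⟨s, inferInstance, fun i => C i, fun i => f i, fun i => R.lateral ∩ tsupport (f i),
    fun i => (f i).contMDiff.contDiff, fun i => hR.isCompact_lateral.inter_right
      (isClosed_tsupport _), fun i p hp => hf i hp.2, fun i p hp hpK => ?_, fun p hp => ?_⟩
  · by_contra h
    exact hpK ⟨hp, subset_tsupport _ h⟩
  · rw [← f.sum_eq_one hp, finsum_eq_sum_of_fintype]

include hF

lemma sphere_integrable {f : ST → ℝ} (hf : ContinuousOn f R.lateral) {t : ℝ}
    (ht : t ∈ Icc 0 R.T) : Integrable f (R.sphereMeasure F t) := by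
  obtain ⟨ι, _, C, ρ, K, hρ, hK, hKs, h0, h1⟩ := hR.exists_partition
  have h : ∀ i, Integrable (fun p => ρ i p * f p) (R.sphereMeasure F t) := by
    intro i
    obtain ⟨r, -, hr⟩ := (C i).exists_radius (hK i) (hKs i)
    exact ((C i).sphereIntegral_eq hF hR (hK i) (hKs i) ((hρ i).continuous.continuousOn.mul hf)
      (fun p hp hpK => by
        change ρ i p * f p = 0
        rw [h0 i p hp hpK, zero_mul]) ht fun x hx A => (hr x hx A).le).1
  refine hR.sphere_integrable_congr ?_ (integrable_finsetSum Finset.univ fun i _ => h i)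
  intro p hp
  simp only [← Finset.sum_mul, h1 p hp, one_mul]

lemma sphereIntegral_sum {ι : Type*} [Fintype ι] {f : ι → ST → ℝ}
    (hf : ∀ i, ContinuousOn (f i) R.lateral) {t : ℝ} (ht : t ∈ Icc 0 R.T) :
    R.sphereIntegral F t (fun p => ∑ i, f i p) = ∑ i, R.sphereIntegral F t (f i) :=
  integral_finsetSum _ fun i _ => hR.sphere_integrable hF (hf i) ht

lemma intervalIntegrable_sphereIntegral {f : ST → ℝ} (hf : ContinuousOn f R.lateral) {t : ℝ}
    (ht : t ∈ Icc 0 R.T) :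
    IntervalIntegrable (fun s => R.sphereIntegral F s f) volume 0 t := by
  obtain ⟨ι, _, C, ρ, K, hρ, hK, hKs, h0, h1⟩ := hR.exists_partition
  have hc : ∀ i, ContinuousOn (fun p => ρ i p * f p) R.lateral := fun i =>
    (hρ i).continuous.continuousOn.mul hf
  have h : ∀ i, IntervalIntegrable (fun s => R.sphereIntegral F s fun p => ρ i p * f p)
      volume 0 t := by
    intro i
    obtain ⟨r, -, hr⟩ := (C i).exists_radius (hK i) (hKs i)
    exact ((C i).intervalIntegrable_sphereIntegral hF hR (hK i) (hKs i) (hc i)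
      (fun p hp hpK => by rw [h0 i p hp hpK, zero_mul]) ht hr).1
  refine (IntervalIntegrable.sum Finset.univ fun i _ => h i).congr_uIoo ?_
  intro s hs
  rw [uIoo_of_le ht.1] at hs
  rw [Finset.sum_apply, ← hR.sphereIntegral_sum hF hc ⟨hs.1.le, hs.2.le.trans ht.2⟩]
  refine hR.sphereIntegral_congr ?_ s
  intro p hp
  simp only [← Finset.sum_mul, h1 p hp, one_mul]

lemma lateralIntegrable {f : ST → ℝ} (hf : ContinuousOn f R.lateral) {t : ℝ}
    (ht : t ∈ Icc 0 R.T) : R.LateralIntegrable F t f :=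
  ⟨fun _ hs => hR.sphere_integrable hF hf ⟨hs.1, hs.2.trans ht.2⟩,
    hR.intervalIntegrable_sphereIntegral hF hf ht⟩

omit hF in
lemma lateralIntegral_congr {f f' : ST → ℝ} (h : EqOn f f' R.lateral) (t : ℝ) :
    R.lateralIntegral F t f = R.lateralIntegral F t f' :=
  intervalIntegral.integral_congr fun s _ => hR.sphereIntegral_congr h s

lemma lateralIntegral_add {f f' : ST → ℝ} (hf : ContinuousOn f R.lateral)
    (hf' : ContinuousOn f' R.lateral) {t : ℝ} (ht : t ∈ Icc 0 R.T) :
    R.lateralIntegral F t (fun p => f p + f' p)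
      = R.lateralIntegral F t f + R.lateralIntegral F t f' := by
  unfold lateralIntegral
  rw [← intervalIntegral.integral_add (hR.intervalIntegrable_sphereIntegral hF hf ht)
    (hR.intervalIntegrable_sphereIntegral hF hf' ht)]
  refine intervalIntegral.integral_congr fun s hs => ?_
  rw [uIcc_of_le ht.1] at hs
  have hs' : s ∈ Icc 0 R.T := ⟨hs.1, hs.2.trans ht.2⟩
  exact integral_add (hR.sphere_integrable hF hf hs') (hR.sphere_integrable hF hf' hs')

/-- The divergence theorem on the lateral boundary. -/
theorem lateralIntegral_lateralDiv {ξ : ST → ST} (hξ : ContDiffOn ℝ ∞ ξ R.lateral)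
    (hT : ∀ p ∈ R.lateral, ξ p ∈ tangentSpaceAt R.lateral p) {t : ℝ} (ht : t ∈ Icc 0 R.T) :
    R.lateralIntegral F t (R.lateralDiv F ξ)
      = R.sphereIntegral F t (fun p => fderiv ℝ R.tau p (ξ p))
        - R.sphereIntegral F 0 (fun p => fderiv ℝ R.tau p (ξ p)) := by
  obtain ⟨ι, _, C, ρ, K, hρ, hK, hKs, h0, h1⟩ := hR.exists_partition
  have hT0 : (0 : ℝ) ∈ Icc 0 R.T := ⟨le_rfl, hR.T_pos.le⟩
  set ζ : ι → ST → ST := fun i p => ρ i p • ξ p with hζ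
  have hζc : ∀ i, ContDiffOn ℝ ∞ (ζ i) R.lateral := fun i => (hρ i).contDiffOn.smul hξ
  have hζT : ∀ i, ∀ p ∈ R.lateral, ζ i p ∈ tangentSpaceAt R.lateral p := fun i p hp =>
    Submodule.smul_mem _ _ (hT p hp)
  have hloc := fun i => (C i).integral_lateralDiv hF hR (hK i) (hKs i) (hζc i) (hζT i)
    (fun p hp hpK => by simp only [hζ, h0 i p hp hpK, zero_smul]) ht
  have hsum : EqOn ξ (fun p => ∑ i, ζ i p) R.lateral := fun p hp => by
    simp only [hζ, ← Finset.sum_smul, h1 p hp, one_smul]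
  have hdc : ∀ i, ContinuousOn (R.lateralDiv F (ζ i)) R.lateral := fun i =>
    hR.lateralDiv_continuousOn hF (hζc i)
  have hleft : R.lateralIntegral F t (R.lateralDiv F ξ)
      = ∑ i, ∫ s in (0 : ℝ)..t, R.sphereIntegral F s (R.lateralDiv F (ζ i)) := by
    rw [← intervalIntegral.integral_finsetSum fun i _ =>
      hR.intervalIntegrable_sphereIntegral hF (hdc i) ht]
    refine intervalIntegral.integral_congr fun s hs => ?_
    rw [uIcc_of_le ht.1] at hs
    rw [← hR.sphereIntegral_sum hF hdc ⟨hs.1, hs.2.trans ht.2⟩]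
    refine hR.sphereIntegral_congr (fun p hp => ?_) s
    rw [hR.lateralDiv_congr hF hsum hp, hR.lateralDiv_sum hF _ hζc hp]
  have hright : ∀ s ∈ Icc 0 R.T, R.sphereIntegral F s (fun p => fderiv ℝ R.tau p (ξ p))
      = ∑ i, R.sphereIntegral F s (fun p => fderiv ℝ R.tau p (ζ i p)) := by
    intro s hs
    rw [← hR.sphereIntegral_sum hF (fun i => (hR.fderiv_tau_contDiffOn (hζc i)).continuousOn) hs]
    refine hR.sphereIntegral_congr (fun p hp => ?_) s
    rw [hsum hp, map_sum]
  rw [hleft, hright t ht, hright 0 hT0, ← Finset.sum_sub_distrib]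
  exact Finset.sum_congr rfl fun i _ => hloc i

/-- The integral identity for a vector field whose specific error integrand is determined by the
exterior derivative of its metric dual. -/
theorem boundaryIdentity {V : ST → ST} (hV : ∀ p ∈ R.lateral, ContDiffAt ℝ ∞ V p)
    (hV0 : ∀ p, V p 0 = 0) {W : ST → ℝ} (hW : ContDiffOn ℝ ∞ W R.lateral) {errV : ST → ℝ}
    (herr : ∀ q ∈ R.lateral,
      errV q = -2 * R.z F q * dLower F V q (R.tang F q (V q)) (R.E F q))
    {t : ℝ} (ht : t ∈ Icc 0 R.T) : BoundaryIdentity R F W V errV t := by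
  have hT0 : (0 : ℝ) ∈ Icc 0 R.T := ⟨le_rfl, hR.T_pos.le⟩
  have hV' : ContDiffOn ℝ ∞ V R.lateral := fun p hp => (hV p hp).contDiffWithinAt
  have hξ : ContDiffOn ℝ ∞ (fun p => W p • R.flux F V p) R.lateral :=
    hW.smul (hR.flux_contDiffOn hF hV')
  have hξT : ∀ p ∈ R.lateral, W p • R.flux F V p ∈ tangentSpaceAt R.lateral p := fun p hp =>
    Submodule.smul_mem _ _ (hR.flux_tangent hF hp V)
  have hτ : EqOn (fun p => fderiv ℝ R.tau p (W p • R.flux F V p))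
      (fun p => W p * R.sphereDensity F V p) R.lateral := by
    intro p hp
    simp only [map_smul, smul_eq_mul, hR.fderiv_tau_flux hF hp]
  have hcl : ContinuousOn (fun q => W q * R.ZJ F V q) R.lateral :=
    hW.continuousOn.mul (hR.ZJ_continuousOn hF hV)
  have hdc : ContinuousOn (R.lateralDiv F fun p => W p • R.flux F V p) R.lateral :=
    hR.lateralDiv_continuousOn hF hξ
  have hpt : EqOn (fun q => R.errWeight F W V q + W q * R.errCommon F V q + W q * errV q)
      (fun q => W q * R.ZJ F V q + R.lateralDiv F (fun p => W p • R.flux F V p) q) R.lateral :=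
    fun q hq => hR.errors_eq_lateralDiv hF hq hV hV0 hW (herr q hq)
  have hds : ContinuousOn (fun q => W q * R.sphereDensity F V q) R.lateral :=
    hW.continuousOn.mul (hR.sphereDensity_contDiffOn hF hV').continuousOn
  refine ⟨hR.lateralIntegrable hF hcl ht, hR.lateralIntegrable hF
    ((hcl.add hdc).congr hpt) ht, hR.sphere_integrable hF hds ht,
    hR.sphere_integrable hF hds hT0, ?_⟩
  rw [hR.lateralIntegral_congr hpt, hR.lateralIntegral_add hF hcl hdc ht,
    hR.lateralIntegral_lateralDiv hF hξ hξT ht, hR.sphereIntegral_congr hτ,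
    hR.sphereIntegral_congr hτ]
  ring

end Region.IsAdmissible

/-! ### Differentiating identities that hold on the region -/

section

variable {R : Region} {F : Fluid} {q : ST}

/-- The region has enough tangent directions at points of the lateral boundary: in a chart it is
the convex set `u ≤ 0`, `0 ≤ tau ≤ T`, which has interior points. -/
lemma Region.IsAdmissible.uniqueDiffWithinAt_region (hR : R.IsAdmissible F) (hq : q ∈ R.lateral) :
    UniqueDiffWithinAt ℝ R.region q := by
  obtain ⟨C, hC⟩ := hR.exists_latChart hq
  set s : Set (Fin 4 → ℝ) := {y | y 0 ≤ 0 ∧ y 1 ∈ Icc 0 R.T} with hs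
  have hconv : Convex ℝ s := by
    have h0 : Convex ℝ {y : Fin 4 → ℝ | y 0 ≤ 0} :=
      (convex_Iic (0 : ℝ)).linear_preimage (LinearMap.proj 0 : (Fin 4 → ℝ) →ₗ[ℝ] ℝ)
    have h1 : Convex ℝ {y : Fin 4 → ℝ | y 1 ∈ Icc 0 R.T} :=
      (convex_Icc (0 : ℝ) R.T).linear_preimage (LinearMap.proj 1 : (Fin 4 → ℝ) →ₗ[ℝ] ℝ)
    exact h0.inter h1
  have hint : (interior s).Nonempty := by
    refine ⟨![-1, R.T / 2, 0, 0], mem_interior.2 ⟨{y | y 0 < 0 ∧ y 1 ∈ Ioo 0 R.T}, ?_, ?_, ?_⟩⟩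
    · exact fun y hy => ⟨hy.1.le, hy.2.1.le, hy.2.2.le⟩
    · exact (isOpen_Iio.preimage (continuous_apply 0)).inter
        (isOpen_Ioo.preimage (continuous_apply 1))
    · have := hR.T_pos
      refine ⟨by simp, ?_, ?_⟩ <;> simp <;> linarith
  have hmem : C.chart q ∈ s := by
    have h := (C.lateral_iff q hC).1 hq
    refine ⟨h.1.le, ?_⟩
    rw [C.chart_one]
    exact h.2
  have h1 : UniqueDiffWithinAt ℝ (s ∩ C.chart.target) (C.chart q) :=
    (uniqueDiffOn_convex hconv hint _ hmem).inter
      (C.chart.open_target.mem_nhds (C.chart.map_source hC))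
  have h2 := (C.symm_hasFDerivAt (C.chart.map_source hC)).hasFDerivWithinAt
    (s := s ∩ C.chart.target)
  have h3 := h2.uniqueDiffWithinAt h1
    (Function.Surjective.denseRange fun X => ⟨_, C.fderiv_symm_fderiv hC X⟩)
  rw [C.chart.left_inv hC] at h3
  refine h3.mono ?_
  rintro p ⟨y, ⟨hy, hyt⟩, rfl⟩
  rw [C.region_iff _ (C.chart.map_target hyt), ← C.chart_one, C.chart.right_inv hyt]
  exact hy

/-- Identities that hold on the region may be differentiated in all directions. -/
lemma Region.IsAdmissible.fderiv_eq_of_eqOn (hR : R.IsAdmissible F) (hq : q ∈ R.lateral)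
    {f f' : ST → ℝ} (hf : DifferentiableAt ℝ f q) (hf' : DifferentiableAt ℝ f' q)
    (h : EqOn f f' R.region) (X : ST) : fderiv ℝ f q X = fderiv ℝ f' q X := by
  have h1 := hf.hasFDerivAt.hasFDerivWithinAt (s := R.region)
  have h2 := hf'.hasFDerivAt.hasFDerivWithinAt (s := R.region)
  rw [(hR.uniqueDiffWithinAt_region hq).eq (h1.congr (fun p hp => (h hp).symm)
    (h (hR.lateral_subset hq)).symm) h2]

end

/-! ### The exterior derivative of the metric dual of a spatial vector field -/

namespace Fluid

/-- The components `θ^a(X) = X^a - v^a X^0` of `X - X^0 B`. -/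
def rel (F : Fluid) (q X : ST) (a : Fin 3) : ℝ := X a.succ - F.vel q a * X 0

variable {F : Fluid} {q : ST}

lemma eq_add_spatial_rel (X : ST) : X = X 0 • F.B q + spatial (F.rel q X) := by
  funext α
  refine Fin.cases ?_ (fun a => ?_) α
  · simp
  · simp [rel]
    ring

lemma spatial_eq_sum (w : Fin 3 → ℝ) : spatial w = ∑ a : Fin 3, w a • coordVec a.succ := by
  funext α
  refine Fin.cases ?_ (fun a => ?_) α
  · simp [coordVec_apply, eq_comm (a := (0 : Fin 4))]
  · simp [coordVec_apply]

lemma map_eq_rel {G : Type*} [AddCommGroup G] [Module ℝ G] [TopologicalSpace G] (L : ST →L[ℝ] G)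
    (X : ST) : L X = X 0 • L (F.B q) + ∑ a : Fin 3, F.rel q X a • L (coordVec a.succ) := by
  conv_lhs => rw [eq_add_spatial_rel (F := F) (q := q) X, spatial_eq_sum]
  simp [map_sum]

lemma g_of_spatial {V : ST} (hV : V 0 = 0) (X : ST) :
    F.g q V X = (F.c q ^ 2)⁻¹ * ∑ a : Fin 3, V a.succ * F.rel q X a := by
  simp [g, hV, rel]

lemma rel_eq_sum (X : ST) (a : Fin 3) : F.rel q X a = ∑ β, F.rel q (coordVec β) a * X β := by
  simp only [rel, sub_mul, Finset.sum_sub_distrib, coordVec_apply, Fin.sum_univ_four]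
  fin_cases a <;> simp

lemma IsEulerSolution.fderiv_c_sq_inv {O M : Set ST} (hF : F.IsEulerSolution O M) (hO : IsOpen O)
    (hq : q ∈ F.goodSet O) :
    DifferentiableAt ℝ (fun p => (F.c p ^ 2)⁻¹) q ∧ ∀ X, fderiv ℝ (fun p => (F.c p ^ 2)⁻¹) q X
      = -2 * (F.c q ^ 2)⁻¹ * Region.dLogC F q X := by
  have hc := (c_pos_of_mem hq).ne'
  have h1 := ((hF.c_contDiffAt hO hq).differentiableAt (by simp)).hasFDerivAt
  have h2 := (hasDerivAt_inv (pow_ne_zero 2 hc)).comp_hasFDerivAt q (h1.pow 2)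
  have h3 : HasFDerivAt (fun p => (F.c p ^ 2)⁻¹) _ q := h2
  refine ⟨h3.differentiableAt, fun X => ?_⟩
  rw [h3.fderiv, Region.dLogC, (h1.log hc).fderiv]
  simp
  field_simp

/-- The exterior derivative of `V_♭ = c^{-2} V^a (dx^a - v^a dt)` for a vector field with vanishing time
component. -/
lemma IsEulerSolution.dLower_eq {O M : Set ST} (hF : F.IsEulerSolution O M) (hO : IsOpen O)
    (hq : q ∈ F.goodSet O) {V : ST → ST} (hV0 : ∀ p, V p 0 = 0) (hV : DifferentiableAt ℝ V q)
    (X Y : ST) : Region.dLower F V q X Y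
      = -2 * (Region.dLogC F q X * F.g q (V q) Y - Region.dLogC F q Y * F.g q (V q) X)
        + (F.c q ^ 2)⁻¹ * (∑ a : Fin 3, (fderiv ℝ V q X a.succ * F.rel q Y a
            - fderiv ℝ V q Y a.succ * F.rel q X a)
          + ∑ a : Fin 3, V q a.succ * (fderiv ℝ F.vel q Y a * X 0 - fderiv ℝ F.vel q X a * Y 0)) := by
  obtain ⟨hm, hm'⟩ := hF.fderiv_c_sq_inv hO hq
  have hv := ((hF.vel_contDiffAt hO hq.1).differentiableAt (by simp)).hasFDerivAt
  have hva := fun a : Fin 3 => hasFDerivAt_pi'.1 hv a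
  have hVa := fun a : Fin 3 => hasFDerivAt_pi'.1 hV.hasFDerivAt a.succ
  have hlow : ∀ β, (fun p => F.lower p (V p) β) = fun p => (F.c p ^ 2)⁻¹ * ∑ a : Fin 3,
      V p a.succ * (coordVec β a.succ - F.vel p a * coordVec β 0) := fun β => by
    funext p
    rw [lower, g_of_spatial (hV0 p)]
    rfl
  have hder : ∀ β X, fderiv ℝ (fun p => F.lower p (V p) β) q X
      = -2 * Region.dLogC F q X * F.lower q (V q) β + (F.c q ^ 2)⁻¹ * ∑ a : Fin 3,
        (fderiv ℝ V q X a.succ * F.rel q (coordVec β) a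
          - V q a.succ * fderiv ℝ F.vel q X a * coordVec β 0) := by
    intro β X
    have h1 := hm.hasFDerivAt.fun_mul (HasFDerivAt.fun_sum (u := Finset.univ) fun a _ =>
      (hVa a).fun_mul (((hva a).mul_const (coordVec β 0)).const_sub (coordVec β a.succ)))
    rw [hlow, h1.fderiv, lower, g_of_spatial (hV0 q)]
    simp only [add_apply, smul_apply, smul_eq_mul, hm', neg_apply,
      ContinuousLinearMap.comp_apply, ContinuousLinearMap.proj_apply, Fin.sum_univ_three, rel]
    ring
  simp only [Region.dLower, hder]
  have hlowY : ∀ Y, F.g q (V q) Y = ∑ β, F.lower q (V q) β * Y β := fun Y => F.g_eq_sum_lower _ _ _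
  have h0 : ∀ Y : ST, Y 0 = ∑ β, coordVec β 0 * Y β := by
    intro Y
    simp [coordVec_apply]
  rw [hlowY Y, hlowY X]
  simp only [rel_eq_sum (F := F) (q := q) X, rel_eq_sum (F := F) (q := q) Y]
  rw [h0 X, h0 Y]
  simp only [Fin.sum_univ_three, Fin.sum_univ_four]
  ring

end Fluid

/-! ### The entropy gradient -/

namespace Region.IsAdmissible

variable {R : Region} {F : Fluid} {q : ST}
variable (hF : F.IsEulerSolution R.ambient R.region) (hR : R.IsAdmissible F)
include hF hR

lemma fderiv_S (hq : q ∈ R.region) (X : ST) (a : Fin 3) :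
    fderiv ℝ F.S q X a.succ = fderiv ℝ (fderiv ℝ F.ent) q X (coordVec a.succ) := by
  have hqa := hR.region_subset hq
  have h1 := ((hF.S_contDiffAt hR.ambient_open hqa).differentiableAt (by simp)).hasFDerivAt
  have h2 := hasFDerivAt_pi'.1 h1 a.succ
  have h3 := ((hF.ent_contDiffAt hR.ambient_open hqa).fderiv_right (m := ∞)
    (by simp)).differentiableAt (by simp)
  have h4 := h3.hasFDerivAt.clm_apply (hasFDerivAt_const (coordVec a.succ : ST) q)
  have h5 := congrArg (fun L => L X) (h2.unique h4)
  simpa using h5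

omit hF hR in
lemma fderiv_B {O M : Set ST} (hF : F.IsEulerSolution O M) (hO : IsOpen O) (hq : q ∈ O) (X : ST) :
    DifferentiableAt ℝ F.B q ∧ fderiv ℝ F.B q X = spatial (fderiv ℝ F.vel q X) := by
  have h1 := (hF.B_contDiffAt hO hq).differentiableAt (by simp)
  refine ⟨h1, ?_⟩
  have hv := ((hF.vel_contDiffAt hO hq).differentiableAt (by simp)).hasFDerivAt
  funext α
  have h2 := hasFDerivAt_pi'.1 h1.hasFDerivAt α
  refine Fin.cases ?_ (fun a => ?_) α
  · have h3 := hasFDerivAt_pi'.1 h1.hasFDerivAt 0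
    have := congrArg (fun L => L X) (h3.unique (hasFDerivAt_const (1 : ℝ) q))
    simpa using this
  · have h3 := hasFDerivAt_pi'.1 h1.hasFDerivAt a.succ
    have := congrArg (fun L => L X) (h3.unique (hasFDerivAt_pi'.1 hv a))
    simpa using this

/-- The derivative of the equation `B s = 0`. -/
lemma fderiv_entropy (hq : q ∈ R.lateral) (X : ST) :
    fderiv ℝ (fderiv ℝ F.ent) q X (F.B q) = -∑ a : Fin 3, F.S q a.succ * fderiv ℝ F.vel q X a := by
  have hqr := hR.lateral_subset hq
  have hqa := hR.region_subset hqr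
  obtain ⟨hB, -⟩ := fderiv_B hF hR.ambient_open hqa X
  have h3 := ((hF.ent_contDiffAt hR.ambient_open hqa).fderiv_right (m := ∞)
    (by simp)).differentiableAt (by simp)
  have h4 := h3.hasFDerivAt.clm_apply hB.hasFDerivAt
  have h5 := hR.fderiv_eq_of_eqOn hq h4.differentiableAt (differentiableAt_const (0 : ℝ))
    (fun p hp => hF.entropy p hp) X
  rw [h4.fderiv] at h5
  simp only [add_apply, ContinuousLinearMap.comp_apply, ContinuousLinearMap.flip_apply,
    (fderiv_B hF hR.ambient_open hqa X).2, fderiv_fun_const, Pi.zero_apply, zero_apply] at h5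
  rw [Fluid.spatial_eq_sum, map_sum] at h5
  have h6 : ∑ a : Fin 3, fderiv ℝ F.ent q (fderiv ℝ F.vel q X a • coordVec a.succ)
      = ∑ a : Fin 3, F.S q a.succ * fderiv ℝ F.vel q X a :=
    Finset.sum_congr rfl fun a _ => by
      rw [map_smul, smul_eq_mul, mul_comm]
      rfl
  rw [h6] at h5
  linarith

/-- The entropy gradient satisfies `d(S_♭) = -2 d(ln c) ∧ S_♭`, because `S_♭ = c^{-2} ds`. -/
lemma errEnt_eq (hq : q ∈ R.lateral) :
    R.errEnt F q = -2 * R.z F q * dLower F F.S q (R.tang F q (F.S q)) (R.E F q) := by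
  have hqr := hR.lateral_subset hq
  have hqa := hR.region_subset hqr
  rw [hF.dLower_eq hR.ambient_open (hR.mem_goodSet hF hqr) (fun p => F.S_zero p)
    ((hF.S_contDiffAt hR.ambient_open hqa).differentiableAt (by simp))]
  have hsymm : IsSymmSndFDerivAt ℝ F.ent q := (hF.ent_contDiffAt hR.ambient_open hqa).isSymmSndFDerivAt
    (by simpa using WithTop.coe_le_coe.2 (le_top : (2 : ℕ∞) ≤ ⊤))
  set X := R.tang F q (F.S q)
  set Y := R.E F q
  set D := fderiv ℝ (fderiv ℝ F.ent) q
  have hX := Fluid.map_eq_rel (F := F) (q := q) (D Y) X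
  have hY := Fluid.map_eq_rel (F := F) (q := q) (D X) Y
  rw [hR.fderiv_entropy hF hq] at hX hY
  have hXY : D X Y = D Y X := hsymm.eq X Y
  have hzero : ∑ a : Fin 3, (fderiv ℝ F.S q X a.succ * F.rel q Y a
            - fderiv ℝ F.S q Y a.succ * F.rel q X a)
          + ∑ a : Fin 3, F.S q a.succ * (fderiv ℝ F.vel q Y a * X 0 - fderiv ℝ F.vel q X a * Y 0)
      = 0 := by
    simp only [hR.fderiv_S hF hqr]
    simp only [Fin.sum_univ_three, smul_eq_mul] at hX hY ⊢
    linear_combination hX - hY + hXY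
  rw [hzero, errEnt, hR.normSq_eq hF hq]
  ring

end Region.IsAdmissible

/-! ### The transport equation of the specific vorticity -/

namespace Fluid

variable {F : Fluid} {O M : Set ST} {q : ST}

/-- The pressure along the fluid. -/
def press (F : Fluid) (p : ST) : ℝ := F.eosPair (F.dens p, F.ent p)

variable (hF : F.IsEulerSolution O M) (hO : IsOpen O)
include hF hO

lemma IsEulerSolution.fderiv_rho (hq : q ∈ F.goodSet O) (X : ST) :
    fderiv ℝ F.rho q X = fderiv ℝ F.dens q X / F.dens q := by
  have h1 := ((hF.dens_contDiffAt hO hq.1).differentiableAt (by simp)).hasFDerivAt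
  have hb := hF.densBar_pos.ne'
  have hd := hq.2.1.ne'
  have h2 := (h1.mul_const F.densBar⁻¹).log (mul_ne_zero hd (inv_ne_zero hb))
  have h3 : F.rho = fun p => Real.log (F.dens p * F.densBar⁻¹) := by
    funext p
    rw [rho, div_eq_mul_inv]
  rw [h3, h2.fderiv]
  simp only [smul_apply, smul_eq_mul]
  field_simp

omit hO in
lemma IsEulerSolution.exp_neg_rho (hq : q ∈ F.goodSet O) :
    Real.exp (-F.rho q) = F.densBar / F.dens q := by
  rw [Real.exp_neg, rho, Real.exp_log (div_pos hq.2.1 hF.densBar_pos), inv_div]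

lemma IsEulerSolution.press_contDiffAt (hq : q ∈ F.goodSet O) : ContDiffAt ℝ ∞ F.press q :=
  ContDiffAt.comp q (hF.eosPair_contDiffAt (x := (F.dens q, F.ent q)) hq.2.1)
    ((hF.dens_contDiffAt hO hq.1).prodMk (hF.ent_contDiffAt hO hq.1))

lemma IsEulerSolution.fderiv_press (hq : q ∈ F.goodSet O) (X : ST) :
    fderiv ℝ F.press q X = F.c q ^ 2 * fderiv ℝ F.dens q X
      + F.densBar * F.pEntBar q * fderiv ℝ F.ent q X := by
  have h1 := ((hF.dens_contDiffAt hO hq.1).differentiableAt (by simp)).hasFDerivAt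
  have h2 := ((hF.ent_contDiffAt hO hq.1).differentiableAt (by simp)).hasFDerivAt
  have h3 := ((hF.eosPair_contDiffAt (x := (F.dens q, F.ent q)) hq.2.1).differentiableAt
    (by simp)).hasFDerivAt
  have h4 : HasFDerivAt F.press _ q := h3.comp q (h1.prodMk h2)
  rw [h4.fderiv, c_sq_of_mem hq, hF.pDens_eq hq.2.1, hF.pEntBar_eq hq.2.1]
  have hb := hF.densBar_pos.ne'
  have h5 : ((fderiv ℝ F.dens q).prod (fderiv ℝ F.ent q)) X
      = fderiv ℝ F.dens q X • ((1, 0) : ℝ × ℝ) + fderiv ℝ F.ent q X • ((0, 1) : ℝ × ℝ) := by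
    simp
  rw [ContinuousLinearMap.comp_apply, h5, map_add, map_smul, map_smul, smul_eq_mul, smul_eq_mul]
  field_simp

/-- The momentum equation in terms of the pressure. -/
lemma IsEulerSolution.momentum_press (hMO : M ⊆ O) (hq : q ∈ M) (i : Fin 3) :
    F.dens q * fderiv ℝ F.vel q (F.B q) i = -fderiv ℝ F.press q (coordVec i.succ) := by
  have hg := hF.mem_goodSet hMO hq
  rw [hF.momentum q hq i, hF.fderiv_press hO hg, hF.fderiv_rho hO hg, hF.exp_neg_rho hg]
  have hd := hg.2.1.ne'
  field_simp
  ring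

lemma IsEulerSolution.fderiv_curl_vel (hq : q ∈ O) (X : ST) :
    (fun i => fderiv ℝ (fun p => curl F.vel p i) q X)
      = ![fderiv ℝ (fderiv ℝ F.vel) q X (coordVec 2) 2 - fderiv ℝ (fderiv ℝ F.vel) q X (coordVec 3) 1,
          fderiv ℝ (fderiv ℝ F.vel) q X (coordVec 3) 0 - fderiv ℝ (fderiv ℝ F.vel) q X (coordVec 1) 2,
          fderiv ℝ (fderiv ℝ F.vel) q X (coordVec 1) 1
            - fderiv ℝ (fderiv ℝ F.vel) q X (coordVec 2) 0] := by
  have h1 := (((hF.vel_contDiffAt hO hq).fderiv_right (m := ∞) (by simp)).differentiableAt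
    (by simp)).hasFDerivAt
  have h2 : ∀ (α : Fin 4) (i : Fin 3), HasFDerivAt (fun p => fderiv ℝ F.vel p (coordVec α) i) _ q :=
    fun α i => hasFDerivAt_pi'.1 (h1.clm_apply (hasFDerivAt_const (coordVec α : ST) q)) i
  funext i
  fin_cases i
  · have h3 : HasFDerivAt (fun p => curl F.vel p 0) _ q := (h2 2 2).fun_sub (h2 3 1)
    change fderiv ℝ (fun p => curl F.vel p 0) q X = _
    rw [h3.fderiv]
    simp
  · have h3 : HasFDerivAt (fun p => curl F.vel p 1) _ q := (h2 3 0).fun_sub (h2 1 2)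
    change fderiv ℝ (fun p => curl F.vel p 1) q X = _
    rw [h3.fderiv]
    simp
  · have h3 : HasFDerivAt (fun p => curl F.vel p 2) _ q := (h2 1 1).fun_sub (h2 2 0)
    change fderiv ℝ (fun p => curl F.vel p 2) q X = _
    rw [h3.fderiv]
    simp

lemma IsEulerSolution.fderiv_Om (hq : q ∈ F.goodSet O) (X : ST) (i : Fin 3) :
    fderiv ℝ F.Om q X i.succ = Real.exp (-F.rho q) * fderiv ℝ (fun p => curl F.vel p i) q X
      - F.Om q i.succ * fderiv ℝ F.rho q X := by
  have h1 := hasFDerivAt_pi'.1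
    ((hF.Om_contDiffAt hO hq).differentiableAt (by simp)).hasFDerivAt i.succ
  have h2 := ((hF.rho_contDiffAt hO hq).differentiableAt (by simp)).hasFDerivAt
  have h3 := ((hF.curl_vel_contDiffAt hO hq.1 i).differentiableAt (by simp)).hasFDerivAt
  have h4 := h3.fun_mul h2.neg.exp
  have h5 : (fun p => F.Om p i.succ) = fun p => curl F.vel p i * Real.exp ((-F.rho) p) := by
    funext p
    change curl F.vel p i / Real.exp (F.rho p) = _
    rw [Pi.neg_apply, Real.exp_neg, div_eq_mul_inv]
  rw [h5] at h1
  have h6 := congrArg (fun L => L X) (h1.unique h4)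
  simp only [ContinuousLinearMap.comp_apply, ContinuousLinearMap.proj_apply, add_apply, smul_apply,
    smul_eq_mul, neg_apply, Pi.neg_apply] at h6
  have h7 := congrFun h5 q
  simp only [Pi.neg_apply] at h7
  rw [h6, h7]
  ring

end Fluid

namespace Region.IsAdmissible

variable {R : Region} {F : Fluid} {q : ST}
variable (hF : F.IsEulerSolution R.ambient R.region) (hR : R.IsAdmissible F)
include hF hR

/-- The derivative of the momentum equation. -/
lemma fderiv_momentum (hq : q ∈ R.lateral) (X : ST) (i : Fin 3) :
    fderiv ℝ F.dens q X * fderiv ℝ F.vel q (F.B q) i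
        + F.dens q * (fderiv ℝ (fderiv ℝ F.vel) q X (F.B q) i
          + ∑ a : Fin 3, fderiv ℝ F.vel q X a * fderiv ℝ F.vel q (coordVec a.succ) i)
      = -fderiv ℝ (fderiv ℝ F.press) q X (coordVec i.succ) := by
  have hqr := hR.lateral_subset hq
  have hqa := hR.region_subset hqr
  have hg := hR.mem_goodSet hF hqr
  obtain ⟨hB, hB'⟩ := fderiv_B hF hR.ambient_open hqa X
  have hd := ((hF.dens_contDiffAt hR.ambient_open hqa).differentiableAt (by simp)).hasFDerivAt
  have hD := (((hF.vel_contDiffAt hR.ambient_open hqa).fderiv_right (m := ∞)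
    (by simp)).differentiableAt (by simp)).hasFDerivAt
  have hp := (((hF.press_contDiffAt hR.ambient_open hg).fderiv_right (m := ∞)
    (by simp)).differentiableAt (by simp)).hasFDerivAt
  have h1 := hd.fun_mul (hasFDerivAt_pi'.1 (hD.clm_apply hB.hasFDerivAt) i)
  have h2 := (hp.clm_apply (hasFDerivAt_const (coordVec i.succ : ST) q)).neg
  have h3 := hR.fderiv_eq_of_eqOn hq h1.differentiableAt h2.differentiableAt
    (fun p hp => hF.momentum_press hR.ambient_open hR.region_subset hp i) X
  rw [h1.fderiv, h2.fderiv] at h3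
  simp only [add_apply, smul_apply, ContinuousLinearMap.comp_apply,
    ContinuousLinearMap.proj_apply, ContinuousLinearMap.flip_apply, hB', neg_apply,
    smul_eq_mul, zero_apply, map_zero, Pi.add_apply, zero_add] at h3
  rw [Fluid.spatial_eq_sum, map_sum] at h3
  simp only [map_smul, Finset.sum_apply, Pi.smul_apply, smul_eq_mul] at h3
  rw [← h3]
  ring

/-- The curl of the momentum equation; the pressure drops out by the symmetry of its second
derivatives, except for the derivatives of the density. -/
lemma curl_momentum (hq : q ∈ R.lateral) (i j : Fin 3) :
    fderiv ℝ (fderiv ℝ F.vel) q (coordVec j.succ) (F.B q) i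
        - fderiv ℝ (fderiv ℝ F.vel) q (coordVec i.succ) (F.B q) j
      = -∑ a : Fin 3, (fderiv ℝ F.vel q (coordVec j.succ) a * fderiv ℝ F.vel q (coordVec a.succ) i
          - fderiv ℝ F.vel q (coordVec i.succ) a * fderiv ℝ F.vel q (coordVec a.succ) j)
        + Real.exp (-F.rho q) * F.pEntBar q
          * (fderiv ℝ F.rho q (coordVec j.succ) * F.S q i.succ
            - fderiv ℝ F.rho q (coordVec i.succ) * F.S q j.succ) := by
  have hqr := hR.lateral_subset hq
  have hg := hR.mem_goodSet hF hqr
  have hd := hg.2.1.ne'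
  have h1 := hR.fderiv_momentum hF hq (coordVec j.succ) i
  have h2 := hR.fderiv_momentum hF hq (coordVec i.succ) j
  have hsymm : IsSymmSndFDerivAt ℝ F.press q :=
    (hF.press_contDiffAt hR.ambient_open hg).isSymmSndFDerivAt
      (by simpa using WithTop.coe_le_coe.2 (le_top : (2 : ℕ∞) ≤ ⊤))
  have h3 := hsymm.eq (coordVec i.succ) (coordVec j.succ)
  have h4 := fun k => hF.momentum_press hR.ambient_open hR.region_subset hqr k
  have h5 := fun k : Fin 3 => hF.fderiv_press hR.ambient_open hg (coordVec k.succ)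
  have hS : ∀ k : Fin 3, F.S q k.succ = fderiv ℝ F.ent q (coordVec k.succ) := fun k => rfl
  rw [hF.fderiv_rho hR.ambient_open hg, hF.fderiv_rho hR.ambient_open hg, hF.exp_neg_rho hg, hS, hS,
    Finset.sum_sub_distrib]
  have h6 := h4 i
  have h7 := h4 j
  rw [h5] at h6 h7
  have h8 : fderiv ℝ F.vel q (F.B q) i = -(F.c q ^ 2 * fderiv ℝ F.dens q (coordVec i.succ)
      + F.densBar * F.pEntBar q * fderiv ℝ F.ent q (coordVec i.succ)) / F.dens q := by
    rw [eq_div_iff hd, mul_comm, h6]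
  have h9 : fderiv ℝ F.vel q (F.B q) j = -(F.c q ^ 2 * fderiv ℝ F.dens q (coordVec j.succ)
      + F.densBar * F.pEntBar q * fderiv ℝ F.ent q (coordVec j.succ)) / F.dens q := by
    rw [eq_div_iff hd, mul_comm, h7]
  rw [h8] at h1
  rw [h9] at h2
  refine mul_left_cancel₀ hd ?_
  field_simp at h1 h2 ⊢
  linear_combination h1 - h2 + F.dens q * h3

/-- The transport equation of the specific vorticity. The term `Ω^b ∂_i v^b` equals the more usual
`Ω^b ∂_b v^i`, because `Ω` is parallel to the curl of the velocity. -/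
lemma fderiv_Om_B (hq : q ∈ R.lateral) :
    (fun i : Fin 3 => fderiv ℝ F.Om q (F.B q) i.succ)
      = ![∑ b : Fin 3, F.Om q b.succ * fderiv ℝ F.vel q (coordVec 1) b
            + Real.exp (-2 * F.rho q) * F.pEntBar q
              * (fderiv ℝ F.rho q (coordVec 2) * F.S q 3 - fderiv ℝ F.rho q (coordVec 3) * F.S q 2),
          ∑ b : Fin 3, F.Om q b.succ * fderiv ℝ F.vel q (coordVec 2) b
            + Real.exp (-2 * F.rho q) * F.pEntBar q
              * (fderiv ℝ F.rho q (coordVec 3) * F.S q 1 - fderiv ℝ F.rho q (coordVec 1) * F.S q 3),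
          ∑ b : Fin 3, F.Om q b.succ * fderiv ℝ F.vel q (coordVec 3) b
            + Real.exp (-2 * F.rho q) * F.pEntBar q
              * (fderiv ℝ F.rho q (coordVec 1) * F.S q 2
                - fderiv ℝ F.rho q (coordVec 2) * F.S q 1)] := by
  have hqr := hR.lateral_subset hq
  have hqa := hR.region_subset hqr
  have hg := hR.mem_goodSet hF hqr
  have hsymm : IsSymmSndFDerivAt ℝ F.vel q :=
    (hF.vel_contDiffAt hR.ambient_open hqa).isSymmSndFDerivAt
      (by simpa using WithTop.coe_le_coe.2 (le_top : (2 : ℕ∞) ≤ ⊤))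
  have hc := hF.fderiv_curl_vel hR.ambient_open hqa (F.B q)
  have hc0 := congrFun hc 0
  have hc1 := congrFun hc 1
  have hc2 := congrFun hc 2
  have hcm := hR.curl_momentum hF hq
  have h12 := hcm 2 1
  have h20 := hcm 0 2
  have h01 := hcm 1 0
  have hs : ∀ α, fderiv ℝ (fderiv ℝ F.vel) q (F.B q) (coordVec α)
      = fderiv ℝ (fderiv ℝ F.vel) q (coordVec α) (F.B q) := fun α => hsymm.eq _ _
  have hmass := hF.mass q hqr
  have hO : ∀ i : Fin 3, F.Om q i.succ = Real.exp (-F.rho q) * curl F.vel q i := by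
    intro i
    change curl F.vel q i / Real.exp (F.rho q) = _
    rw [Real.exp_neg]
    ring
  have he : Real.exp (-2 * F.rho q) = Real.exp (-F.rho q) * Real.exp (-F.rho q) := by
    rw [← Real.exp_add]
    ring_nf
  have k0 : curl F.vel q 0 = fderiv ℝ F.vel q (coordVec 2) 2 - fderiv ℝ F.vel q (coordVec 3) 1 := rfl
  have k1 : curl F.vel q 1 = fderiv ℝ F.vel q (coordVec 3) 0 - fderiv ℝ F.vel q (coordVec 1) 2 := rfl
  have k2 : curl F.vel q 2 = fderiv ℝ F.vel q (coordVec 1) 1 - fderiv ℝ F.vel q (coordVec 2) 0 := rfl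
  have d3 : F.divVel q = fderiv ℝ F.vel q (coordVec 1) 0 + fderiv ℝ F.vel q (coordVec 2) 1
      + fderiv ℝ F.vel q (coordVec 3) 2 := by
    rw [Fluid.divVel, Fin.sum_univ_three]
    rfl
  have j0 : (0 : Fin 3).succ = (1 : Fin 4) := rfl
  have j1 : (1 : Fin 3).succ = (2 : Fin 4) := rfl
  have j2 : (2 : Fin 3).succ = (3 : Fin 4) := rfl
  simp only [Matrix.cons_val_zero, Matrix.cons_val_one, Matrix.cons_val, hs] at hc0 hc1 hc2
  simp only [Fin.sum_univ_three, j0, j1, j2] at h12 h20 h01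
  funext i
  rw [hF.fderiv_Om hR.ambient_open hg, hmass, d3, he]
  fin_cases i
  · simp only [Fin.zero_eta, Matrix.cons_val_zero, Fin.sum_univ_three, hO, k0, k1, k2]
    rw [hc0]
    linear_combination Real.exp (-F.rho q) * h12
  · simp only [Fin.mk_one, Matrix.cons_val_one, Matrix.cons_val_zero, Fin.sum_univ_three, hO, k0, k1, k2]
    rw [hc1]
    linear_combination Real.exp (-F.rho q) * h20
  · simp only [Fin.reduceFinMk, Matrix.cons_val, Fin.sum_univ_three, hO, k0, k1, k2]
    rw [hc2]
    linear_combination Real.exp (-F.rho q) * h01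

end Region.IsAdmissible

/-! ### The error integrand of the vorticity -/

/-- The determinant of three vectors of `ℝ³`. -/
def det3 (x y z : Fin 3 → ℝ) : ℝ :=
  x 0 * (y 1 * z 2 - y 2 * z 1) + x 1 * (y 2 * z 0 - y 0 * z 2) + x 2 * (y 0 * z 1 - y 1 * z 0)

namespace Fluid

variable {F : Fluid} {O M : Set ST} {q : ST}

lemma eps4_expand (X Y Z W : ST) : eps4 X Y Z W
    = X 0 * det3 (fun a => Y a.succ) (fun a => Z a.succ) (fun a => W a.succ)
      - Y 0 * det3 (fun a => X a.succ) (fun a => Z a.succ) (fun a => W a.succ)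
      + Z 0 * det3 (fun a => X a.succ) (fun a => Y a.succ) (fun a => W a.succ)
      - W 0 * det3 (fun a => X a.succ) (fun a => Y a.succ) (fun a => Z a.succ) := by
  have j0 : (0 : Fin 3).succ = (1 : Fin 4) := rfl
  have j1 : (1 : Fin 3).succ = (2 : Fin 4) := rfl
  have j2 : (2 : Fin 3).succ = (3 : Fin 4) := rfl
  have e : eps4 X Y Z W = Matrix.det !![X 0, X 1, X 2, X 3; Y 0, Y 1, Y 2, Y 3;
      Z 0, Z 1, Z 2, Z 3; W 0, W 1, W 2, W 3] := by
    rw [eps4]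
    congr 1
    ext i j
    fin_cases i <;> fin_cases j <;> rfl
  rw [e, Matrix.det_succ_row_zero, Fin.sum_univ_four]
  simp only [Matrix.det_fin_three, Matrix.submatrix_apply]
  simp only [det3, j0, j1, j2]
  simp [Fin.succAbove]
  ring

/-- The `ε`-contraction in the components relative to the frame `B, ∂₁, ∂₂, ∂₃`, in which the
antisymmetric symbol has the same components. -/
lemma eps4_eq (F : Fluid) (q : ST) (X Y Z W : ST) : eps4 X Y Z W
    = X 0 * det3 (F.rel q Y) (F.rel q Z) (F.rel q W) - Y 0 * det3 (F.rel q X) (F.rel q Z) (F.rel q W)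
      + Z 0 * det3 (F.rel q X) (F.rel q Y) (F.rel q W)
      - W 0 * det3 (F.rel q X) (F.rel q Y) (F.rel q Z) := by
  rw [eps4_expand]
  simp only [det3, rel]
  ring

lemma rel_B (a : Fin 3) : F.rel q (F.B q) a = 0 := by simp [rel]

lemma rel_of_zero {X : ST} (h : X 0 = 0) (a : Fin 3) : F.rel q X a = X a.succ := by simp [rel, h]

lemma lower_succ (X : ST) (a : Fin 3) : F.lower q X a.succ = (F.c q ^ 2)⁻¹ * F.rel q X a := by
  have h : coordVec a.succ 0 = 0 := by
    simp [coordVec_apply, eq_comm (a := (0 : Fin 4)), Fin.succ_ne_zero]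
  rw [lower, F.g_comm, g_of_spatial h]
  simp [coordVec_apply]

variable (hF : F.IsEulerSolution O M) (hO : IsOpen O)
include hF hO

lemma IsEulerSolution.curl_Om (hq : q ∈ F.goodSet O) :
    curl (fun p j => F.Om p j.succ) q
      = ![fderiv ℝ F.Om q (coordVec 2) 3 - fderiv ℝ F.Om q (coordVec 3) 2,
          fderiv ℝ F.Om q (coordVec 3) 1 - fderiv ℝ F.Om q (coordVec 1) 3,
          fderiv ℝ F.Om q (coordVec 1) 2 - fderiv ℝ F.Om q (coordVec 2) 1] := by
  have h1 := ((hF.Om_contDiffAt hO hq).differentiableAt (by simp)).hasFDerivAt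
  have h2 : HasFDerivAt (fun p (j : Fin 3) => F.Om p j.succ) _ q :=
    hasFDerivAt_pi.2 fun j : Fin 3 => hasFDerivAt_pi'.1 h1 j.succ
  simp only [curl, h2.fderiv]
  rfl

end Fluid

namespace Region.IsAdmissible

variable {R : Region} {F : Fluid} {q : ST}
variable (hF : F.IsEulerSolution R.ambient R.region) (hR : R.IsAdmissible F)
include hF hR

/-- The exterior derivative of the metric dual of the specific vorticity. The derivative along `B`
is computed with the transport equation; the derivatives of the velocity that it contributes equal
those coming from `dv^a ∧ dt`. -/
lemma dLower_Om (hq : q ∈ R.lateral) (X Y : ST) : dLower F F.Om q X Y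
      = -2 * (dLogC F q X * F.g q (F.Om q) Y - dLogC F q Y * F.g q (F.Om q) X)
        + (F.c q ^ 2)⁻¹ * (2 * ∑ a : Fin 3, F.Om q a.succ
              * (fderiv ℝ F.vel q Y a * X 0 - fderiv ℝ F.vel q X a * Y 0)
          + Real.exp (-2 * F.rho q) * F.pEntBar q
            * (X 0 * det3 (F.rel q Y) (fun a => fderiv ℝ F.rho q (coordVec a.succ))
                (fun a => F.S q a.succ)
              - Y 0 * det3 (F.rel q X) (fun a => fderiv ℝ F.rho q (coordVec a.succ))
                (fun a => F.S q a.succ))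
          + det3 (curl (fun p j => F.Om p j.succ) q) (F.rel q X) (F.rel q Y)) := by
  have hqr := hR.lateral_subset hq
  have hqa := hR.region_subset hqr
  have hg := hR.mem_goodSet hF hqr
  rw [hF.dLower_eq hR.ambient_open hg (fun p => F.Om_zero p)
    ((hF.Om_contDiffAt hR.ambient_open hg).differentiableAt (by simp)),
    hF.curl_Om hR.ambient_open hg]
  congr 2
  have hB := hR.fderiv_Om_B hF hq
  have hB0 := congrFun hB 0
  have hB1 := congrFun hB 1
  have hB2 := congrFun hB 2
  have j0 : (0 : Fin 3).succ = (1 : Fin 4) := rfl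
  have j1 : (1 : Fin 3).succ = (2 : Fin 4) := rfl
  have j2 : (2 : Fin 3).succ = (3 : Fin 4) := rfl
  simp only [Matrix.cons_val_zero, Matrix.cons_val_one, Matrix.cons_val, Fin.sum_univ_three,
    j0, j1, j2] at hB0 hB1 hB2
  have hOm : ∀ (X : ST) (i : Fin 4), fderiv ℝ F.Om q X i = X 0 * fderiv ℝ F.Om q (F.B q) i
      + ∑ b : Fin 3, F.rel q X b * fderiv ℝ F.Om q (coordVec b.succ) i := fun X i => by
    conv_lhs => rw [Fluid.map_eq_rel (F := F) (q := q) (fderiv ℝ F.Om q) X]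
    simp
  have hvel : ∀ (X : ST) (i : Fin 3), fderiv ℝ F.vel q X i = X 0 * fderiv ℝ F.vel q (F.B q) i
      + ∑ b : Fin 3, F.rel q X b * fderiv ℝ F.vel q (coordVec b.succ) i := fun X i => by
    conv_lhs => rw [Fluid.map_eq_rel (F := F) (q := q) (fderiv ℝ F.vel q) X]
    simp
  simp only [hOm X, hOm Y, hvel X, hvel Y, Fin.sum_univ_three, det3, j0, j1, j2,
    Matrix.cons_val_zero, Matrix.cons_val_one, Matrix.cons_val, hB0, hB1, hB2]
  ring

omit hF hR in
/-- A linear map applied to `e_a = ∂_a + N̲_a B - P_a H̲`. -/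
lemma e_map {G : Type*} [AddCommGroup G] [Module ℝ G] [TopologicalSpace G]
    (L : ST →L[ℝ] G) (a : Fin 3) : L (R.e F a.succ q) = L (coordVec a.succ)
      + ((F.c q ^ 2)⁻¹ * F.rel q (R.Nbar F q) a) • L (F.B q)
      - ((F.c q ^ 2)⁻¹ * F.rel q (R.P F q) a) • L (R.H F q) := by
  rw [e, map_sub, map_add, map_smul, map_smul, Fluid.lower_succ, Fluid.lower_succ]

lemma P_time (hq : q ∈ R.lateral) : R.P F q 0 = 0 := by
  simp [P, hR.Nbar_time hF hq, hR.N_time (hR.lateral_subset hq)]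

/-- The combination of derivatives in directions tangent to the lateral boundary that enters the
first product: by the Euler equations it equals `-g(N̲, N̲) ∂_a v^a`. -/
lemma tangBrace_eq (hq : q ∈ R.lateral) :
    R.tangBrace F q = -F.g q (R.Nbar F q) (R.Nbar F q) * F.divVel q := by
  have hqr := hR.lateral_subset hq
  have hc := (hR.c_pos hF hqr).ne'
  have hmass := hF.mass q hqr
  have hmom := hF.momentum q hqr
  have hP := hR.P_time hF hq
  have hN := hR.Nbar_time hF hq
  have hS : ∀ k : Fin 3, F.S q k.succ = fderiv ℝ F.ent q (coordVec k.succ) := fun k => rfl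
  have hg : F.g q (R.Nbar F q) (R.Nbar F q)
      = -1 + (F.c q ^ 2)⁻¹ * ∑ a : Fin 3, F.rel q (R.Nbar F q) a * F.rel q (R.Nbar F q) a := by
    simp only [Fluid.g, hN, Fluid.rel]
    ring
  have hdiag : ∀ f : Fin 3 → Fin 3 → ℝ, (∑ a : Fin 3, ∑ b : Fin 3,
      (if a = b then F.c q ^ 2 else 0) * f a b) = F.c q ^ 2 * ∑ a, f a a := by
    intro f
    simp [Finset.mul_sum]
  rw [tangBrace]
  simp only [mul_assoc]
  rw [hdiag fun a b => F.lower q (R.Nbar F q) a.succ * fderiv ℝ F.rho q (R.e F b.succ q)]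
  have hev : ∀ a : Fin 3, fderiv ℝ F.vel q (R.e F a.succ q) a
      = fderiv ℝ F.vel q (coordVec a.succ) a
        + ((F.c q ^ 2)⁻¹ * F.rel q (R.Nbar F q) a) * fderiv ℝ F.vel q (F.B q) a
        - ((F.c q ^ 2)⁻¹ * F.rel q (R.P F q) a) * fderiv ℝ F.vel q (R.H F q) a := by
    intro a
    rw [e_map]
    rfl
  have hPs : ∀ a : Fin 3, R.P F q a.succ = F.rel q (R.P F q) a := fun a =>
    (Fluid.rel_of_zero hP a).symm
  simp only [Fluid.lower_succ, hev, e_map, hmass, hmom, hg, hPs, hS, Fluid.divVel,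
    Fin.sum_univ_three, smul_eq_mul]
  field_simp
  ring

/-- The error integrand of the vorticity is determined by the exterior derivative of the metric
dual of the specific vorticity. All derivatives of `v` and `ρ` are decomposed by
`∂_α = e_α - N̲_α B + P_α H̲`; what remains is a multiple of the divergence of the velocity. -/
lemma errVort_eq (hq : q ∈ R.lateral)
    (hfirst : R.errVortFirst F q = 2 * R.z F q * Real.exp (-2 * F.rho q) * F.pEntBar q
      * (F.c q ^ 4)⁻¹ * F.divVel q * eps4 (R.E F q) (R.tang F q (F.Om q)) (R.Nbar F q)
        (F.S q + R.SNbar F q • F.B q)) :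
    R.errVort F q = -2 * R.z F q * dLower F F.Om q (R.tang F q (F.Om q)) (R.E F q) := by
  have hqr := hR.lateral_subset hq
  have hc := (hR.c_pos hF hqr).ne'
  have hmass := hF.mass q hqr
  have hmom := hF.momentum q hqr
  have hP := hR.P_time hF hq
  have hN := hR.Nbar_time hF hq
  rw [hR.dLower_Om hF hq, errVort, hfirst, hR.normSq_eq hF hq]
  set X := R.tang F q (F.Om q) with hX
  set Y := R.E F q with hY
  have hS : ∀ k : Fin 3, fderiv ℝ F.ent q (coordVec k.succ) = F.S q k.succ := fun k => rfl
  have hsn : R.SNbar F q = (F.c q ^ 2)⁻¹ * ∑ a : Fin 3, F.S q a.succ * F.rel q (R.Nbar F q) a :=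
    Fluid.g_of_spatial (F.S_zero q) _
  have hsp : F.g q (F.S q) (R.P F q) = (F.c q ^ 2)⁻¹ * ∑ a : Fin 3, F.S q a.succ * F.rel q (R.P F q) a :=
    Fluid.g_of_spatial (F.S_zero q) _
  have hlowOm : ∀ a : Fin 3, F.lower q (F.Om q) a.succ = (F.c q ^ 2)⁻¹ * F.Om q a.succ := fun a => by
    rw [Fluid.lower_succ, Fluid.rel_of_zero (F.Om_zero q)]
  have hrelS : F.rel q (F.S q) = fun a => F.S q a.succ :=
    funext fun a => Fluid.rel_of_zero (F.S_zero q) a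
  have hrelspat : ∀ w, F.rel q (spatial w) = w := fun w => funext fun a => by
    rw [Fluid.rel_of_zero (spatial_zero w), spatial_succ]
  have hrelB : F.rel q (F.B q) = fun _ => 0 := funext fun a => Fluid.rel_B a
  have hrelW : F.rel q (F.S q + R.SNbar F q • F.B q) = fun a => F.S q a.succ := funext fun a => by
    simp [Fluid.rel]
    ring
  have hSv : ∀ i : Fin 3, fderiv ℝ F.vel q (F.S q) i
      = ∑ a : Fin 3, F.S q a.succ * fderiv ℝ F.vel q (coordVec a.succ) i := fun i => by
    rw [Fluid.map_eq_rel (F := F) (q := q) (fderiv ℝ F.vel q) (F.S q), hrelS]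
    simp
  have hC : F.modCurl q = spatial fun i =>
      Real.exp (-F.rho q) * curl (fun p j => F.Om p j.succ) q i
        + Real.exp (-3 * F.rho q) * (F.c q ^ 2)⁻¹ * F.pEntBar q * fderiv ℝ F.vel q (F.S q) i
        - Real.exp (-3 * F.rho q) * (F.c q ^ 2)⁻¹ * F.pEntBar q * F.divVel q * F.S q i.succ := rfl
  have he2 : Real.exp (-2 * F.rho q) = Real.exp (-F.rho q) ^ 2 := by
    rw [← Real.exp_nat_mul]; ring_nf
  have he3 : Real.exp (-3 * F.rho q) = Real.exp (-F.rho q) ^ 3 := by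
    rw [← Real.exp_nat_mul]; ring_nf
  have he1 : Real.exp (F.rho q) * Real.exp (-F.rho q) = 1 := by
    rw [← Real.exp_add, add_neg_cancel, Real.exp_zero]
  simp only [Fluid.eps4_eq F q, hrelspat, hrelB, hrelW, hrelS, hC, hP, hN, F.S_zero, F.B_zero,
    spatial_zero, Pi.add_apply, Pi.smul_apply, smul_eq_mul, he2, he3, hlowOm]
  generalize hw : curl (fun p j => F.Om p j.succ) q = w
  simp only [e_map, hmass, Pi.add_apply, Pi.sub_apply, Pi.smul_apply, smul_eq_mul, hmom,
    det3, Fin.sum_univ_three, hSv, hS, hsn, hsp]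
  generalize F.rel q (R.Nbar F q) = n
  generalize F.rel q (R.P F q) = p
  generalize F.rel q X = x
  generalize F.rel q Y = y
  generalize Real.exp (-F.rho q) = ε at *
  generalize Real.exp (F.rho q) = ε' at *
  obtain ⟨m, hm⟩ : ∃ m, m = (F.c q ^ 2)⁻¹ := ⟨_, rfl⟩
  have hm4 : (F.c q ^ 4)⁻¹ = m ^ 2 := by
    rw [hm]
    field_simp
  have hmc : m * F.c q ^ 2 = 1 := by
    rw [hm]
    field_simp
  rw [hm4, ← hm]
  -- the momentum equation brings in `c² ∇ρ` through `S^a e_a v`, and the definition of `𝒞` brings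
  -- in powers of `e^{-ρ}` that the factor `e^ρ` compensates
  linear_combination (norm := (simp only [det3]; ring)) (2 * R.z F q * ε ^ 2 * F.pEntBar q * m ^ 2
      * (F.S q (Fin.succ 0) * n 0 + F.S q (Fin.succ 1) * n 1 + F.S q (Fin.succ 2) * n 2)
      * det3 y x (fun a => fderiv ℝ F.rho q (coordVec a.succ))) * hmc
    + (2 * R.z F q * m * (det3 y x w + ε ^ 2 * m * F.pEntBar q
      * (det3 y x (fun i => F.S q (Fin.succ 0) * fderiv ℝ F.vel q (coordVec (Fin.succ 0)) i
          + F.S q (Fin.succ 1) * fderiv ℝ F.vel q (coordVec (Fin.succ 1)) i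
          + F.S q (Fin.succ 2) * fderiv ℝ F.vel q (coordVec (Fin.succ 2)) i)
        - F.divVel q * det3 y x (fun i => F.S q i.succ)))) * he1

end Region.IsAdmissible

/-! ### The Gram determinant and the first product -/

lemma eps4_add_left (X X' Y Z W : ST) :
    eps4 (X + X') Y Z W = eps4 X Y Z W + eps4 X' Y Z W := by
  simp only [Fluid.eps4_expand, det3, Pi.add_apply]
  ring

lemma eps4_smul_left (a : ℝ) (X Y Z W : ST) : eps4 (a • X) Y Z W = a * eps4 X Y Z W := by
  simp only [Fluid.eps4_expand, det3, Pi.smul_apply, smul_eq_mul]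
  ring

lemma eps4_add_right (X Y Z W W' : ST) :
    eps4 X Y Z (W + W') = eps4 X Y Z W + eps4 X Y Z W' := by
  simp only [Fluid.eps4_expand, det3, Pi.add_apply]
  ring

lemma eps4_smul_right (a : ℝ) (X Y Z W : ST) : eps4 X Y Z (a • W) = a * eps4 X Y Z W := by
  simp only [Fluid.eps4_expand, det3, Pi.smul_apply, smul_eq_mul]
  ring

lemma eps4_self (X Y Z : ST) : eps4 X Y Z X = 0 := by
  simp only [Fluid.eps4_expand, det3]
  ring

lemma eps4_swap (X Y Z W : ST) : eps4 W Y Z X = -eps4 X Y Z W := by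
  simp only [Fluid.eps4_expand, det3]
  ring

namespace Fluid

variable {F : Fluid} {q : ST}

/-- The components of `X` relative to the frame `B, ∂₁, ∂₂, ∂₃`. -/
def frameComp (F : Fluid) (q X : ST) : ST := Fin.cons (X 0) (F.rel q X)

/-- The metric is diagonal in the frame `B, ∂₁, ∂₂, ∂₃`. -/
lemma g_eq_frameComp (X Y : ST) : F.g q X Y = ∑ i : Fin 4, F.frameComp q X i
    * (Fin.cons (-1) (fun _ => (F.c q ^ 2)⁻¹) : Fin 4 → ℝ) i * F.frameComp q Y i := by
  rw [Fin.sum_univ_succ]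
  simp only [g, frameComp, rel, Fin.cons_zero, Fin.cons_succ, Fin.sum_univ_three]
  ring

lemma eps4_frameComp (X Y Z W : ST) :
    eps4 (F.frameComp q X) (F.frameComp q Y) (F.frameComp q Z) (F.frameComp q W)
      = eps4 X Y Z W := by
  rw [eps4_expand, eps4_eq F q]
  rfl

/-- The Gram determinant of four vectors, in terms of the `ε`-contraction. -/
lemma det_gram (V : Fin 4 → ST) : Matrix.det (Matrix.of fun i j => F.g q (V i) (V j))
    = -((F.c q ^ 2)⁻¹ ^ 3 * eps4 (V 0) (V 1) (V 2) (V 3) ^ 2) := by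
  set M : Matrix (Fin 4) (Fin 4) ℝ := Matrix.of fun i j => F.frameComp q (V i) j with hM
  have h1 : (Matrix.of fun i j => F.g q (V i) (V j)) = M * Matrix.diagonal
      (Fin.cons (-1) (fun _ => (F.c q ^ 2)⁻¹) : Fin 4 → ℝ) * M.transpose := by
    ext i j
    rw [Matrix.mul_apply]
    simp only [Matrix.mul_diagonal, Matrix.transpose_apply, Matrix.of_apply, hM]
    exact g_eq_frameComp _ _
  have h2 : M.det = eps4 (V 0) (V 1) (V 2) (V 3) := by
    rw [← eps4_frameComp (F := F) (q := q), eps4]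
    congr 1
    ext i j
    fin_cases i <;> rfl
  rw [h1, Matrix.det_mul, Matrix.det_mul, Matrix.det_transpose, Matrix.det_diagonal, h2,
    Fin.prod_univ_succ]
  simp only [Fin.cons_zero, Fin.cons_succ, Finset.prod_const, Finset.card_univ, Fintype.card_fin]
  ring

/-- Four vectors orthogonal to a nonzero vector are linearly dependent. -/
lemma eps4_eq_zero_of_orthogonal (hc : 0 < F.c q) {H X Y Z W : ST} (hH : H ≠ 0)
    (hX : F.g q H X = 0) (hY : F.g q H Y = 0) (hZ : F.g q H Z = 0) (hW : F.g q H W = 0) :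
    eps4 X Y Z W = 0 := by
  refine Matrix.exists_mulVec_eq_zero_iff.1 ⟨F.lower q H, fun h => hH ?_, ?_⟩
  · refine F.eq_zero_of_g_eq_zero hc fun Y => ?_
    rw [g_eq_sum_lower, h]
    simp
  · have key : ∀ X : ST, X ⬝ᵥ F.lower q H = F.g q H X := fun X => by
      rw [g_eq_sum_lower, dotProduct_comm]
      rfl
    ext i
    fin_cases i
    · exact (key X).trans hX
    · exact (key Y).trans hY
    · exact (key Z).trans hZ
    · exact (key W).trans hW

end Fluid

namespace Region.IsAdmissible

variable {R : Region} {F : Fluid} {q : ST}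
variable (hF : F.IsEulerSolution R.ambient R.region) (hR : R.IsAdmissible F)
include hF hR

/-- A vector orthogonal to the tangent vectors of `S_τ` is a combination of `N̂` and `Z`. -/
lemma eq_of_orthogonal_sphere (hq : q ∈ R.lateral) {X : ST}
    (hX : ∀ Y, R.IsSphereTangent F q Y → F.g q X Y = 0) :
    X = -F.g q (R.Nhat F q) X • R.Nhat F q + F.g q (R.Z F q) X • R.Z F q := by
  have h : R.tang F q X = 0 := by
    refine F.eq_zero_of_g_eq_zero (hR.c_pos hF (hR.lateral_subset hq)) fun Y => ?_
    rw [g_tang_left]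
    exact hX _ (hR.isSphereTangent_tang hF hq Y)
  rw [R.tang_eq F q] at h
  rw [neg_smul]
  linear_combination (exp := 1) h

lemma Nbar_orthogonal_sphere (hq : q ∈ R.lateral) {Y : ST} (hY : R.IsSphereTangent F q Y) :
    F.g q (R.Nbar F q) Y = 0 :=
  hR.isNormalToLateral_Nbar hF hq _ (hR.tangent_of_isSphereTangent hF hq hY)

/-- The relations between the lengths of `N̲` and `H̲`. They follow from
`N̲, H̲ ∈ span {N̂, Z}`, `g(N̲, H̲) = 0` and `N̲ t = H̲ t = 1`. -/
lemma g_Nbar_self (hq : q ∈ R.lateral) :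
    -F.g q (R.Nbar F q) (R.Nbar F q) * R.h F q ^ 2
        = R.z F q ^ 2 * R.nu F q ^ 2 * F.g q (R.H F q) (R.H F q)
      ∧ -F.g q (R.Nbar F q) (R.Nbar F q) * (R.h F q + F.g q (R.H F q) (R.H F q)) ^ 2
        = F.g q (R.H F q) (R.H F q)
          * (R.h F q ^ 2 + F.g q (R.H F q) (R.H F q) * R.nu F q ^ 2) := by
  have hqr := hR.lateral_subset hq
  have hν := (hR.nu_pos hF hqr).ne'
  have hz := (hR.z_pos q hq).ne'
  have hNb := hR.eq_of_orthogonal_sphere hF hq fun Y hY => hR.Nbar_orthogonal_sphere hF hq hY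
  have hH := hR.eq_of_orthogonal_sphere hF hq fun Y hY => hR.g_H_of_isSphereTangent hF hq hY
  have hNN := hR.g_Nhat_self hF hqr
  have hNZ := hR.g_Nhat_Z hF hq
  have hZN : F.g q (R.Z F q) (R.Nhat F q) = 0 := by rw [F.g_comm, hNZ]
  have hZZ := hR.g_Z_self hF hq
  have hzd : F.g q (R.Z F q) (R.Nbar F q) = -R.z F q := by rw [z, neg_neg]
  have hhd : F.g q (R.Nhat F q) (R.H F q) = -(R.h F q / R.nu F q) := by
    rw [Nhat, F.g_smul_left, h, F.g_comm]
    field_simp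
  have hNB : F.g q (R.Nhat F q) (F.B q) = -(R.nu F q)⁻¹ := by
    rw [Nhat, F.g_smul_left, hR.g_N_B hq]
    ring
  have e1 : F.g q (R.Nbar F q) (R.H F q) = 0 := hR.g_Nbar_H hF hq
  have e2 : F.g q (R.Nbar F q) (F.B q) = -1 := hR.g_Nbar_B hF hq
  have e3 : F.g q (R.H F q) (F.B q) = -1 := by rw [F.g_B_right, hR.H_time hq]
  rw [hzd] at hNb
  rw [hhd] at hH
  set β := F.g q (R.Nhat F q) (R.Nbar F q)
  set ζ := F.g q (R.Z F q) (R.H F q)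
  set b := F.g q (R.Z F q) (F.B q) with hb
  have f0 : F.g q (R.Nbar F q) (R.Nbar F q) = -β ^ 2 + R.z F q ^ 2 := by
    rw [hNb]
    simp only [F.g_add_left, F.g_add_right, F.g_smul_left, F.g_smul_right, hNN, hNZ, hZN, hZZ]
    ring
  have f1 : F.g q (R.H F q) (R.H F q) = -(R.h F q / R.nu F q) ^ 2 + ζ ^ 2 := by
    rw [hH]
    simp only [F.g_add_left, F.g_add_right, F.g_smul_left, F.g_smul_right, hNN, hNZ, hZN, hZZ]
    ring
  rw [hNb, hH] at e1
  rw [hNb] at e2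
  rw [hH] at e3
  simp only [F.g_add_left, F.g_add_right, F.g_smul_left, F.g_smul_right, hNN, hNZ, hZN, hZZ, hNB,
    ← hb] at e1 e2 e3
  have g1 : β * R.h F q = R.nu F q * R.z F q * ζ := by
    field_simp at e1
    linear_combination e1
  have g2 : R.z F q * (R.h F q + F.g q (R.H F q) (R.H F q)) = -(R.h F q * ζ) := by
    rw [f1]
    linear_combination R.z F q * R.h F q * e3 + R.h F q * ζ * e2 - ζ * e1
  have g3 : -F.g q (R.Nbar F q) (R.Nbar F q) * R.h F q ^ 2
      = R.z F q ^ 2 * R.nu F q ^ 2 * F.g q (R.H F q) (R.H F q) := by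
    have : R.nu F q ^ 2 * F.g q (R.H F q) (R.H F q) = R.nu F q ^ 2 * ζ ^ 2 - R.h F q ^ 2 := by
      rw [f1]
      field_simp
      ring
    rw [mul_assoc, this, f0]
    linear_combination (β * R.h F q + R.nu F q * R.z F q * ζ) * g1
  refine ⟨g3, ?_⟩
  have g4 : R.nu F q ^ 2 * ζ ^ 2
      = R.h F q ^ 2 + F.g q (R.H F q) (R.H F q) * R.nu F q ^ 2 := by
    rw [f1]
    field_simp
    ring
  refine mul_left_cancel₀ (pow_ne_zero 2 hz) ?_
  rw [← g4]
  linear_combination (-F.g q (R.Nbar F q) (R.Nbar F q))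
    * (R.z F q * (R.h F q + F.g q (R.H F q) (R.H F q)) - R.h F q * ζ) * g2 + ζ ^ 2 * g3

lemma Nbar_ne_zero (hq : q ∈ R.lateral) : R.Nbar F q ≠ 0 := fun h => by
  simpa [h] using hR.Nbar_time hF hq

lemma g_Nbar_self_nonpos (hq : q ∈ R.lateral) : F.g q (R.Nbar F q) (R.Nbar F q) ≤ 0 := by
  rcases hR.causal with h | h
  · exact (h q hq _ (hR.Nbar_ne_zero hF hq) (hR.isNormalToLateral_Nbar hF hq)).le
  · exact (h q hq _ (hR.Nbar_ne_zero hF hq) (hR.isNormalToLateral_Nbar hF hq)).le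

lemma g_H_self_nonneg (hq : q ∈ R.lateral) : 0 ≤ F.g q (R.H F q) (R.H F q) := by
  have hν := hR.nu_pos hF (hR.lateral_subset hq)
  have hz := hR.z_pos q hq
  refine nonneg_of_mul_nonneg_right (a := R.z F q ^ 2 * R.nu F q ^ 2) ?_ (by positivity)
  rw [← (hR.g_Nbar_self hF hq).1]
  exact mul_nonneg (neg_nonneg.2 (hR.g_Nbar_self_nonpos hF hq)) (sq_nonneg _)

lemma U_isSphereTangent (hq : q ∈ R.lateral) : R.IsSphereTangent F q (R.U F q) := by
  have hqr := hR.lateral_subset hq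
  have hh := (hR.h_pos q hq).ne'
  have hNH : F.g q (R.N F q) (R.H F q) = -R.h F q := by rw [h, F.g_comm, neg_neg]
  refine hR.isSphereTangent_of hF hq ?_ ?_
  · simp only [U, F.g_add_right, F.g_sub_right, F.g_smul_right, hR.g_Nbar_B hF hq,
      hR.g_Nbar_H hF hq, SNbar, F.g_comm q (F.S q)]
    ring
  · rw [Nhat, F.g_smul_left]
    simp only [U, F.g_add_right, F.g_sub_right, F.g_smul_right, hR.g_N_B hq, hNH, kCoef,
      F.g_comm q (R.N F q) (F.S q)]
    field_simp
    ring

lemma Y_isSphereTangent (hq : q ∈ R.lateral) : R.IsSphereTangent F q (R.Y F q) := by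
  obtain ⟨h1, h2⟩ := hR.U_isSphereTangent hF hq
  obtain ⟨h3, h4⟩ := hR.Theta_isSphereTangent hF hq
  constructor <;> simp only [Y, F.g_sub_right, F.g_smul_right, h1, h2, h3, h4] <;> ring

omit hF hR in
lemma sphForm_of_isSphereTangent {X Y : ST} (hX : R.IsSphereTangent F q X) :
    R.sphForm F q X Y = F.g q X Y := by
  rw [R.sphForm_eq F q, hX.1, hX.2]
  ring

/-- Up to the sign, the `ε`-contraction of the first product is a volume in the frame
`H̲, N̲, Ω̸, Y`: the remaining contribution is the determinant of vectors orthogonal to `H̲`. -/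
lemma eps4_first (hq : q ∈ R.lateral) (X : ST) (hX : R.IsSphereTangent F q X) :
    eps4 (R.E F q) X (R.Nbar F q) (F.S q + R.SNbar F q • F.B q)
      = -eps4 (R.H F q) X (R.Nbar F q) (R.Y F q) := by
  have hqr := hR.lateral_subset hq
  have hH : R.H F q ≠ 0 := fun h => by simpa [h] using hR.H_time hq
  have h0 : eps4 (R.Theta F q) X (R.Nbar F q) (R.U F q) = 0 :=
    Fluid.eps4_eq_zero_of_orthogonal (hR.c_pos hF hqr) hH
      (hR.g_H_of_isSphereTangent hF hq (hR.Theta_isSphereTangent hF hq))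
      (hR.g_H_of_isSphereTangent hF hq hX) (by rw [F.g_comm, hR.g_Nbar_H hF hq])
      (hR.g_H_of_isSphereTangent hF hq (hR.U_isSphereTangent hF hq))
  have hU : F.S q + R.SNbar F q • F.B q = R.U F q + R.kCoef F q • R.H F q := by
    rw [U]
    abel
  have hY : R.Y F q = R.kCoef F q • R.Theta F q + (-(R.h F q)⁻¹) • R.U F q := by
    rw [Y, neg_smul, sub_eq_add_neg]
  rw [E_eq, hU, hY]
  simp only [eps4_add_left, eps4_smul_left, eps4_add_right, eps4_smul_right, eps4_self, h0,
    eps4_swap (R.H F q) X (R.Nbar F q) (R.Theta F q)]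
  ring

/-- The square of the `ε`-contraction of the first product. -/
lemma eps4_first_sq (hq : q ∈ R.lateral) (X : ST) (hX : R.IsSphereTangent F q X) :
    eps4 (R.E F q) X (R.Nbar F q) (F.S q + R.SNbar F q • F.B q) ^ 2
      = (F.c q ^ 3) ^ 2 * (-F.g q (R.Nbar F q) (R.Nbar F q) * (F.g q (R.H F q) (R.H F q)
        * Matrix.det !![R.sphForm F q X X, R.sphForm F q X (R.Y F q);
            R.sphForm F q X (R.Y F q), R.sphForm F q (R.Y F q) (R.Y F q)])) := by
  have hc := (hR.c_pos hF (hR.lateral_subset hq)).ne'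
  have hY := hR.Y_isSphereTangent hF hq
  have key := F.det_gram (q := q) ![R.H F q, X, R.Nbar F q, R.Y F q]
  have hHN : F.g q (R.H F q) (R.Nbar F q) = 0 := by rw [F.g_comm, hR.g_Nbar_H hF hq]
  have hmat : (Matrix.of fun i j => F.g q ((![R.H F q, X, R.Nbar F q, R.Y F q] : Fin 4 → ST) i)
      ((![R.H F q, X, R.Nbar F q, R.Y F q] : Fin 4 → ST) j))
      = !![F.g q (R.H F q) (R.H F q), 0, 0, 0;
          0, F.g q X X, 0, F.g q X (R.Y F q);
          0, 0, F.g q (R.Nbar F q) (R.Nbar F q), 0;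
          0, F.g q X (R.Y F q), 0, F.g q (R.Y F q) (R.Y F q)] := by
    have a1 := hR.g_H_of_isSphereTangent hF hq hX
    have a2 := hR.g_H_of_isSphereTangent hF hq hY
    have a3 := hR.Nbar_orthogonal_sphere hF hq hX
    have a4 := hR.Nbar_orthogonal_sphere hF hq hY
    ext i j
    fin_cases i <;> fin_cases j <;>
      simp [a1, a2, a3, a4, hHN, F.g_comm q X (R.H F q), F.g_comm q (R.Y F q) (R.H F q),
        F.g_comm q X (R.Nbar F q), F.g_comm q (R.Y F q) (R.Nbar F q), hR.g_Nbar_H hF hq,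
        F.g_comm q (R.Y F q) X]
  rw [hmat, Matrix.det_succ_row_zero, Fin.sum_univ_four] at key
  simp [Matrix.det_fin_three, Fin.succAbove] at key
  rw [hR.eps4_first hF hq X hX, Matrix.det_fin_two_of, sphForm_of_isSphereTangent hX,
    sphForm_of_isSphereTangent hX, sphForm_of_isSphereTangent hY]
  rw [eq_neg_iff_add_eq_zero, add_comm, ← eq_neg_iff_add_eq_zero, inv_mul_eq_iff_eq_mul₀
    (by positivity)] at key
  linear_combination key

end Region.IsAdmissible

namespace Region.IsAdmissible

variable {R : Region} {F : Fluid} {q : ST}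
variable (hF : F.IsEulerSolution R.ambient R.region) (hR : R.IsAdmissible F)
include hF hR

/-- The factor `(h + η²) (h² + η² ν²)^{-1/2}` is the ratio of the lengths of `H̲` and `N̲`; it is
multiplied by the squared length of `N̲` to include the null case. -/
lemma norm_ratio (hq : q ∈ R.lateral) :
    -F.g q (R.Nbar F q) (R.Nbar F q) * ((R.h F q + R.eta F q ^ 2)
        / Real.sqrt (R.h F q ^ 2 + R.eta F q ^ 2 * R.nu F q ^ 2))
      = Real.sqrt (-F.g q (R.Nbar F q) (R.Nbar F q)) * R.eta F q := by
  have hh := hR.h_pos q hq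
  have hη : R.eta F q ^ 2 = F.g q (R.H F q) (R.H F q) := Real.sq_sqrt (hR.g_H_self_nonneg hF hq)
  have hη0 : 0 ≤ R.eta F q := Real.sqrt_nonneg _
  have hA := neg_nonneg.2 (hR.g_Nbar_self_nonpos hF hq)
  have hrel := (hR.g_Nbar_self hF hq).2
  rw [← hη] at hrel
  set A := -F.g q (R.Nbar F q) (R.Nbar F q)
  set D := R.h F q ^ 2 + R.eta F q ^ 2 * R.nu F q ^ 2
  have hD : 0 < Real.sqrt D := Real.sqrt_pos.2 (by positivity)
  have key : Real.sqrt A * (R.h F q + R.eta F q ^ 2) = R.eta F q * Real.sqrt D := by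
    rw [← Real.sqrt_sq (by positivity : 0 ≤ R.h F q + R.eta F q ^ 2), ← Real.sqrt_mul hA, hrel,
      Real.sqrt_mul (sq_nonneg _), Real.sqrt_sq hη0]
  rw [mul_div_assoc', div_eq_iff hD.ne']
  linear_combination Real.sqrt A * key
    - (R.h F q + R.eta F q ^ 2) * Real.sq_sqrt hA

/-- The first product of the error integrand of the vorticity is the contribution of the
divergence of the velocity to the exterior derivative of the metric dual of the specific
vorticity. -/
lemma errVortFirst_eq (hq : q ∈ R.lateral) :
    R.errVortFirst F q = 2 * R.z F q * Real.exp (-2 * F.rho q) * F.pEntBar q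
      * (F.c q ^ 4)⁻¹ * F.divVel q * eps4 (R.E F q) (R.tang F q (F.Om q)) (R.Nbar F q)
        (F.S q + R.SNbar F q • F.B q) := by
  have hc := hR.c_pos hF (hR.lateral_subset hq)
  have hsq := hR.eps4_first_sq hF hq _ (hR.isSphereTangent_tang hF hq (F.Om q))
  have hA := neg_nonneg.2 (hR.g_Nbar_self_nonpos hF hq)
  have hratio := hR.norm_ratio hF hq
  rw [errVortFirst, hR.tangBrace_eq hF hq, gramFactor, sgn]
  set w := eps4 (R.E F q) (R.tang F q (F.Om q)) (R.Nbar F q) (F.S q + R.SNbar F q • F.B q)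
  set A := -F.g q (R.Nbar F q) (R.Nbar F q)
  set D := Matrix.det !![R.sphForm F q (R.tang F q (F.Om q)) (R.tang F q (F.Om q)),
           R.sphForm F q (R.tang F q (F.Om q)) (R.Y F q);
           R.sphForm F q (R.tang F q (F.Om q)) (R.Y F q),
           R.sphForm F q (R.Y F q) (R.Y F q)]
  set ρ := (R.h F q + R.eta F q ^ 2) / Real.sqrt (R.h F q ^ 2 + R.eta F q ^ 2 * R.nu F q ^ 2)
  have habs : |w| = F.c q ^ 3 * (Real.sqrt A * R.eta F q * Real.sqrt D) := by
    rw [← Real.sqrt_sq_eq_abs, hsq, Real.sqrt_mul (sq_nonneg _), Real.sqrt_sq (by positivity),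
      Real.sqrt_mul hA, Real.sqrt_mul (hR.g_H_self_nonneg hF hq), eta]
    ring
  have hw : Real.sign w * |w| = w := by
    rcases lt_trichotomy w 0 with h | h | h
    · rw [Real.sign_of_neg h, abs_of_neg h]; ring
    · simp [h]
    · rw [Real.sign_of_pos h, abs_of_pos h]; ring
  have hfin : F.c q ^ 3 * (Real.sign w * (A * ρ * Real.sqrt D)) = w := by
    rw [hratio, mul_left_comm, ← habs, hw]
  have hc4 : (F.c q ^ 4)⁻¹ * F.c q ^ 3 = (F.c q)⁻¹ := by field_simp
  rw [← hc4]
  linear_combination (2 * R.z F q * Real.exp (-2 * F.rho q) * F.pEntBar q * (F.c q ^ 4)⁻¹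
    * F.divVel q) * hfin

lemma errVortFirst_eq_detProduct (hq : q ∈ R.lateral) : R.errVortFirst F q
    = -2 * R.z F q * (F.c q ^ 4)⁻¹ * Real.exp (-2 * F.rho q) * F.pEntBar q
      * R.detProduct F q := by
  have hc := hR.c_pos hF (hR.lateral_subset hq)
  rw [errVortFirst, detProduct]
  field_simp

lemma errVortFirst_eq_zero (hnull : R.LateralNull F) (hq : q ∈ R.lateral) :
    R.errVortFirst F q = 0 := by
  rw [errVortFirst, hR.tangBrace_eq hF hq,
    hnull q hq _ (hR.Nbar_ne_zero hF hq) (hR.isNormalToLateral_Nbar hF hq)]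
  ring

end Region.IsAdmissible

end EulerBdry

end

theorem proposition6p1 (F : EulerBdry.Fluid) (R : EulerBdry.Region)
    (hF : F.IsEulerSolution R.ambient R.region) (hR : R.IsAdmissible F) :
    -- the lapse is positive
    (∀ q ∈ R.lateral, 0 < R.lapse F q) ∧
    -- the two integral identities
    (∀ W : EulerBdry.ST → ℝ, ContDiffOn ℝ (∞ : ℕ∞ω) W R.region → ∀ τ ∈ Set.Icc 0 R.T,
      EulerBdry.BoundaryIdentity R F W F.Om (R.errVort F) τ ∧
      EulerBdry.BoundaryIdentity R F W F.S (R.errEnt F) τ) ∧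
    -- the first product in the vorticity error integrand, and its vanishing in the null case
    (∀ q ∈ R.lateral, R.errVortFirst F q =
      -2 * R.z F q * (F.c q ^ 4)⁻¹ * Real.exp (-2 * F.rho q) * F.pEntBar q * R.detProduct F q) ∧
    (R.LateralNull F → ∀ q ∈ R.lateral, R.errVortFirst F q = 0) := by
  refine ⟨fun q hq => hR.lapse_pos hF hq, fun W hW τ hτ => ⟨?_, ?_⟩,
    fun q hq => hR.errVortFirst_eq_detProduct hF hq,
    fun hnull q hq => hR.errVortFirst_eq_zero hF hnull hq⟩
  · exact hR.boundaryIdentity hF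
      (fun p hp => hF.Om_contDiffAt hR.ambient_open (hR.mem_goodSet hF (hR.lateral_subset hp)))
      F.Om_zero (hW.mono hR.lateral_subset)
      (fun q hq => hR.errVort_eq hF hq (hR.errVortFirst_eq hF hq)) hτ
  · exact hR.boundaryIdentity hF
      (fun p hp => hF.S_contDiffAt hR.ambient_open (hR.region_subset (hR.lateral_subset hp)))
      F.S_zero (hW.mono hR.lateral_subset) (fun q hq => hR.errEnt_eq hF hq) hτ
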